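/- Let $\Omega\subset\mathbb R^3$ be a nonempty bounded convex open set with $C^2$ boundary and outward unit normal $\mathbf n$, let $\tau>0$, $Q_\tau=(0,\tau)\times\Omega$, $\mathcal S^2=\{\beta\in\mathbb R^3:|\beta|=1\}$, $\mathcal X=\Omega\times\mathcal S^2$, and $$\partial\Omega_{\pm}=\{(x,\beta)\in\partial\Omega\times\mathcal S^2:\ \pm\,\beta\cdot\mathbf n(x)>0\},\qquad L^2_{\pm}=L^2(\partial\Omega_\pm;\ \pm\beta\cdot\mathbf n\,d\Gamma\,d\beta).$$ Let $\mathcal W=\{v\in L^2(\mathcal X):\ \beta\cdot\nabla_x v\in L^2(\mathcal X),\ v|_{\partial\Omega_+}\in L^2_+\}$, where $\beta\cdot\nabla_x v$ is the weak derivative and the trace of $v$ on $\partial\Omega\times\mathcal S^2$ is understood through Green's formula. Let $W^{2,1}_2(Q_\tau)$ be the space of all $\phi\in L^2(Q_\tau)$ whose weak derivatives $\phi_t,\phi_{x_i},\phi_{x_ix_j}$ belong to $L^2(Q_\tau)$, with its Hilbert norm. There is a constant $C_2>0$ depending only on $\tau$ and $\Omega$ such that the following holds for every nonnegative $I_b\in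 L^2(0,\tau;L^2_-)$. 1. For every $T\in W^{2,1}_2(Q_\tau)$ one has $T^4\in L^2(Q_\tau)$, and the radiative transfer problem $$I(t,x,\beta)+\beta\cdot\nabla_x I(t,x,\beta)=T^4(t,x)\ \text{ in }(0,\tau)\times\mathcal X,\qquad I=I_b\ \text{ on }(0,\tau)\times\partial\Omega_-,$$ has a unique solution $I\in L^2(0,\tau;\mathcal W)$; this solution is nonnegative. 2. The map $T\mapsto G$, where $G(t,x)=\int_{\mathcal S^2}I(t,x,\beta)\,d\beta$ and $I$ is the solution in 1, is a well-defined and continuous map from $W^{2,1}_2(Q_\tau)$ to $L^2(Q_\tau)$, and for every $T\in W^{2,1}_2(Q_\tau)$ $$\|G\|_{L^2(Q_\tau)}\le C_2\left(\|T\|_{W^{2,1}_2(Q_\tau)}^4+\|I_b\|_{L^2(0,\tau;L^2_-)}\right).$$ -/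

import Mathlib

open MeasureTheory Set
open scoped ENNReal ContDiff

noncomputable section

namespace RadTransfer

/-- Physical space `ℝ³` with the Euclidean norm. -/
abbrev E3 : Type := EuclideanSpace ℝ (Fin 3)

/-- The unit sphere of directions. -/
abbrev S2 : Type := Metric.sphere (0 : E3) 1

/-! ### Domains with `C²` boundary -/

/-- `ρ` is a `C²` defining function of `Ω` on the open set `U`: its gradient does not vanish on `U`,
and inside `U` the set `Ω` is exactly `{ρ < 0}`. -/
def IsC2DefiningFunction (Ω U : Set E3) (ρ : E3 → ℝ) : Prop :=
  IsOpen U ∧ ContDiffOn ℝ 2 ρ U ∧ (∀ x ∈ U, gradient ρ x ≠ 0) ∧ Ω ∩ U = {x ∈ U | ρ x < 0}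

/-- `Ω` has a `C²` boundary: near each boundary point there is a `C²` defining function. -/
def HasC2Boundary (Ω : Set E3) : Prop :=
  ∀ x ∈ frontier Ω, ∃ (U : Set E3) (ρ : E3 → ℝ), x ∈ U ∧ IsC2DefiningFunction Ω U ρ

/-- `ν` is the outward unit normal at the boundary point `x`, that is `∇ρ / |∇ρ|` for a
local defining function `ρ`. -/
def IsOutwardNormal (Ω : Set E3) (x ν : E3) : Prop :=
  x ∈ frontier Ω ∧ ∃ (U : Set E3) (ρ : E3 → ℝ), x ∈ U ∧ IsC2DefiningFunction Ω U ρ ∧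
    ν = ‖gradient ρ x‖⁻¹ • gradient ρ x

open Classical in
/-- The outward unit normal field on the boundary (extended by `0` off the boundary). -/
def outwardNormal (Ω : Set E3) (x : E3) : E3 :=
  if h : ∃ ν, IsOutwardNormal Ω x ν then h.choose else 0

/-- `β · n(x)` for `(x, β) ∈ ∂Ω × S²`. -/
def normalFlux (Ω : Set E3) (z : E3 × S2) : ℝ :=
  inner ℝ (z.2 : E3) (outwardNormal Ω z.1)

/-- `∂Ω₋`. -/
def inflowBoundary (Ω : Set E3) : Set (E3 × S2) :=
  {z | z.1 ∈ frontier Ω ∧ normalFlux Ω z < 0}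

/-- `∂Ω₊`. -/
def outflowBoundary (Ω : Set E3) : Set (E3 × S2) :=
  {z | z.1 ∈ frontier Ω ∧ 0 < normalFlux Ω z}

/-! ### Measures -/

/-- The surface measure `dβ` on the unit sphere (total mass `4π`). -/
def sphereMeasure : Measure S2 := (volume : Measure E3).toSphere

/-- The surface measure `dΓ` on `∂Ω`: the two-dimensional Hausdorff measure, normalised so as to
agree with Lebesgue measure on planes. -/
def surfaceMeasure (Ω : Set E3) : Measure E3 := (μHE[2] : Measure E3).restrict (frontier Ω)

/-- `dx dβ` on `𝒳 = Ω × S²`. -/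
def phaseMeasure (Ω : Set E3) : Measure (E3 × S2) := (volume.restrict Ω).prod sphereMeasure

/-- `dΓ dβ` on `∂Ω × S²`. -/
def boundaryMeasure (Ω : Set E3) : Measure (E3 × S2) := (surfaceMeasure Ω).prod sphereMeasure

/-- `-β·n dΓ dβ` on `∂Ω₋`. -/
def inflowMeasure (Ω : Set E3) : Measure (E3 × S2) :=
  ((boundaryMeasure Ω).restrict (inflowBoundary Ω)).withDensity
    fun z => ENNReal.ofReal (-normalFlux Ω z)

/-- `β·n dΓ dβ` on `∂Ω₊`. -/
def outflowMeasure (Ω : Set E3) : Measure (E3 × S2) :=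
  ((boundaryMeasure Ω).restrict (outflowBoundary Ω)).withDensity
    fun z => ENNReal.ofReal (normalFlux Ω z)

/-- Lebesgue measure on the time interval `(0, τ)`. -/
def timeMeasure (τ : ℝ) : Measure ℝ := volume.restrict (Ioo 0 τ)

/-- Lebesgue measure on `Q_τ = (0, τ) × Ω`. -/
def cylinderMeasure (Ω : Set E3) (τ : ℝ) : Measure (ℝ × E3) :=
  (timeMeasure τ).prod (volume.restrict Ω)

/-- The space `L²(Q_τ)`. -/
abbrev L2Q (Ω : Set E3) (τ : ℝ) : Type := Lp ℝ 2 (cylinderMeasure Ω τ)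

/-! ### The parabolic Sobolev space `W^{2,1}_2(Q_τ)` -/

/-- `w` is the weak derivative of `u` on `Q_τ` in the space-time direction `e`. -/
def HasWeakDeriv {Ω : Set E3} {τ : ℝ} (u w : L2Q Ω τ) (e : ℝ × E3) : Prop :=
  ∀ φ : ℝ × E3 → ℝ, ContDiff ℝ ∞ φ → HasCompactSupport φ → tsupport φ ⊆ Ioo 0 τ ×ˢ Ω →
    ∫ z, u z * fderiv ℝ φ z e ∂(cylinderMeasure Ω τ) = -∫ z, w z * φ z ∂(cylinderMeasure Ω τ)

instance (Ω : Set E3) (τ : ℝ) : IsFiniteMeasureOnCompacts (cylinderMeasure Ω τ) := by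
  unfold cylinderMeasure timeMeasure
  rw [Measure.prod_restrict]
  infer_instance

theorem integrable_mul_test {Ω : Set E3} {τ : ℝ} (u : L2Q Ω τ) {ψ : ℝ × E3 → ℝ}
    (hψ : Continuous ψ) (hc : HasCompactSupport ψ) :
    Integrable (fun z => u z * ψ z) (cylinderMeasure Ω τ) :=
  MemLp.integrable_mul (p := 2) (q := 2) (Lp.memLp u) (hψ.memLp_of_hasCompactSupport hc)

theorem integrable_mul_fderiv_test {Ω : Set E3} {τ : ℝ} (u : L2Q Ω τ) {φ : ℝ × E3 → ℝ}
    (hφ : ContDiff ℝ ∞ φ) (hc : HasCompactSupport φ) (e : ℝ × E3) :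
    Integrable (fun z => u z * fderiv ℝ φ z e) (cylinderMeasure Ω τ) :=
  integrable_mul_test u ((hφ.continuous_fderiv (by simp)).clm_apply continuous_const)
    (hc.fderiv_apply (𝕜 := ℝ) e)

theorem HasWeakDeriv.zero {Ω : Set E3} {τ : ℝ} (e : ℝ × E3) :
    HasWeakDeriv (0 : L2Q Ω τ) 0 e := by
  intro φ _ _ _
  have h0 := Lp.coeFn_zero ℝ 2 (cylinderMeasure Ω τ)
  rw [integral_congr_ae (g := fun _ => (0 : ℝ)) (by filter_upwards [h0] with z hz; rw [hz]; simp),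
    integral_congr_ae (f := fun z => (0 : L2Q Ω τ) z * φ z) (g := fun _ => (0 : ℝ))
      (by filter_upwards [h0] with z hz; rw [hz]; simp)]
  simp

theorem HasWeakDeriv.add {Ω : Set E3} {τ : ℝ} {u v w y : L2Q Ω τ} {e : ℝ × E3}
    (h : HasWeakDeriv u w e) (h' : HasWeakDeriv v y e) : HasWeakDeriv (u + v) (w + y) e := by
  intro φ hφ hc hs
  rw [integral_congr_ae (g := fun z => u z * fderiv ℝ φ z e + v z * fderiv ℝ φ z e)
      (by filter_upwards [Lp.coeFn_add u v] with z hz; rw [hz, Pi.add_apply, add_mul]),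
    integral_congr_ae (f := fun z => (w + y) z * φ z) (g := fun z => w z * φ z + y z * φ z)
      (by filter_upwards [Lp.coeFn_add w y] with z hz; rw [hz, Pi.add_apply, add_mul]),
    integral_add (integrable_mul_fderiv_test u hφ hc e) (integrable_mul_fderiv_test v hφ hc e),
    integral_add (integrable_mul_test w hφ.continuous hc)
      (integrable_mul_test y hφ.continuous hc), h φ hφ hc hs, h' φ hφ hc hs]
  ring

theorem HasWeakDeriv.smul {Ω : Set E3} {τ : ℝ} {u w : L2Q Ω τ} {e : ℝ × E3} (c : ℝ)
    (h : HasWeakDeriv u w e) : HasWeakDeriv (c • u) (c • w) e := by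
  intro φ hφ hc hs
  rw [integral_congr_ae (g := fun z => c * (u z * fderiv ℝ φ z e))
      (by filter_upwards [Lp.coeFn_smul c u] with z hz; rw [hz, Pi.smul_apply, smul_eq_mul, mul_assoc]),
    integral_congr_ae (f := fun z => (c • w) z * φ z) (g := fun z => c * (w z * φ z))
      (by filter_upwards [Lp.coeFn_smul c w] with z hz; rw [hz, Pi.smul_apply, smul_eq_mul, mul_assoc]),
    integral_const_mul, integral_const_mul, h φ hφ hc hs]
  ring

/-- Labels for `φ`, `φ_t`, `φ_{x_i}`, `φ_{x_i x_j}`. -/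
inductive W21Index : Type
  | val : W21Index
  | dt : W21Index
  | dx (i : Fin 3) : W21Index
  | dxx (i j : Fin 3) : W21Index
  deriving DecidableEq, Fintype

/-- The direction of the time variable. -/
def timeDir : ℝ × E3 := (1, 0)

/-- The direction of the space variable `x_i`. -/
def spaceDir (i : Fin 3) : ℝ × E3 := (0, EuclideanSpace.single i 1)

/-- The Sobolev space `W^{2,1}_2(Q_τ)`. An element is a function of `L²(Q_τ)` listed together with
its weak derivatives `φ_t, φ_{x_i}, φ_{x_i x_j} ∈ L²(Q_τ)`, which it determines uniquely. The norm
induced from `PiLp 2` is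
`(‖φ‖² + ‖φ_t‖² + ∑ i, ‖φ_{x_i}‖² + ∑ i j, ‖φ_{x_i x_j}‖²)^{1/2}`. -/
def W21 (Ω : Set E3) (τ : ℝ) : Submodule ℝ (PiLp 2 fun _ : W21Index => L2Q Ω τ) where
  carrier := {p | HasWeakDeriv (p .val) (p .dt) timeDir ∧
    (∀ i, HasWeakDeriv (p .val) (p (.dx i)) (spaceDir i)) ∧
    ∀ i j, HasWeakDeriv (p (.dx i)) (p (.dxx i j)) (spaceDir j)}
  add_mem' h h' := ⟨h.1.add h'.1, fun i => (h.2.1 i).add (h'.2.1 i),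
    fun i j => (h.2.2 i j).add (h'.2.2 i j)⟩
  zero_mem' := ⟨.zero _, fun _ => .zero _, fun _ _ => .zero _⟩
  smul_mem' c _ h := ⟨h.1.smul c, fun i => (h.2.1 i).smul c, fun i j => (h.2.2 i j).smul c⟩

/-- The function `T⁴` on `Q_τ`, for `T ∈ W^{2,1}_2(Q_τ)`. -/
def fourthPower {Ω : Set E3} {τ : ℝ} (T : W21 Ω τ) (q : ℝ × E3) : ℝ :=
  ((T : PiLp 2 fun _ : W21Index => L2Q Ω τ) .val) q ^ 4

/-! ### The transport space and the radiative transfer equation -/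

/-- The derivative `β · ∇_x φ(x, β)` of a test function. Test functions on `ℝ³ × S²` are the
restrictions of test functions on `ℝ³ × ℝ³`. -/
def transportDeriv (φ : E3 × E3 → ℝ) (z : E3 × S2) : ℝ :=
  fderiv ℝ (fun x => φ (x, (z.2 : E3))) z.1 (z.2 : E3)

/-- `D = β · ∇_x v` weakly on `𝒳 = Ω × S²`. -/
def IsWeakTransportDeriv (Ω : Set E3) (v D : E3 × S2 → ℝ) : Prop :=
  ∀ φ : E3 × E3 → ℝ, ContDiff ℝ ∞ φ → HasCompactSupport φ → tsupport φ ⊆ Ω ×ˢ univ →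
    ∫ z, v z * transportDeriv φ z ∂(phaseMeasure Ω) =
      -∫ z, D z * φ (z.1, (z.2 : E3)) ∂(phaseMeasure Ω)

/-- `γ` is the trace on `∂Ω × S²` of `v`, where `D = β · ∇_x v`: it is integrable with respect to
`|β·n| dΓ dβ` and Green's formula
`∫ (β·∇v) φ + ∫ v (β·∇φ) = ∫_{∂Ω × S²} (β·n) γ φ dΓ dβ` holds for all test functions `φ`,
which need not vanish near the boundary. -/
def IsTrace (Ω : Set E3) (v D γ : E3 × S2 → ℝ) : Prop :=
  Integrable (fun z => normalFlux Ω z * γ z) (boundaryMeasure Ω) ∧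
  ∀ φ : E3 × E3 → ℝ, ContDiff ℝ ∞ φ → HasCompactSupport φ →
    ∫ z, D z * φ (z.1, (z.2 : E3)) ∂(phaseMeasure Ω) +
        ∫ z, v z * transportDeriv φ z ∂(phaseMeasure Ω) =
      ∫ z, normalFlux Ω z * γ z * φ (z.1, (z.2 : E3)) ∂(boundaryMeasure Ω)

/-- `I ∈ L²(0, τ; 𝒲)`, where `𝒲 = {v ∈ L²(𝒳) : β·∇_x v ∈ L²(𝒳), v|_{∂Ω₊} ∈ L²₊}`, with
`D = β·∇_x I` and with trace `γ` on `(0, τ) × ∂Ω × S²`. -/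
structure MemL2W (Ω : Set E3) (τ : ℝ) (I D γ : ℝ × E3 × S2 → ℝ) : Prop where
  memLp : MemLp I 2 ((timeMeasure τ).prod (phaseMeasure Ω))
  memLp_deriv : MemLp D 2 ((timeMeasure τ).prod (phaseMeasure Ω))
  memLp_outflow : MemLp γ 2 ((timeMeasure τ).prod (outflowMeasure Ω))
  deriv : ∀ᵐ t ∂(timeMeasure τ),
    IsWeakTransportDeriv Ω (fun z => I (t, z)) (fun z => D (t, z))
  trace : ∀ᵐ t ∂(timeMeasure τ),
    IsTrace Ω (fun z => I (t, z)) (fun z => D (t, z)) (fun z => γ (t, z))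

/-- `I ∈ L²(0, τ; 𝒲)` solves the radiative transfer equation
`I + β·∇_x I = S(t, x)` in `(0, τ) × Ω × S²`, `I = I_b` on `(0, τ) × ∂Ω₋`. -/
def IsRTESolution (Ω : Set E3) (τ : ℝ) (S : ℝ × E3 → ℝ) (Ib I : ℝ × E3 × S2 → ℝ) : Prop :=
  ∃ D γ : ℝ × E3 × S2 → ℝ, MemL2W Ω τ I D γ ∧
    (∀ᵐ p ∂((timeMeasure τ).prod (phaseMeasure Ω)), I p + D p = S (p.1, p.2.1)) ∧
    ∀ᵐ p ∂((timeMeasure τ).prod (inflowMeasure Ω)), γ p = Ib p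

/-- The norm of `L²(0, τ; L²₋)`. -/
def inflowNorm (Ω : Set E3) (τ : ℝ) (Ib : ℝ × E3 × S2 → ℝ) : ℝ :=
  (eLpNorm Ib 2 ((timeMeasure τ).prod (inflowMeasure Ω))).toReal

end RadTransfer

end

open MeasureTheory Set
open scoped ENNReal ContDiff

noncomputable section

namespace RadTransfer

/-! The proof joins a parabolic Sobolev embedding, which puts `T ^ 4` in `L²`, to an explicit
solution of the transport equation along chords, for which existence, positivity, Green's formula
and all bounds can be read off.

Embedding (`exists_eLpNorm_eight_le`). Space-time has parabolic dimension `2 + 3 = 5`, so `u_t,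
u_{x_i x_j} ∈ L²` should give every exponent up to `10`; only `8` is needed, and the slack allows
crude estimates. The cylinder is stable under the contractions `w ↦ z + dil (μ ^ 2) μ (w - z)` with
`z ∈ Q`, because it is a product of convex sets. Hence kernels rescaled about any `z ∈ Q` remain
test functions, and no extension across the boundary is required. Average `u` at scale `μ` against a
kernel of mass one with vanishing first spatial moments. Its scale derivative is a time derivative
plus second spatial derivatives of compactly supported kernels (`euler_momentKernel`), so the
`μ`-derivative of the average is at most a constant times `μ` times a contracted average of `|u_t| +
∑ |u_{x_i x_j}|`. Integrating from `ε` to `1/2` and letting `ε → 0` bounds `u` by a potential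
(`ae_enorm_le_potential`), which Hölder's inequality places in `L⁸` (`lintegral_potential_pow_le`).

Geometry. In a convex domain a line of direction `β` that meets `Ω` has exactly one entry and one
exit point. The measure `|β·n| dΓ` on entry points is the area of their projection along `β`
(`volume_proj_inflow`), and the same holds for exit points. Two facts follow: `dx dβ` is the flux
measure times arclength on chords (`map_chordMap`), and the map from start to end of a chord carries
the inflow measure to the outflow measure (`map_chordEnd`).

Transport. On a chord the equation is a linear ODE with solution `exp (-r) * (c + ∫ exp σ * f σ)`,
nonnegative for nonnegative data and bounded in `L²` since chords have bounded length. Integration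
by parts on each chord is Green's formula (`isTrace_raySolution`). Uniqueness is by duality: for
each smooth `ψ` compactly supported over `Ω`, the equation `β·∇φ - φ = ψ` has a smooth solution
vanishing on the outflow boundary. Inserting it in Green's formula shows that the difference of two
solutions is orthogonal to every `ψ` (`ae_eq_of_isTrace`).

Continuity and the estimate. For fixed inflow data, differences of solutions depend only on
differences of sources, so `G` is Lipschitz in the source; `T ↦ T ^ 4` is locally Lipschitz into
`L²` by Hölder and the `L⁸` embedding (`lintegral_fourthPower_sub_sq`). -/

/-! ### Anisotropic dilations of space-time -/

/-- The dilation `(t, x) ↦ (a t, b x)` of space-time. -/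
def dil (a b : ℝ) : ℝ × E3 →L[ℝ] ℝ × E3 :=
  (a • ContinuousLinearMap.id ℝ ℝ).prodMap (b • ContinuousLinearMap.id ℝ E3)

@[simp] theorem dil_apply (a b : ℝ) (z : ℝ × E3) : dil a b z = (a * z.1, b • z.2) := by
  rfl

instance : (volume : Measure (ℝ × E3)).IsAddHaarMeasure :=
  inferInstanceAs ((volume : Measure ℝ).prod (volume : Measure E3)).IsAddHaarMeasure

theorem det_dil (a b : ℝ) : LinearMap.det (dil a b : ℝ × E3 →ₗ[ℝ] ℝ × E3) = a * b ^ 3 := by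
  have : (dil a b : ℝ × E3 →ₗ[ℝ] ℝ × E3) =
      (a • LinearMap.id (R := ℝ) (M := ℝ)).prodMap (b • LinearMap.id (R := ℝ) (M := E3)) := by
    ext z <;> simp
  rw [this, LinearMap.det_prodMap]
  simp [LinearMap.det_smul]

theorem map_dil {a b : ℝ} (ha : 0 < a) (hb : 0 < b) :
    (volume : Measure (ℝ × E3)).map (dil a b) = ENNReal.ofReal (a * b ^ 3)⁻¹ • volume := by
  have h := Measure.map_linearMap_addHaar_eq_smul_addHaar (volume : Measure (ℝ × E3))
    (f := (dil a b : ℝ × E3 →ₗ[ℝ] ℝ × E3)) (by rw [det_dil]; positivity)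
  rw [det_dil, abs_of_pos (by positivity)] at h
  exact h

theorem lintegral_dil {a b : ℝ} (ha : 0 < a) (hb : 0 < b) (c : ℝ × E3) {g : ℝ × E3 → ℝ≥0∞}
    (hg : Measurable g) :
    ∫⁻ z, g (dil a b z + c) = ENNReal.ofReal (a * b ^ 3)⁻¹ * ∫⁻ z, g z := by
  have h : ∫⁻ z, g (z + c) ∂((volume : Measure (ℝ × E3)).map (dil a b)) =
      ∫⁻ z, g (dil a b z + c) := by
    rw [lintegral_map (by fun_prop) (by fun_prop)]
  rw [← h, map_dil ha hb, lintegral_smul_measure, lintegral_add_right_eq_self]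
  rfl

theorem integral_dil {a b : ℝ} (ha : 0 < a) (hb : 0 < b) (c : ℝ × E3) (g : ℝ × E3 → ℝ) :
    ∫ z, g (dil a b z + c) = (a * b ^ 3)⁻¹ * ∫ z, g z := by
  have hemb : MeasurableEmbedding (dil a b) := by
    have : Topology.IsClosedEmbedding (dil a b) := by
      apply LinearMap.isClosedEmbedding_of_injective (f := (dil a b : ℝ × E3 →ₗ[ℝ] ℝ × E3))
      rw [LinearMap.ker_eq_bot]
      intro z w h
      have h1 : a * z.1 = a * w.1 := by simpa using congrArg Prod.fst h
      have h2 : b • z.2 = b • w.2 := by simpa using congrArg Prod.snd h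
      exact Prod.ext (mul_left_cancel₀ ha.ne' h1) (smul_right_injective _ hb.ne' h2)
    exact this.measurableEmbedding
  have h : ∫ z, g (z + c) ∂((volume : Measure (ℝ × E3)).map (dil a b)) =
      ∫ z, g (dil a b z + c) := hemb.integral_map _
  rw [← h, map_dil ha hb, integral_smul_measure, integral_add_right_eq_self,
    ENNReal.toReal_ofReal (by positivity), smul_eq_mul]

/-! ### Rescaled kernels -/

/-- The kernel `k` centred at `z` and rescaled parabolically to size `μ`. -/
def rescale (z : ℝ × E3) (μ : ℝ) (k : ℝ × E3 → ℝ) (w : ℝ × E3) : ℝ :=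
  k (dil (μ ^ 2)⁻¹ μ⁻¹ (w - z))

theorem contDiff_rescale {k : ℝ × E3 → ℝ} (hk : ContDiff ℝ ∞ k) (z : ℝ × E3) (μ : ℝ) :
    ContDiff ℝ ∞ (rescale z μ k) := by
  unfold rescale
  fun_prop

theorem dil_dil_inv {μ : ℝ} (hμ : μ ≠ 0) (ζ : ℝ × E3) :
    dil (μ ^ 2) μ (dil (μ ^ 2)⁻¹ μ⁻¹ ζ) = ζ := by
  ext1
  · simp [hμ]
  · simp [smul_smul, hμ]

theorem dil_inv_dil {μ : ℝ} (hμ : μ ≠ 0) (ζ : ℝ × E3) :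
    dil (μ ^ 2)⁻¹ μ⁻¹ (dil (μ ^ 2) μ ζ) = ζ := by
  ext1
  · simp [hμ]
  · simp [smul_smul, hμ]

theorem tsupport_rescale_subset {k : ℝ × E3 → ℝ} {K : Set (ℝ × E3)} (hK : IsCompact K)
    (hk : ∀ ζ, ζ ∉ K → k ζ = 0) (z : ℝ × E3) {μ : ℝ} (hμ : μ ≠ 0) :
    tsupport (rescale z μ k) ⊆ (fun ζ => z + dil (μ ^ 2) μ ζ) '' K ∧
      HasCompactSupport (rescale z μ k) := by
  have hc : IsCompact ((fun ζ => z + dil (μ ^ 2) μ ζ) '' K) := hK.image (by fun_prop)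
  have h0 : ∀ w, w ∉ (fun ζ => z + dil (μ ^ 2) μ ζ) '' K → rescale z μ k w = 0 := by
    intro w hw
    apply hk
    intro hin
    refine hw ⟨_, hin, ?_⟩
    simp only [dil_dil_inv hμ]
    abel
  refine ⟨closure_minimal ?_ hc.isClosed, HasCompactSupport.intro hc h0⟩
  intro w hw
  by_contra h
  exact hw (h0 w h)

theorem fderiv_rescale {k : ℝ × E3 → ℝ} (hk : Differentiable ℝ k) (z : ℝ × E3) (μ : ℝ)
    (w e : ℝ × E3) :
    fderiv ℝ (rescale z μ k) w e =
      fderiv ℝ k (dil (μ ^ 2)⁻¹ μ⁻¹ (w - z)) (dil (μ ^ 2)⁻¹ μ⁻¹ e) := by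
  have h1 : HasFDerivAt (fun w => dil (μ ^ 2)⁻¹ μ⁻¹ (w - z)) (dil (μ ^ 2)⁻¹ μ⁻¹) w :=
    (dil (μ ^ 2)⁻¹ μ⁻¹).hasFDerivAt.comp w ((hasFDerivAt_id w).sub_const z)
  have h2 := (hk (dil (μ ^ 2)⁻¹ μ⁻¹ (w - z))).hasFDerivAt.comp w h1
  rw [show rescale z μ k = k ∘ fun w => dil (μ ^ 2)⁻¹ μ⁻¹ (w - z) from rfl, h2.fderiv]
  rfl

theorem fderiv_rescale_timeDir {k : ℝ × E3 → ℝ} (hk : Differentiable ℝ k) (z : ℝ × E3) (μ : ℝ)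
    (w : ℝ × E3) :
    fderiv ℝ (rescale z μ k) w timeDir =
      (μ ^ 2)⁻¹ * rescale z μ (fun ζ => fderiv ℝ k ζ timeDir) w := by
  have : dil (μ ^ 2)⁻¹ μ⁻¹ timeDir = (μ ^ 2)⁻¹ • timeDir := by ext1 <;> simp [timeDir]
  rw [fderiv_rescale hk, this, map_smul, smul_eq_mul, rescale]

theorem fderiv_rescale_spaceDir {k : ℝ × E3 → ℝ} (hk : Differentiable ℝ k) (z : ℝ × E3) (μ : ℝ)
    (w : ℝ × E3) (i : Fin 3) :
    fderiv ℝ (rescale z μ k) w (spaceDir i) =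
      μ⁻¹ * rescale z μ (fun ζ => fderiv ℝ k ζ (spaceDir i)) w := by
  have : dil (μ ^ 2)⁻¹ μ⁻¹ (spaceDir i) = μ⁻¹ • spaceDir i := by
    ext1
    · simp [spaceDir]
    · simp only [spaceDir, dil_apply, Prod.smul_mk]
  rw [fderiv_rescale hk, this, map_smul, smul_eq_mul, rescale]

/-- The derivative of the rescaled kernel in the scale. -/
theorem hasDerivAt_rescale {k : ℝ × E3 → ℝ} (hk : Differentiable ℝ k) (z w : ℝ × E3) {μ : ℝ}
    (hμ : μ ≠ 0) :
    HasDerivAt (fun μ => (μ ^ 5)⁻¹ * rescale z μ k w)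
      (-(μ ^ 6)⁻¹ * rescale z μ (fun ζ => 5 * k ζ + fderiv ℝ k ζ (2 * ζ.1, ζ.2)) w) μ := by
  have h1 : HasDerivAt (fun μ : ℝ => (μ ^ 2)⁻¹) (-(2 * μ) / (μ ^ 2) ^ 2) μ := by
    simpa [Pi.inv_def] using (hasDerivAt_pow 2 μ).inv (by positivity)
  have h2 : HasDerivAt (fun μ : ℝ => μ⁻¹) (-(μ ^ 2)⁻¹) μ := hasDerivAt_inv hμ
  have h5 : HasDerivAt (fun μ : ℝ => (μ ^ 5)⁻¹) (-(5 * μ ^ 4) / (μ ^ 5) ^ 2) μ := by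
    simpa [Pi.inv_def] using (hasDerivAt_pow 5 μ).inv (by positivity)
  have h3 : HasDerivAt (fun μ : ℝ => dil (μ ^ 2)⁻¹ μ⁻¹ (w - z))
      (-(2 * μ) / (μ ^ 2) ^ 2 * (w - z).1, -(μ ^ 2)⁻¹ • (w - z).2) μ := by
    simp only [dil_apply]
    exact (h1.mul_const _).prodMk (h2.smul_const _)
  have h4 := (hk (dil (μ ^ 2)⁻¹ μ⁻¹ (w - z))).hasFDerivAt.comp_hasDerivAt μ h3
  have h6 := h5.mul h4
  refine h6.congr_deriv ?_
  have hv : ((-(2 * μ) / (μ ^ 2) ^ 2 * (w - z).1, -(μ ^ 2)⁻¹ • (w - z).2) : ℝ × E3) =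
      (-μ⁻¹) • ((2 * (dil (μ ^ 2)⁻¹ μ⁻¹ (w - z)).1, (dil (μ ^ 2)⁻¹ μ⁻¹ (w - z)).2) : ℝ × E3) := by
    ext1
    · simp only [dil_apply, Prod.smul_mk, smul_eq_mul]
      field_simp
    · simp only [dil_apply, Prod.smul_mk, smul_smul]
      congr 1
      field_simp
  rw [hv, map_smul]
  simp only [rescale, smul_eq_mul, Function.comp]
  field_simp
  ring

/-! ### A kernel with vanishing first moments -/

/-- The sum `F + div_y (y F)`, which has the same integral as `F` and vanishing first spatial
moments. -/
def momentKernel (F : ℝ × E3 → ℝ) (ζ : ℝ × E3) : ℝ := 4 * F ζ + fderiv ℝ F ζ (0, ζ.2)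

/-- The kernel `y_i y_j F`. -/
def quadKernel (F : ℝ × E3 → ℝ) (i j : Fin 3) (ζ : ℝ × E3) : ℝ := ζ.2 i * (ζ.2 j * F ζ)

theorem sum_smul_spaceDir (ζ : ℝ × E3) : ∑ i, ζ.2 i • spaceDir i = (0, ζ.2) := by
  ext1
  · simp [spaceDir, Prod.fst_sum]
  · ext j
    fin_cases j <;> simp [spaceDir, Fin.sum_univ_three]

/-- The spatial coordinates as continuous linear forms on space-time. -/
def spaceCoord (i : Fin 3) : ℝ × E3 →L[ℝ] ℝ :=
  (EuclideanSpace.proj i : E3 →L[ℝ] ℝ).comp (ContinuousLinearMap.snd ℝ ℝ E3)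

@[simp] theorem spaceCoord_apply (i : Fin 3) (ζ : ℝ × E3) : spaceCoord i ζ = ζ.2 i := rfl

theorem spaceCoord_spaceDir (i j : Fin 3) :
    spaceCoord i (spaceDir j) = if i = j then 1 else 0 := by
  simp [spaceDir]

theorem fderiv_clm_mul {G : ℝ × E3 → ℝ} {ζ : ℝ × E3} (hG : DifferentiableAt ℝ G ζ)
    (l : ℝ × E3 →L[ℝ] ℝ) (e : ℝ × E3) :
    fderiv ℝ (fun ζ => l ζ * G ζ) ζ e = l e * G ζ + l ζ * fderiv ℝ G ζ e := by
  have h := (l.hasFDerivAt (x := ζ)).mul hG.hasFDerivAt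
  change HasFDerivAt (fun ζ => l ζ * G ζ) _ ζ at h
  rw [h.fderiv]
  simp only [add_apply, smul_apply, smul_eq_mul]
  ring

theorem fderiv_coord_mul {G : ℝ × E3 → ℝ} {ζ : ℝ × E3} (hG : DifferentiableAt ℝ G ζ)
    (i : Fin 3) (e : ℝ × E3) :
    fderiv ℝ (fun ζ => ζ.2 i * G ζ) ζ e = spaceCoord i e * G ζ + ζ.2 i * fderiv ℝ G ζ e :=
  fderiv_clm_mul hG (spaceCoord i) e

theorem sum_fderiv_coord_mul {G : ℝ × E3 → ℝ} {ζ : ℝ × E3} (hG : DifferentiableAt ℝ G ζ) :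
    ∑ i, fderiv ℝ (fun ζ => ζ.2 i * G ζ) ζ (spaceDir i) = 3 * G ζ + fderiv ℝ G ζ (0, ζ.2) := by
  have h : fderiv ℝ G ζ (0, ζ.2) = ∑ i, ζ.2 i * fderiv ℝ G ζ (spaceDir i) := by
    rw [← sum_smul_spaceDir, map_sum]
    simp
  rw [h]
  simp_rw [fderiv_coord_mul hG, spaceCoord_spaceDir]
  simp [Finset.sum_add_distrib]

theorem contDiff_momentKernel {F : ℝ × E3 → ℝ} (hF : ContDiff ℝ ∞ F) :
    ContDiff ℝ ∞ (momentKernel F) := by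
  unfold momentKernel
  have h : ContDiff ℝ ∞ (fderiv ℝ F) := hF.fderiv_right (by simp)
  exact (contDiff_const.mul hF).add (h.clm_apply (by fun_prop))

theorem contDiff_coord (i : Fin 3) : ContDiff ℝ ∞ (fun ζ : ℝ × E3 => ζ.2 i) :=
  (spaceCoord i).contDiff

theorem contDiff_quadKernel {F : ℝ × E3 → ℝ} (hF : ContDiff ℝ ∞ F) (i j : Fin 3) :
    ContDiff ℝ ∞ (quadKernel F i j) :=
  (contDiff_coord i).mul ((contDiff_coord j).mul hF)

theorem contDiff_pderiv {F : ℝ × E3 → ℝ} (hF : ContDiff ℝ ∞ F) (e : ℝ × E3) :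
    ContDiff ℝ ∞ (fun ζ => fderiv ℝ F ζ e) :=
  (hF.fderiv_right (by simp)).clm_apply contDiff_const

theorem differentiable_of_smooth {F : ℝ × E3 → ℝ} (hF : ContDiff ℝ ∞ F) : Differentiable ℝ F :=
  hF.differentiable (by simp)

/-- This is the vanishing of first moments in divergence form. The factor `4` in `momentKernel`
arises as `3` from the divergence of `y` plus `1` from differentiating `y_i`. -/
theorem sum_fderiv_quadKernel {F : ℝ × E3 → ℝ} (hF : ContDiff ℝ ∞ F) (i : Fin 3) (ζ : ℝ × E3) :
    ∑ j, fderiv ℝ (quadKernel F i j) ζ (spaceDir j) = ζ.2 i * momentKernel F ζ := by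
  have hd (j : Fin 3) : DifferentiableAt ℝ (fun ζ : ℝ × E3 => ζ.2 j * F ζ) ζ :=
    differentiable_of_smooth ((contDiff_coord j).mul hF) ζ
  unfold quadKernel
  simp_rw [fun j => fderiv_coord_mul (hd j) i (spaceDir j), spaceCoord_spaceDir,
    Finset.sum_add_distrib, ← Finset.mul_sum]
  rw [sum_fderiv_coord_mul (differentiable_of_smooth hF ζ)]
  simp [momentKernel]
  ring

/-- The scale derivative of the moment kernel is a sum of a time derivative and of second spatial
derivatives. -/
theorem euler_momentKernel {F : ℝ × E3 → ℝ} (hF : ContDiff ℝ ∞ F) (ζ : ℝ × E3) :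
    5 * momentKernel F ζ + fderiv ℝ (momentKernel F) ζ (2 * ζ.1, ζ.2) =
      fderiv ℝ (fun ζ => 2 * ζ.1 * momentKernel F ζ) ζ timeDir +
      ∑ i, ∑ j, fderiv ℝ (fun ζ => fderiv ℝ (quadKernel F i j) ζ (spaceDir j)) ζ (spaceDir i) := by
  have hG := contDiff_momentKernel hF
  have hGd := differentiable_of_smooth hG
  -- The inner sum over `j` collapses to `y_i` times the moment kernel, leaving a spatial
  -- divergence. The weight then splits as `5 = 2 + 3`: `2` from `∂_t (2t G)` and `3` from `div (y
  -- G)`.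
  have h1 (i : Fin 3) : ∑ j, fderiv ℝ (fun ζ => fderiv ℝ (quadKernel F i j) ζ (spaceDir j)) ζ
      (spaceDir i) = fderiv ℝ (fun ζ => ζ.2 i * momentKernel F ζ) ζ (spaceDir i) := by
    have : (fun ζ : ℝ × E3 => ζ.2 i * momentKernel F ζ) =
        fun ζ => ∑ j, fderiv ℝ (quadKernel F i j) ζ (spaceDir j) := by
      ext ζ; rw [sum_fderiv_quadKernel hF]
    rw [this, fderiv_fun_sum]
    · simp
    · intro j _
      exact differentiable_of_smooth (contDiff_pderiv (contDiff_quadKernel hF i j) _) ζ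
  simp_rw [h1]
  rw [sum_fderiv_coord_mul (hGd ζ)]
  have h2 := fderiv_clm_mul (hGd ζ) ((2 : ℝ) • ContinuousLinearMap.fst ℝ ℝ E3) timeDir
  simp only [smul_apply, ContinuousLinearMap.coe_fst', smul_eq_mul,
    timeDir, mul_one] at h2
  rw [timeDir, h2]
  have h3 : ((2 * ζ.1, ζ.2) : ℝ × E3) = (2 * ζ.1) • ((1, 0) : ℝ × E3) + (0, ζ.2) := by
    ext1 <;> simp
  rw [h3, map_add, map_smul, smul_eq_mul]
  ring

/-- The correction to `F` is the divergence of a compactly supported field and integrates to zero.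
Mass one therefore survives, which is what makes the small-scale averages approximate the function.
-/
theorem integral_momentKernel {F : ℝ × E3 → ℝ} (hF : ContDiff ℝ ∞ F) (hc : HasCompactSupport F) :
    ∫ ζ, momentKernel F ζ = ∫ ζ, F ζ := by
  have h0 (i : Fin 3) : ContDiff ℝ ∞ (fun ζ : ℝ × E3 => ζ.2 i * F ζ) :=
    (contDiff_coord i).mul hF
  have hc0 (i : Fin 3) : HasCompactSupport (fun ζ : ℝ × E3 => ζ.2 i * F ζ) := hc.mul_left
  have hint (i : Fin 3) : Integrable
      (fun ζ => fderiv ℝ (fun ζ : ℝ × E3 => ζ.2 i * F ζ) ζ (spaceDir i)) :=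
    (contDiff_pderiv (h0 i) _).continuous.integrable_of_hasCompactSupport
      ((hc0 i).fderiv_apply (𝕜 := ℝ) _)
  have h1 : momentKernel F = fun ζ => F ζ +
      ∑ i, fderiv ℝ (fun ζ => ζ.2 i * F ζ) ζ (spaceDir i) := by
    ext ζ
    rw [sum_fderiv_coord_mul (differentiable_of_smooth hF ζ), momentKernel]
    ring
  have h2 (i : Fin 3) : ∫ ζ, fderiv ℝ (fun ζ : ℝ × E3 => ζ.2 i * F ζ) ζ (spaceDir i) = 0 := by
    have := integral_mul_fderiv_eq_neg_fderiv_mul_of_integrable (μ := volume)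
      (f := fun _ : ℝ × E3 => (1 : ℝ)) (g := fun ζ : ℝ × E3 => ζ.2 i * F ζ) (v := spaceDir i)
      (by simp) (by simpa using hint i)
      (by simpa using (h0 i).continuous.integrable_of_hasCompactSupport (hc0 i))
      (fun _ _ => by fun_prop) (fun ζ _ => differentiable_of_smooth (h0 i) ζ)
    simpa using this
  rw [h1, integral_add (hF.continuous.integrable_of_hasCompactSupport hc)
    (integrable_finsetSum _ fun i _ => hint i), integral_finsetSum _ fun i _ => hint i]
  simp [h2]

/-! ### Averages over shrinking parabolic copies of the domain -/

/-- `w` is the weak derivative of `u` on `Q` in direction `e`, for functions. -/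
def IsWeakDerivOn (Q : Set (ℝ × E3)) (u w : ℝ × E3 → ℝ) (e : ℝ × E3) : Prop :=
  ∀ φ : ℝ × E3 → ℝ, ContDiff ℝ ∞ φ → HasCompactSupport φ → tsupport φ ⊆ Q →
    ∫ z in Q, u z * fderiv ℝ φ z e = -∫ z in Q, w z * φ z

/-- `Q` is stable under the parabolic contractions centred at its points. -/
def ParabolicStar (Q : Set (ℝ × E3)) : Prop :=
  ∀ z ∈ Q, ∀ w ∈ Q, ∀ μ : ℝ, 0 < μ → μ ≤ 1 → z + dil (μ ^ 2) μ (w - z) ∈ Q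

/-- The contraction uses weight `μ ^ 2` in time and `μ` in space, so convexity is applied to the two
factors separately. The embedding uses the convexity of `Ω` only here. -/
theorem parabolicStar_prod {A : Set ℝ} {Ω : Set E3} (hA : Convex ℝ A) (hΩ : Convex ℝ Ω) :
    ParabolicStar (A ×ˢ Ω) := by
  intro z hz w hw μ h0 h1
  refine ⟨?_, ?_⟩
  · have := hA.add_smul_sub_mem hz.1 hw.1 (t := μ ^ 2) ⟨by positivity, pow_le_one₀ h0.le h1⟩
    simpa using this
  · have := hΩ.add_smul_sub_mem hz.2 hw.2 (t := μ) ⟨h0.le, h1⟩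
    simpa using this

section
variable {Q : Set (ℝ × E3)} {u ut : ℝ × E3 → ℝ} {k : ℝ × E3 → ℝ} {K : Set (ℝ × E3)}

/-- If the unscaled kernel, placed at `z`, lives in `Q`, then so do all its contractions. This makes
every rescaled kernel admissible in the definition of the weak derivatives of `u`. -/
theorem tsupport_rescale_subset_of_star (hQ : ParabolicStar Q) (hK : IsCompact K)
    (hk : ∀ ζ, ζ ∉ K → k ζ = 0) {z : ℝ × E3} (hz : z ∈ Q) (hKQ : ∀ ζ ∈ K, z + ζ ∈ Q)
    {μ : ℝ} (h0 : 0 < μ) (h1 : μ ≤ 1) : tsupport (rescale z μ k) ⊆ Q := by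
  refine (tsupport_rescale_subset hK hk z h0.ne').1.trans ?_
  rintro _ ⟨ζ, hζ, rfl⟩
  simpa using hQ z hz (z + ζ) (hKQ ζ hζ) μ h0 h1

theorem fderiv_eq_zero_off {K : Set (ℝ × E3)} (hK : IsCompact K) (hk : ∀ ζ, ζ ∉ K → k ζ = 0)
    {ζ : ℝ × E3} (hζ : ζ ∉ K) : fderiv ℝ k ζ = 0 := by
  have : k =ᶠ[nhds ζ] fun _ => 0 := by
    filter_upwards [hK.isClosed.isOpen_compl.mem_nhds hζ] with w hw using hk w hw
  rw [this.fderiv_eq, fderiv_fun_const]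
  rfl

/-- By the chain rule a time derivative of the rescaled kernel costs `(μ ^ 2)⁻¹`; moving it onto `u`
gains the factor back. A space derivative gains only `μ`, so two of them match one time derivative.
-/
theorem weakDeriv_rescale_time (hQ : ParabolicStar Q) (hu : IsWeakDerivOn Q u ut timeDir)
    (hks : ContDiff ℝ ∞ k) (hK : IsCompact K) (hk : ∀ ζ, ζ ∉ K → k ζ = 0) {z : ℝ × E3}
    (hz : z ∈ Q) (hKQ : ∀ ζ ∈ K, z + ζ ∈ Q) {μ : ℝ} (h0 : 0 < μ) (h1 : μ ≤ 1) :
    ∫ w in Q, u w * rescale z μ (fun ζ => fderiv ℝ k ζ timeDir) w =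
      -(μ ^ 2 * ∫ w in Q, ut w * rescale z μ k w) := by
  have h := hu (rescale z μ k) (contDiff_rescale hks z μ)
    (tsupport_rescale_subset hK hk z h0.ne').2 (tsupport_rescale_subset_of_star hQ hK hk hz hKQ h0 h1)
  simp_rw [fderiv_rescale_timeDir (differentiable_of_smooth hks), mul_left_comm (u _)] at h
  rw [integral_const_mul] at h
  field_simp at h
  linarith

theorem weakDeriv_rescale_space {i : Fin 3} {ui : ℝ × E3 → ℝ} (hQ : ParabolicStar Q)
    (hu : IsWeakDerivOn Q u ui (spaceDir i))
    (hks : ContDiff ℝ ∞ k) (hK : IsCompact K) (hk : ∀ ζ, ζ ∉ K → k ζ = 0) {z : ℝ × E3}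
    (hz : z ∈ Q) (hKQ : ∀ ζ ∈ K, z + ζ ∈ Q) {μ : ℝ} (h0 : 0 < μ) (h1 : μ ≤ 1) :
    ∫ w in Q, u w * rescale z μ (fun ζ => fderiv ℝ k ζ (spaceDir i)) w =
      -(μ * ∫ w in Q, ui w * rescale z μ k w) := by
  have h := hu (rescale z μ k) (contDiff_rescale hks z μ)
    (tsupport_rescale_subset hK hk z h0.ne').2 (tsupport_rescale_subset_of_star hQ hK hk hz hKQ h0 h1)
  simp_rw [fderiv_rescale_spaceDir (differentiable_of_smooth hks), mul_left_comm (u _)] at h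
  rw [integral_const_mul] at h
  field_simp at h
  linarith

theorem weakDeriv_rescale_space_space {i j : Fin 3} {ui uij : ℝ × E3 → ℝ} (hQ : ParabolicStar Q)
    (hu : IsWeakDerivOn Q u ui (spaceDir i)) (hui : IsWeakDerivOn Q ui uij (spaceDir j))
    (hks : ContDiff ℝ ∞ k) (hK : IsCompact K) (hk : ∀ ζ, ζ ∉ K → k ζ = 0) {z : ℝ × E3}
    (hz : z ∈ Q) (hKQ : ∀ ζ ∈ K, z + ζ ∈ Q) {μ : ℝ} (h0 : 0 < μ) (h1 : μ ≤ 1) :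
    ∫ w in Q, u w * rescale z μ (fun ζ => fderiv ℝ (fun ζ => fderiv ℝ k ζ (spaceDir j)) ζ
        (spaceDir i)) w = μ ^ 2 * ∫ w in Q, uij w * rescale z μ k w := by
  rw [weakDeriv_rescale_space hQ hu (contDiff_pderiv hks _) hK
    (fun ζ hζ => by rw [fderiv_eq_zero_off hK hk hζ]; rfl) hz hKQ h0 h1,
    weakDeriv_rescale_space hQ hui hks hK hk hz hKQ h0 h1]
  ring

theorem integrable_mul_rescale {μ : ℝ} (hu : IntegrableOn u Q) (hks : Continuous k)
    (hk : HasCompactSupport k) (z : ℝ × E3) :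
    IntegrableOn (fun w => u w * rescale z μ k w) Q := by
  obtain ⟨C, hC⟩ := hk.exists_bound_of_continuous hks
  refine hu.mul_bdd (c := C) ?_ (Filter.Eventually.of_forall fun w => hC _)
  exact (hks.comp (by fun_prop)).aestronglyMeasurable

theorem hasDerivAt_average (hu : IntegrableOn u Q) (hks : ContDiff ℝ ∞ k)
    (hk : HasCompactSupport k) (z : ℝ × E3) {μ : ℝ} (hμ : 0 < μ) :
    HasDerivAt (fun μ => (μ ^ 5)⁻¹ * ∫ w in Q, u w * rescale z μ k w)
      (-(μ ^ 6)⁻¹ * ∫ w in Q, u w *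
        rescale z μ (fun ζ => 5 * k ζ + fderiv ℝ k ζ (2 * ζ.1, ζ.2)) w) μ := by
  have hkd := differentiable_of_smooth hks
  have hLc : Continuous (fun ζ : ℝ × E3 => 5 * k ζ + fderiv ℝ k ζ (2 * ζ.1, ζ.2)) := by
    have : Continuous (fderiv ℝ k) := hks.continuous_fderiv (by simp)
    have := hks.continuous
    fun_prop
  have hLk : HasCompactSupport (fun ζ : ℝ × E3 => 5 * k ζ + fderiv ℝ k ζ (2 * ζ.1, ζ.2)) := by
    refine HasCompactSupport.intro hk (K := tsupport k) fun ζ hζ => ?_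
    rw [fderiv_eq_zero_off hk (fun ζ hζ => image_eq_zero_of_notMem_tsupport hζ) hζ,
      image_eq_zero_of_notMem_tsupport hζ]
    simp
  obtain ⟨C, hC⟩ := hLk.exists_bound_of_continuous hLc
  have hC0 : 0 ≤ C := (norm_nonneg _).trans (hC 0)
  -- Restricting the scale to `ν > μ / 2` bounds `ν⁻⁶` by a constant, so a multiple of `|u|`
  -- dominates.
  have key := hasDerivAt_integral_of_dominated_loc_of_deriv_le (μ := volume.restrict Q)
    (F := fun μ w => u w * ((μ ^ 5)⁻¹ * rescale z μ k w))
    (F' := fun μ w => u w * (-(μ ^ 6)⁻¹ *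
      rescale z μ (fun ζ => 5 * k ζ + fderiv ℝ k ζ (2 * ζ.1, ζ.2)) w))
    (bound := fun w => |u w| * (((μ / 2) ^ 6)⁻¹ * C)) (x₀ := μ) (s := Ioi (μ / 2))
    (Ioi_mem_nhds (by linarith)) ?_ ?_ ?_ ?_ ?_ ?_
  · have h2 := key.2
    simp_rw [mul_left_comm (u _), integral_const_mul] at h2
    exact h2
  · refine Filter.Eventually.of_forall fun ν => ?_
    have h := (integrable_mul_rescale hu hks.continuous hk z (μ := ν)).aestronglyMeasurable
    simpa [mul_left_comm (u _)] using h.const_mul (ν ^ 5)⁻¹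
  · have h := (integrable_mul_rescale hu hks.continuous hk z (μ := μ)).const_mul (μ ^ 5)⁻¹
    simpa [mul_left_comm (u _)] using h
  · have h := (integrable_mul_rescale hu hLc hLk z (μ := μ)).aestronglyMeasurable
    simpa [mul_left_comm (u _)] using h.const_mul (-(μ ^ 6)⁻¹)
  · refine Filter.Eventually.of_forall fun w ν hν => ?_
    have hν' : μ / 2 < ν := hν
    have hν0 : 0 < ν := by linarith
    rw [norm_mul, Real.norm_eq_abs, norm_mul, norm_neg, norm_inv, norm_pow,
      Real.norm_of_nonneg hν0.le]
    gcongr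
    exact hC _
  · exact hu.norm.mul_const _
  · refine Filter.Eventually.of_forall fun w ν hν => ?_
    have hν' : μ / 2 < ν := hν
    exact (hasDerivAt_rescale hkd z w (by linarith : 0 < ν).ne').const_mul _

end

/-- The integral over `w ∈ Q` of `g` at the point of `Q` obtained by contracting `w` towards `z`
by the parabolic factor `μ`. -/
def contractAvg (Q : Set (ℝ × E3)) (g : ℝ × E3 → ℝ≥0∞) (μ : ℝ) (z : ℝ × E3) : ℝ≥0∞ :=
  ∫⁻ w in Q, g (z + dil (μ ^ 2) μ (w - z))

section
variable {Q : Set (ℝ × E3)} {g : ℝ × E3 → ℝ≥0∞}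

theorem lintegral_contract (hg : Measurable g) {μ : ℝ} (hμ : 0 < μ) (z : ℝ × E3) :
    ∫⁻ w, g (z + dil (μ ^ 2) μ (w - z)) = ENNReal.ofReal (μ ^ 5)⁻¹ * ∫⁻ w, g w := by
  have h := lintegral_dil (a := μ ^ 2) (b := μ) (by positivity) hμ (z - dil (μ ^ 2) μ z) hg
  rw [show μ ^ 2 * μ ^ 3 = μ ^ 5 by ring] at h
  rw [← h]
  congr with w
  congr 1
  rw [map_sub]
  abel

theorem contractAvg_le (hg : Measurable g) {μ : ℝ} (hμ : 0 < μ) (z : ℝ × E3) :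
    contractAvg Q g μ z ≤ ENNReal.ofReal (μ ^ 5)⁻¹ * ∫⁻ w, g w :=
  (setLIntegral_le_lintegral _ _).trans (lintegral_contract hg hμ z).le

/-- The kernel lives on the contracted copy of `Q` about `z`. Substituting `w ↦ z + dil (μ ^ 2) μ (w
- z)` turns that copy back into `Q` with Jacobian `μ ^ 5`; the indicator inside `G` records the
restriction to the copy. -/
theorem enorm_integral_mul_rescale_le (hQm : MeasurableSet Q) {v k : ℝ × E3 → ℝ} {C : ℝ}
    {z : ℝ × E3} (hk : ∀ ζ, |k ζ| ≤ C) (hkQ : ∀ ζ, z + ζ ∉ Q → k ζ = 0) (hv : ∀ w ∈ Q, ‖v w‖ₑ ≤ g w)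
    (hg : Measurable g) {μ : ℝ} (hμ : 0 < μ) :
    ‖∫ w in Q, v w * rescale z μ k w‖ₑ ≤
      ENNReal.ofReal C * ENNReal.ofReal (μ ^ 5) * contractAvg Q g μ z := by
  have hC : 0 ≤ C := (abs_nonneg _).trans (hk 0)
  set G : ℝ × E3 → ℝ≥0∞ := fun w => Q.indicator (fun _ => 1) (z + dil (μ ^ 2)⁻¹ μ⁻¹ (w - z)) * g w
    with hGdef
  have hGm : Measurable G := by
    refine Measurable.mul ?_ hg
    exact (measurable_const.indicator hQm).comp (by fun_prop)
  calc ‖∫ w in Q, v w * rescale z μ k w‖ₑ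
      ≤ ∫⁻ w in Q, ‖v w * rescale z μ k w‖ₑ := enorm_integral_le_lintegral_enorm _
    _ ≤ ∫⁻ w in Q, ENNReal.ofReal C * G w := by
        refine setLIntegral_mono' hQm fun w hw => ?_
        rw [enorm_mul, hGdef]
        by_cases h : z + dil (μ ^ 2)⁻¹ μ⁻¹ (w - z) ∈ Q
        · simp only [indicator_of_mem h, one_mul]
          rw [mul_comm]
          gcongr
          · rw [Real.enorm_eq_ofReal_abs]
            exact ENNReal.ofReal_le_ofReal (hk _)
          · exact hv w hw
        · rw [rescale, hkQ _ h]; simp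
    _ ≤ ∫⁻ w, ENNReal.ofReal C * G w := setLIntegral_le_lintegral _ _
    _ = ENNReal.ofReal C * ∫⁻ w, G w := lintegral_const_mul _ hGm
    _ = ENNReal.ofReal C * (ENNReal.ofReal (μ ^ 5) * contractAvg Q g μ z) := by
        congr 1
        have h1 := lintegral_contract hGm hμ z
        have h2 : ∫⁻ w, G (z + dil (μ ^ 2) μ (w - z)) = contractAvg Q g μ z := by
          rw [contractAvg, ← lintegral_indicator hQm]
          congr with w
          simp only [hGdef, add_sub_cancel_left, dil_inv_dil hμ.ne']
          simp only [add_sub_cancel]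
          by_cases hw : w ∈ Q <;> simp [hw]
        rw [← h2, h1, ← mul_assoc, ← ENNReal.ofReal_mul (by positivity),
          mul_inv_cancel₀ (by positivity)]
        simp
    _ = _ := by rw [mul_assoc]

end

section
variable {Q : Set (ℝ × E3)} {η : ℝ × E3 → ℝ}

/-- The moment kernel of `η` seen from `z`, and rescaled averages of `u` against it. -/
def momentAvg (Q : Set (ℝ × E3)) (η u : ℝ × E3 → ℝ) (z : ℝ × E3) (μ : ℝ) : ℝ :=
  (μ ^ 5)⁻¹ * ∫ w in Q, u w * rescale z μ (momentKernel fun ζ => η (z + ζ)) w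

theorem fderiv_shift (η : ℝ × E3 → ℝ) (z ζ : ℝ × E3) :
    fderiv ℝ (fun ζ => η (z + ζ)) ζ = fderiv ℝ η (z + ζ) := by
  rw [fderiv_comp_add_left]

theorem shift_support {S : Set (ℝ × E3)} (hS : IsCompact S) (z : ℝ × E3) :
    IsCompact ((fun w => w - z) '' S) ∧ ∀ ζ, ζ ∉ (fun w => w - z) '' S ↔ z + ζ ∉ S := by
  refine ⟨hS.image (by fun_prop), fun ζ => not_congr ?_⟩
  constructor
  · rintro ⟨w, hw, rfl⟩; simpa using hw
  · intro h; exact ⟨_, h, by simp⟩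

/-- Uniform bounds for the kernels used in `momentAvg` and its scale derivative. -/
theorem exists_kernel_bound (hQb : Bornology.IsBounded Q) (hη : ContDiff ℝ ∞ η)
    (hc : HasCompactSupport η) (hs : tsupport η ⊆ Q) :
    ∃ C : ℝ, 0 ≤ C ∧ ∀ z ∈ Q,
      (∀ ζ, |momentKernel (fun ζ => η (z + ζ)) ζ| ≤ C) ∧
      (∀ ζ, |2 * ζ.1 * momentKernel (fun ζ => η (z + ζ)) ζ| ≤ C) ∧
      (∀ i j ζ, |quadKernel (fun ζ => η (z + ζ)) i j ζ| ≤ C) := by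
  obtain ⟨A, hA⟩ := hc.exists_bound_of_continuous hη.continuous
  obtain ⟨B, hB⟩ := (hc.fderiv (𝕜 := ℝ)).exists_bound_of_continuous
    (hη.continuous_fderiv (by simp))
  obtain ⟨R, hR⟩ := Metric.isBounded_iff.1 hQb
  have hA0 : 0 ≤ A := (norm_nonneg _).trans (hA 0)
  have hB0 : 0 ≤ B := (norm_nonneg _).trans (hB 0)
  by_cases hne : Q.Nonempty
  swap
  · exact ⟨0, le_rfl, fun z hz => (hne ⟨z, hz⟩).elim⟩
  obtain ⟨z₀, hz₀⟩ := hne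
  have hR0 : 0 ≤ R := dist_nonneg.trans (hR hz₀ hz₀)
  -- Where a kernel is nonzero both `z` and `z + ζ` lie in `Q`, so `‖ζ‖ ≤ R`. The constant dominates
  -- the three separate bounds `4A + BR`, `2R(4A + BR)` and `R · R · A`.
  refine ⟨(4 * A + B * R) * (1 + 2 * R) + R * (R * A), by positivity, fun z hz => ?_⟩
  have hζ {ζ : ℝ × E3} (h : z + ζ ∈ tsupport η) : ‖ζ‖ ≤ R := by
    simpa [dist_eq_norm] using hR (hs h) hz
  have h1 (ζ : ℝ × E3) : |momentKernel (fun ζ => η (z + ζ)) ζ| ≤ 4 * A + B * R := by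
    by_cases h : z + ζ ∈ tsupport η
    · rw [momentKernel, fderiv_shift]
      refine (abs_add_le _ _).trans (add_le_add ?_ ?_)
      · rw [abs_mul]; simpa using hA (z + ζ)
      · refine ((fderiv ℝ η (z + ζ)).le_opNorm _).trans ?_
        have : ‖((0 : ℝ), ζ.2)‖ ≤ R := by
          refine le_trans ?_ (hζ h)
          rw [Prod.norm_def, Prod.norm_def]
          simp
        gcongr
        exact hB _
    · rw [momentKernel, fderiv_shift, fderiv_eq_zero_off hc
        (fun ζ hζ => image_eq_zero_of_notMem_tsupport hζ) h, image_eq_zero_of_notMem_tsupport h]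
      simp; positivity
  have h0 (ζ : ℝ × E3) (h : z + ζ ∉ tsupport η) : momentKernel (fun ζ => η (z + ζ)) ζ = 0 := by
    rw [momentKernel, fderiv_shift, fderiv_eq_zero_off hc
        (fun ζ hζ => image_eq_zero_of_notMem_tsupport hζ) h, image_eq_zero_of_notMem_tsupport h]
    simp
  refine ⟨fun ζ => (h1 ζ).trans ?_, fun ζ => ?_, fun i j ζ => ?_⟩
  · nlinarith [mul_nonneg (by positivity : 0 ≤ 4 * A + B * R) hR0, mul_nonneg hR0 (mul_nonneg hR0 hA0)]
  · by_cases h : z + ζ ∈ tsupport η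
    · rw [abs_mul, abs_mul]
      have h2 : |ζ.1| ≤ R := (norm_fst_le ζ).trans (hζ h)
      have h3 : |(2 : ℝ)| * |ζ.1| * |momentKernel (fun ζ => η (z + ζ)) ζ| ≤
          2 * R * (4 * A + B * R) := by
        rw [abs_two]
        gcongr
        exact h1 ζ
      nlinarith [mul_nonneg (by positivity : 0 ≤ 4 * A + B * R) hR0,
        mul_nonneg hR0 (mul_nonneg hR0 hA0), mul_nonneg hB0 hR0]
    · rw [h0 ζ h]; simp; positivity
  · by_cases h : z + ζ ∈ tsupport η
    · have hi (i : Fin 3) : |ζ.2 i| ≤ R :=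
        ((PiLp.norm_apply_le ζ.2 i).trans (norm_snd_le ζ)).trans (hζ h)
      have h3 : |quadKernel (fun ζ => η (z + ζ)) i j ζ| ≤ R * (R * A) := by
        rw [quadKernel, abs_mul, abs_mul]
        gcongr
        · exact hi i
        · exact hi j
        · exact hA _
      nlinarith [mul_nonneg (by positivity : 0 ≤ 4 * A + B * R) hR0, mul_nonneg hB0 hR0]
    · rw [quadKernel, image_eq_zero_of_notMem_tsupport h]; simp; positivity

theorem momentKernel_shift_eq_zero (hc : HasCompactSupport η) {z ζ : ℝ × E3}
    (h : z + ζ ∉ tsupport η) : momentKernel (fun ζ => η (z + ζ)) ζ = 0 := by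
  rw [momentKernel, fderiv_shift, fderiv_eq_zero_off hc
    (fun ζ hζ => image_eq_zero_of_notMem_tsupport hζ) h, image_eq_zero_of_notMem_tsupport h]
  simp

theorem contDiff_shift (hη : ContDiff ℝ ∞ η) (z : ℝ × E3) :
    ContDiff ℝ ∞ (fun ζ => η (z + ζ)) := by fun_prop

theorem hasCompactSupport_momentKernel_shift (hc : HasCompactSupport η) (z : ℝ × E3) :
    HasCompactSupport (momentKernel fun ζ => η (z + ζ)) :=
  HasCompactSupport.intro (shift_support hc z).1 fun ζ hζ =>
    momentKernel_shift_eq_zero hc (((shift_support hc z).2 ζ).1 hζ)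

variable {u ut : ℝ × E3 → ℝ} {ui : Fin 3 → ℝ × E3 → ℝ} {uij : Fin 3 → Fin 3 → ℝ × E3 → ℝ}

/-- Differentiating the kernel in the scale gives `-(μ ^ 6)⁻¹` times the Euler expression of
`euler_momentKernel`. Both the time term and the second-order terms gain `μ ^ 2` by integration by
parts; one integration flips the sign, two do not. -/
theorem hasDerivAt_momentAvg (hQ : ParabolicStar Q) (hη : ContDiff ℝ ∞ η)
    (hc : HasCompactSupport η) (hs : tsupport η ⊆ Q) (hu : IntegrableOn u Q)
    (hut : IsWeakDerivOn Q u ut timeDir) (hui : ∀ i, IsWeakDerivOn Q u (ui i) (spaceDir i))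
    (huij : ∀ i j, IsWeakDerivOn Q (ui i) (uij i j) (spaceDir j)) {z : ℝ × E3} (hz : z ∈ Q)
    {μ : ℝ} (h0 : 0 < μ) (h1 : μ ≤ 1) :
    HasDerivAt (momentAvg Q η u z)
      ((μ ^ 4)⁻¹ *
        ((∫ w in Q, ut w * rescale z μ (fun ζ => 2 * ζ.1 * momentKernel (fun ζ => η (z + ζ)) ζ) w) -
        ∑ i, ∑ j, ∫ w in Q, uij i j w * rescale z μ (quadKernel (fun ζ => η (z + ζ)) i j) w)) μ := by
  set F : ℝ × E3 → ℝ := fun ζ => η (z + ζ) with hF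
  have hFs : ContDiff ℝ ∞ F := contDiff_shift hη z
  have hθs := contDiff_momentKernel hFs
  have hθc : HasCompactSupport (momentKernel F) := hasCompactSupport_momentKernel_shift hc z
  obtain ⟨hK, hKiff⟩ := shift_support hc z
  have hKQ : ∀ ζ ∈ (fun w => w - z) '' tsupport η, z + ζ ∈ Q := by
    rintro _ ⟨w, hw, rfl⟩; simpa using hs hw
  have hθ0 : ∀ ζ, ζ ∉ (fun w => w - z) '' tsupport η → momentKernel F ζ = 0 := fun ζ hζ =>
    momentKernel_shift_eq_zero hc ((hKiff ζ).1 hζ)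
  have hτs : ContDiff ℝ ∞ (fun ζ : ℝ × E3 => 2 * ζ.1 * momentKernel F ζ) := by fun_prop
  have hτ0 : ∀ ζ, ζ ∉ (fun w => w - z) '' tsupport η → 2 * ζ.1 * momentKernel F ζ = 0 :=
    fun ζ hζ => by rw [hθ0 ζ hζ, mul_zero]
  have hq0 (i j) : ∀ ζ, ζ ∉ (fun w => w - z) '' tsupport η → quadKernel F i j ζ = 0 :=
    fun ζ hζ => by
      rw [quadKernel, hF]
      simp only [image_eq_zero_of_notMem_tsupport ((hKiff ζ).1 hζ), mul_zero]
  have hqs (i j) := contDiff_quadKernel hFs i j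
  refine (hasDerivAt_average hu hθs hθc z h0).congr_deriv ?_
  simp_rw [euler_momentKernel hFs]
  have e1 : ∫ w in Q, u w * rescale z μ (fun ζ =>
        fderiv ℝ (fun ζ => 2 * ζ.1 * momentKernel F ζ) ζ timeDir +
        ∑ i, ∑ j, fderiv ℝ (fun ζ => fderiv ℝ (quadKernel F i j) ζ (spaceDir j)) ζ (spaceDir i)) w =
      (∫ w in Q, u w * rescale z μ (fun ζ =>
        fderiv ℝ (fun ζ => 2 * ζ.1 * momentKernel F ζ) ζ timeDir) w) +
      ∑ i, ∑ j, ∫ w in Q, u w * rescale z μ (fun ζ =>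
        fderiv ℝ (fun ζ => fderiv ℝ (quadKernel F i j) ζ (spaceDir j)) ζ (spaceDir i)) w := by
    have hi1 := integrable_mul_rescale hu (contDiff_pderiv hτs timeDir).continuous
      ((HasCompactSupport.intro hK hτ0).fderiv_apply (𝕜 := ℝ) timeDir) z (μ := μ)
    have hi2 (i j) := integrable_mul_rescale hu
      (contDiff_pderiv (contDiff_pderiv (hqs i j) (spaceDir j)) (spaceDir i)).continuous
      (((HasCompactSupport.intro hK (hq0 i j)).fderiv_apply (𝕜 := ℝ) _).fderiv_apply (𝕜 := ℝ) _) z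
        (μ := μ)
    simp_rw [← integral_finsetSum Finset.univ fun j _ => hi2 _ j]
    rw [← integral_finsetSum Finset.univ fun i _ => integrable_finsetSum _ fun j _ => hi2 i j,
      ← integral_add hi1 (integrable_finsetSum _ fun i _ => integrable_finsetSum _ fun j _ => hi2 i j)]
    congr with w
    simp only [rescale, mul_add, Finset.mul_sum]
  rw [e1, weakDeriv_rescale_time hQ hut hτs hK hτ0 hz hKQ h0 h1]
  simp_rw [fun i j => weakDeriv_rescale_space_space hQ (hui i) (huij i j) (hqs i j) hK (hq0 i j)
    hz hKQ h0 h1, ← Finset.mul_sum]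
  field_simp
  ring

end

section
variable {Q : Set (ℝ × E3)} {η : ℝ × E3 → ℝ}
variable {u ut : ℝ × E3 → ℝ} {ui : Fin 3 → ℝ × E3 → ℝ} {uij : Fin 3 → Fin 3 → ℝ × E3 → ℝ}

theorem enorm_momentAvg_le (hQm : MeasurableSet Q)
    (hc : HasCompactSupport η) (hs : tsupport η ⊆ Q) {C : ℝ} {z : ℝ × E3}
    (hC : ∀ ζ, |momentKernel (fun ζ => η (z + ζ)) ζ| ≤ C)
    {g : ℝ × E3 → ℝ≥0∞} (hg : Measurable g) (hug : ∀ w ∈ Q, ‖u w‖ₑ ≤ g w) {μ : ℝ} (h0 : 0 < μ) :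
    ‖momentAvg Q η u z μ‖ₑ ≤ ENNReal.ofReal C * contractAvg Q g μ z := by
  have h := enorm_integral_mul_rescale_le hQm hC
    (fun ζ hζ => momentKernel_shift_eq_zero hc (fun h => hζ (hs h))) hug hg h0
  rw [momentAvg, enorm_mul, Real.enorm_eq_ofReal (by positivity)]
  refine (mul_le_mul_right h _).trans (le_of_eq ?_)
  rw [← mul_assoc, mul_comm (ENNReal.ofReal C), ← mul_assoc, ← ENNReal.ofReal_mul (by positivity),
    inv_mul_cancel₀ (by positivity)]
  simp

/-- There are ten terms, one in time and nine in space. The powers combine as `μ⁻⁴ · μ ^ 5 = μ`, and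
this positive power is the regularity gained from the two derivatives. -/
theorem enorm_deriv_momentAvg_le (hQm : MeasurableSet Q) (hQ : ParabolicStar Q)
    (hη : ContDiff ℝ ∞ η)
    (hc : HasCompactSupport η) (hs : tsupport η ⊆ Q) (hu : IntegrableOn u Q)
    (hut : IsWeakDerivOn Q u ut timeDir) (hui : ∀ i, IsWeakDerivOn Q u (ui i) (spaceDir i))
    (huij : ∀ i j, IsWeakDerivOn Q (ui i) (uij i j) (spaceDir j)) {z : ℝ × E3} (hz : z ∈ Q)
    {C : ℝ} (hC1 : ∀ ζ, |2 * ζ.1 * momentKernel (fun ζ => η (z + ζ)) ζ| ≤ C)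
    (hC2 : ∀ i j ζ, |quadKernel (fun ζ => η (z + ζ)) i j ζ| ≤ C)
    {g : ℝ × E3 → ℝ≥0∞} (hg : Measurable g) (hutg : ∀ w ∈ Q, ‖ut w‖ₑ ≤ g w)
    (huijg : ∀ i j, ∀ w ∈ Q, ‖uij i j w‖ₑ ≤ g w)
    {μ : ℝ} (h0 : 0 < μ) (h1 : μ ≤ 1) :
    ‖deriv (momentAvg Q η u z) μ‖ₑ ≤
      10 * ENNReal.ofReal C * (ENNReal.ofReal μ * contractAvg Q g μ z) := by
  rw [(hasDerivAt_momentAvg hQ hη hc hs hu hut hui huij hz h0 h1).deriv, enorm_mul,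
    Real.enorm_eq_ofReal (by positivity)]
  set X := ENNReal.ofReal C * ENNReal.ofReal (μ ^ 5) * contractAvg Q g μ z with hX
  have b1 : ‖∫ w in Q, ut w *
      rescale z μ (fun ζ => 2 * ζ.1 * momentKernel (fun ζ => η (z + ζ)) ζ) w‖ₑ ≤ X :=
    enorm_integral_mul_rescale_le hQm hC1 (fun ζ hζ => by
      rw [momentKernel_shift_eq_zero hc (fun h => hζ (hs h)), mul_zero]) hutg hg h0
  have b2 (i j) : ‖∫ w in Q, uij i j w *
      rescale z μ (quadKernel (fun ζ => η (z + ζ)) i j) w‖ₑ ≤ X :=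
    enorm_integral_mul_rescale_le hQm (hC2 i j) (fun ζ hζ => by
      rw [quadKernel, image_eq_zero_of_notMem_tsupport (fun h => hζ (hs h))]; simp) (huijg i j) hg h0
  have b3 : ‖∑ i, ∑ j, ∫ w in Q, uij i j w *
      rescale z μ (quadKernel (fun ζ => η (z + ζ)) i j) w‖ₑ ≤ 9 * X := by
    refine (enorm_sum_le _ _).trans ?_
    refine (Finset.sum_le_sum fun i _ => (enorm_sum_le _ _).trans
      (Finset.sum_le_sum fun j _ => b2 i j)).trans (le_of_eq ?_)
    simp only [Finset.sum_const, Finset.card_univ, Fintype.card_fin, nsmul_eq_mul]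
    rw [← mul_assoc]
    norm_num
  refine (mul_le_mul_right ((enorm_sub_le).trans (add_le_add b1 b3)) _).trans (le_of_eq ?_)
  have e : ENNReal.ofReal (μ ^ 4)⁻¹ * ENNReal.ofReal (μ ^ 5) = ENNReal.ofReal μ := by
    rw [← ENNReal.ofReal_mul (by positivity)]
    congr 1
    field_simp
  calc ENNReal.ofReal (μ ^ 4)⁻¹ * (X + 9 * X)
      = 10 * ENNReal.ofReal C * ((ENNReal.ofReal (μ ^ 4)⁻¹ * ENNReal.ofReal (μ ^ 5)) *
        contractAvg Q g μ z) := by rw [hX]; ring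
    _ = _ := by rw [e]

/-- The small-scale averages are controlled by a potential of the derivatives. -/
theorem enorm_momentAvg_le_potential (hQm : MeasurableSet Q) (hQ : ParabolicStar Q)
    (hη : ContDiff ℝ ∞ η)
    (hc : HasCompactSupport η) (hs : tsupport η ⊆ Q) (hu : IntegrableOn u Q)
    (hut : IsWeakDerivOn Q u ut timeDir) (hui : ∀ i, IsWeakDerivOn Q u (ui i) (spaceDir i))
    (huij : ∀ i j, IsWeakDerivOn Q (ui i) (uij i j) (spaceDir j)) {z : ℝ × E3} (hz : z ∈ Q)
    {C : ℝ} (hC0 : ∀ ζ, |momentKernel (fun ζ => η (z + ζ)) ζ| ≤ C)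
    (hC1 : ∀ ζ, |2 * ζ.1 * momentKernel (fun ζ => η (z + ζ)) ζ| ≤ C)
    (hC2 : ∀ i j ζ, |quadKernel (fun ζ => η (z + ζ)) i j ζ| ≤ C)
    {g : ℝ × E3 → ℝ≥0∞} (hg : Measurable g) (hug : ∀ w ∈ Q, ‖u w‖ₑ ≤ g w)
    (hutg : ∀ w ∈ Q, ‖ut w‖ₑ ≤ g w)
    (huijg : ∀ i j, ∀ w ∈ Q, ‖uij i j w‖ₑ ≤ g w)
    {ε : ℝ} (h0 : 0 < ε) (h1 : ε < 1 / 2) :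
    ‖momentAvg Q η u z ε‖ₑ ≤ ENNReal.ofReal C * contractAvg Q g (1 / 2) z +
      10 * ENNReal.ofReal C * ∫⁻ μ in Ioc (0 : ℝ) (1 / 2), ENNReal.ofReal μ * contractAvg Q g μ z := by
  set V := momentAvg Q η u z
  have hder (μ : ℝ) (hμ0 : 0 < μ) (hμ1 : μ ≤ 1) : HasDerivAt V (deriv V μ) μ :=
    (hasDerivAt_momentAvg hQ hη hc hs hu hut hui huij hz hμ0 hμ1).differentiableAt.hasDerivAt
  have hbd : ∫⁻ μ in Ioc ε (1 / 2), ‖deriv V μ‖ₑ ≤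
      10 * ENNReal.ofReal C * ∫⁻ μ in Ioc (0 : ℝ) (1 / 2), ENNReal.ofReal μ * contractAvg Q g μ z := by
    rw [← lintegral_const_mul' _ _ (ENNReal.mul_ne_top (by simp) (by simp))]
    refine (setLIntegral_mono' measurableSet_Ioc fun μ hμ => ?_).trans
      (lintegral_mono_set (Ioc_subset_Ioc_left h0.le))
    exact enorm_deriv_momentAvg_le hQm hQ hη hc hs hu hut hui huij hz hC1 hC2 hg hutg huijg
      (h0.trans hμ.1) (hμ.2.trans (by norm_num))
  -- If the derivative is not integrable the bound itself is infinite; otherwise the fundamental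
  -- theorem of calculus applies.
  by_cases htop : ∫⁻ μ in Ioc ε (1 / 2), ‖deriv V μ‖ₑ = ⊤
  · rw [htop, top_le_iff] at hbd
    rw [hbd]
    simp
  have hint : IntervalIntegrable (deriv V) volume ε (1 / 2) := by
    rw [intervalIntegrable_iff_integrableOn_Ioc_of_le h1.le]
    exact ⟨(measurable_deriv V).aestronglyMeasurable, lt_top_iff_ne_top.2 htop⟩
  have hftc := intervalIntegral.integral_eq_sub_of_hasDerivAt (f := V) (f' := deriv V)
    (fun μ hμ => by
      rw [uIcc_of_le h1.le] at hμ
      exact hder μ (h0.trans_le hμ.1) (hμ.2.trans (by norm_num))) hint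
  have hVε : V ε = V (1 / 2) - ∫ μ in ε..(1 / 2), deriv V μ := by rw [hftc]; ring
  rw [hVε]
  refine enorm_sub_le.trans (add_le_add ?_ (le_trans ?_ hbd))
  · exact enorm_momentAvg_le hQm hc hs hC0 hg hug (by norm_num)
  · rw [intervalIntegral.integral_of_le h1.le]
    exact enorm_integral_le_lintegral_enorm _

theorem measurable_contractAvg_uncurry {g : ℝ × E3 → ℝ≥0∞}
    (hg : Measurable g) : Measurable fun p : ℝ × (ℝ × E3) => contractAvg Q g p.1 p.2 := by
  unfold contractAvg
  simp only [dil_apply]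
  apply Measurable.lintegral_prod_right'
    (f := fun q : (ℝ × (ℝ × E3)) × (ℝ × E3) =>
      g (q.1.2 + (q.1.1 ^ 2 * (q.2 - q.1.2).1, q.1.1 • (q.2 - q.1.2).2)))
  fun_prop

/-- After exchanging the integrals, `z ↦ z + dil (μ ^ 2) μ (w - z)` is for fixed `w` an affine map
with linear part `dil (1 - μ ^ 2) (1 - μ)`. For `μ ≤ 1/2` its determinant is at least `3/4 · 1/8`,
and `32/3 ≤ 11`. Unlike the pointwise bound of `contractAvg_le`, this does not degenerate as `μ →
0`. -/
theorem lintegral_contractAvg_le {g : ℝ × E3 → ℝ≥0∞}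
    (hg : Measurable g) {μ : ℝ} (h0 : 0 < μ) (h1 : μ ≤ 1 / 2) :
    ∫⁻ z in Q, contractAvg Q g μ z ≤ 11 * volume Q * ∫⁻ w, g w := by
  unfold contractAvg
  rw [lintegral_lintegral_swap]
  swap
  · simp only [dil_apply]
    unfold Function.uncurry
    fun_prop
  have h2 : 0 < 1 - μ ^ 2 := by nlinarith
  have h3 : 0 < 1 - μ := by linarith
  have key (w : ℝ × E3) : ∫⁻ z in Q, g (z + dil (μ ^ 2) μ (w - z)) ≤ 11 * ∫⁻ w, g w := by
    refine (setLIntegral_le_lintegral _ _).trans ?_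
    have h := lintegral_dil h2 h3 (dil (μ ^ 2) μ w) hg
    have e (z : ℝ × E3) : z + dil (μ ^ 2) μ (w - z) =
        dil (1 - μ ^ 2) (1 - μ) z + dil (μ ^ 2) μ w := by
      ext1
      · simp; ring
      · simp only [dil_apply, Prod.snd_add, Prod.snd_sub, smul_sub, sub_smul, one_smul]
        abel
    simp_rw [e]
    rw [h]
    gcongr
    rw [show (11 : ℝ≥0∞) = ENNReal.ofReal 11 by norm_num]
    apply ENNReal.ofReal_le_ofReal
    have : (3 / 4 : ℝ) * (1 / 2) ^ 3 ≤ (1 - μ ^ 2) * (1 - μ) ^ 3 := by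
      gcongr
      · nlinarith
      · linarith
    calc ((1 - μ ^ 2) * (1 - μ) ^ 3)⁻¹ ≤ ((3 / 4 : ℝ) * (1 / 2) ^ 3)⁻¹ := by gcongr
      _ ≤ 11 := by norm_num
  calc ∫⁻ w in Q, ∫⁻ z in Q, g (z + dil (μ ^ 2) μ (w - z)) ≤ ∫⁻ w in Q, 11 * ∫⁻ w, g w :=
        lintegral_mono fun w => key w
    _ = _ := by rw [setLIntegral_const]; ring

end

/-! ### Hölder inequalities and the `L⁸` bound for the parabolic potential. -/

theorem lintegral_sq_le {α : Type*} [MeasurableSpace α] (μ : Measure α) {f : α → ℝ≥0∞}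
    (hf : AEMeasurable f μ) : (∫⁻ x, f x ∂μ) ^ 2 ≤ μ univ * ∫⁻ x, f x ^ 2 ∂μ := by
  have h := ENNReal.lintegral_mul_le_Lp_mul_Lq μ (p := 2) (q := 2) (by
    constructor <;> norm_num) (f := fun _ => 1) (g := f) (by fun_prop) hf
  simp only [Pi.mul_apply, one_mul, ENNReal.one_rpow, lintegral_const] at h
  calc (∫⁻ x, f x ∂μ) ^ 2 ≤ (μ univ ^ (1 / 2 : ℝ) * (∫⁻ x, f x ^ (2 : ℝ) ∂μ) ^ (1 / 2 : ℝ)) ^ 2 := by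
        gcongr
    _ = _ := by
      rw [mul_pow, ← ENNReal.rpow_natCast, ← ENNReal.rpow_natCast, ← ENNReal.rpow_mul,
        ← ENNReal.rpow_mul]
      norm_num

theorem lintegral_mul_pow_eight_le {α : Type*} [MeasurableSpace α] (μ : Measure α)
    {f g : α → ℝ≥0∞} (hf : AEMeasurable f μ) (hg : AEMeasurable g μ) :
    (∫⁻ x, f x * g x ∂μ) ^ 8 ≤ (∫⁻ x, f x ^ (8 / 7 : ℝ) ∂μ) ^ 7 * ∫⁻ x, g x ^ 8 ∂μ := by
  have h := ENNReal.lintegral_mul_le_Lp_mul_Lq μ (p := 8 / 7) (q := 8) (by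
    constructor <;> norm_num) hf hg
  simp only [Pi.mul_apply] at h
  calc (∫⁻ x, f x * g x ∂μ) ^ 8 ≤ ((∫⁻ x, f x ^ (8 / 7 : ℝ) ∂μ) ^ (1 / (8 / 7) : ℝ) *
        (∫⁻ x, g x ^ (8 : ℝ) ∂μ) ^ (1 / 8 : ℝ)) ^ 8 := by gcongr
    _ = _ := by
      rw [mul_pow, ← ENNReal.rpow_natCast, ← ENNReal.rpow_natCast, ← ENNReal.rpow_mul,
        ← ENNReal.rpow_mul]
      norm_num

theorem lintegral_rpow_Ioc_lt_top {r : ℝ} (hr : -1 < r) :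
    ∫⁻ μ in Ioc (0 : ℝ) (1 / 2), ENNReal.ofReal (μ ^ r) < ⊤ := by
  have h := intervalIntegral.intervalIntegrable_rpow' (a := 0) (b := 1 / 2) hr
  rw [intervalIntegrable_iff_integrableOn_Ioc_of_le (by norm_num)] at h
  have := h.2
  rw [hasFiniteIntegral_iff_ofReal] at this
  · exact this
  · filter_upwards [ae_restrict_mem measurableSet_Ioc] with μ hμ
    exact Real.rpow_nonneg hμ.1.le _

section
variable {Q : Set (ℝ × E3)}

theorem contractAvg_sq_le {g : ℝ × E3 → ℝ≥0∞} (hg : Measurable g) (μ : ℝ) (z : ℝ × E3) :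
    contractAvg Q g μ z ^ 2 ≤ volume Q * contractAvg Q (fun w => g w ^ 2) μ z := by
  have h := lintegral_sq_le (volume.restrict Q) (f := fun w => g (z + dil (μ ^ 2) μ (w - z)))
    (by simp only [dil_apply]; fun_prop)
  simpa [contractAvg] using h

/-- The parabolic potential of an `L²` function belongs to `L⁸`. -/
theorem lintegral_potential_pow_le {g : ℝ × E3 → ℝ≥0∞} (hg : Measurable g) :
    ∫⁻ z in Q, (∫⁻ μ in Ioc (0 : ℝ) (1 / 2), ENNReal.ofReal μ * contractAvg Q g μ z) ^ 8 ≤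
      (∫⁻ μ in Ioc (0 : ℝ) (1 / 2), ENNReal.ofReal (μ ^ (-13 / 14 : ℝ))) ^ 7 *
      ((∫⁻ μ in Ioc (0 : ℝ) (1 / 2), ENNReal.ofReal (μ ^ (-1 / 2 : ℝ))) *
        (11 * volume Q ^ 5 * (∫⁻ w, g w ^ 2) ^ 4)) := by
  set N := ∫⁻ w, g w ^ 2
  have hm := measurable_contractAvg_uncurry (Q := Q) hg
  have hm1 (z : ℝ × E3) : Measurable fun μ => contractAvg Q g μ z :=
    hm.comp (measurable_id.prodMk measurable_const)
  have hm2 (μ : ℝ) : Measurable fun z => contractAvg Q g μ z :=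
    hm.comp (measurable_const.prodMk measurable_id)
  set A := ∫⁻ μ in Ioc (0 : ℝ) (1 / 2), ENNReal.ofReal (μ ^ (-13 / 14 : ℝ)) with hA
  have step1 (z : ℝ × E3) :
      (∫⁻ μ in Ioc (0 : ℝ) (1 / 2), ENNReal.ofReal μ * contractAvg Q g μ z) ^ 8 ≤
        A ^ 7 * ∫⁻ μ in Ioc (0 : ℝ) (1 / 2),
          ENNReal.ofReal (μ ^ (29 / 2 : ℝ)) * contractAvg Q g μ z ^ 8 := by
    -- Split `μ = μ^(-13/16) · μ^(29/16)`. With exponents `8/7` and `8` the powers become `-13/14`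
    -- and `29/2`. The average raised to the eighth will cost `μ⁻¹⁵`, leaving `-1/2`; the split is
    -- chosen so that `-13/14` and `-1/2` are both above `-1`.
    have h := lintegral_mul_pow_eight_le (volume.restrict (Ioc (0 : ℝ) (1 / 2)))
      (f := fun μ => ENNReal.ofReal (μ ^ (-13 / 16 : ℝ)))
      (g := fun μ => ENNReal.ofReal (μ ^ (29 / 16 : ℝ)) * contractAvg Q g μ z)
      (by fun_prop) ((by fun_prop : Measurable fun μ : ℝ =>
        ENNReal.ofReal (μ ^ (29 / 16 : ℝ))).mul (hm1 z)).aemeasurable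
    have e1 : ∫⁻ μ in Ioc (0 : ℝ) (1 / 2), ENNReal.ofReal μ * contractAvg Q g μ z =
        ∫⁻ μ in Ioc (0 : ℝ) (1 / 2), ENNReal.ofReal (μ ^ (-13 / 16 : ℝ)) *
          (ENNReal.ofReal (μ ^ (29 / 16 : ℝ)) * contractAvg Q g μ z) := by
      refine setLIntegral_congr_fun measurableSet_Ioc fun μ hμ => ?_
      rw [← mul_assoc, ← ENNReal.ofReal_mul (Real.rpow_nonneg hμ.1.le _), ← Real.rpow_add hμ.1]
      norm_num
    have e2 : A = ∫⁻ μ in Ioc (0 : ℝ) (1 / 2),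
        ENNReal.ofReal (μ ^ (-13 / 16 : ℝ)) ^ (8 / 7 : ℝ) := by
      refine setLIntegral_congr_fun measurableSet_Ioc fun μ hμ => ?_
      rw [ENNReal.ofReal_rpow_of_pos (Real.rpow_pos_of_pos hμ.1 _), ← Real.rpow_mul hμ.1.le]
      norm_num
    have e3 : ∫⁻ μ in Ioc (0 : ℝ) (1 / 2),
          ENNReal.ofReal (μ ^ (29 / 2 : ℝ)) * contractAvg Q g μ z ^ 8 =
        ∫⁻ μ in Ioc (0 : ℝ) (1 / 2),
          (ENNReal.ofReal (μ ^ (29 / 16 : ℝ)) * contractAvg Q g μ z) ^ 8 := by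
      refine setLIntegral_congr_fun measurableSet_Ioc fun μ hμ => ?_
      rw [mul_pow, ← ENNReal.ofReal_pow (Real.rpow_nonneg hμ.1.le _), ← Real.rpow_natCast,
        ← Real.rpow_mul hμ.1.le]
      norm_num
    rw [e1, e2, e3]
    exact h
  have step2 (μ : ℝ) (hμ : μ ∈ Ioc (0 : ℝ) (1 / 2)) :
      ∫⁻ z in Q, ENNReal.ofReal (μ ^ (29 / 2 : ℝ)) * contractAvg Q g μ z ^ 8 ≤
        ENNReal.ofReal (μ ^ (-1 / 2 : ℝ)) * (11 * volume Q ^ 5 * N ^ 4) := by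
    have hg2 : Measurable fun w => g w ^ 2 := by fun_prop
    -- Of the four squared averages, three are bounded pointwise, each losing `μ⁻⁵`, and the last is
    -- kept for the scale-independent `L¹` bound.
    have hpt (z : ℝ × E3) : contractAvg Q g μ z ^ 8 ≤
        (volume Q * (ENNReal.ofReal (μ ^ 5)⁻¹ * N)) ^ 3 *
          (volume Q * contractAvg Q (fun w => g w ^ 2) μ z) := by
      have h2 := contractAvg_sq_le (Q := Q) hg μ z
      calc contractAvg Q g μ z ^ 8 = (contractAvg Q g μ z ^ 2) ^ 3 * contractAvg Q g μ z ^ 2 := by ring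
        _ ≤ _ := by
          gcongr
          refine h2.trans ?_
          gcongr
          exact contractAvg_le hg2 hμ.1 z
    have hmm : Measurable fun z => contractAvg Q (fun w => g w ^ 2) μ z :=
      (measurable_contractAvg_uncurry hg2).comp (measurable_const.prodMk measurable_id)
    calc ∫⁻ z in Q, ENNReal.ofReal (μ ^ (29 / 2 : ℝ)) * contractAvg Q g μ z ^ 8
        ≤ ∫⁻ z in Q, ENNReal.ofReal (μ ^ (29 / 2 : ℝ)) *
          ((volume Q * (ENNReal.ofReal (μ ^ 5)⁻¹ * N)) ^ 3 *
          (volume Q * contractAvg Q (fun w => g w ^ 2) μ z)) := by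
          gcongr with z; exact hpt z
      _ = ENNReal.ofReal (μ ^ (29 / 2 : ℝ)) * ((volume Q * (ENNReal.ofReal (μ ^ 5)⁻¹ * N)) ^ 3 *
          (volume Q * ∫⁻ z in Q, contractAvg Q (fun w => g w ^ 2) μ z)) := by
          rw [lintegral_const_mul _ (by fun_prop), lintegral_const_mul _ (by fun_prop),
            lintegral_const_mul _ hmm]
      _ ≤ ENNReal.ofReal (μ ^ (29 / 2 : ℝ)) * ((volume Q * (ENNReal.ofReal (μ ^ 5)⁻¹ * N)) ^ 3 *
          (volume Q * (11 * volume Q * N))) := by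
          gcongr
          exact lintegral_contractAvg_le hg2 hμ.1 hμ.2
      _ = (ENNReal.ofReal (μ ^ (29 / 2 : ℝ)) * ENNReal.ofReal (μ ^ 5)⁻¹ ^ 3) *
          (11 * volume Q ^ 5 * N ^ 4) := by ring
      _ = _ := by
          congr 1
          have hinv : (μ ^ 5)⁻¹ = μ ^ (-5 : ℝ) := by
            rw [Real.rpow_neg hμ.1.le]; norm_cast
          rw [hinv, ← ENNReal.ofReal_pow (Real.rpow_nonneg hμ.1.le _), ← Real.rpow_natCast,
            ← Real.rpow_mul hμ.1.le, ← ENNReal.ofReal_mul (Real.rpow_nonneg hμ.1.le _),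
            ← Real.rpow_add hμ.1]
          norm_num
  have hm3 : Measurable (Function.uncurry fun (z : ℝ × E3) (μ : ℝ) =>
      ENNReal.ofReal (μ ^ (29 / 2 : ℝ)) * contractAvg Q g μ z ^ 8) := by
    unfold Function.uncurry
    refine Measurable.mul (by fun_prop) (Measurable.pow_const ?_ 8)
    exact hm.comp (measurable_snd.prodMk measurable_fst)
  have hm4 : Measurable fun z => ∫⁻ μ in Ioc (0 : ℝ) (1 / 2),
      ENNReal.ofReal (μ ^ (29 / 2 : ℝ)) * contractAvg Q g μ z ^ 8 := hm3.lintegral_prod_right'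
  refine (lintegral_mono fun z => step1 z).trans ?_
  rw [lintegral_const_mul _ hm4, lintegral_lintegral_swap hm3.aemeasurable,
    ← lintegral_mul_const _ (by fun_prop)]
  gcongr A ^ 7 * ?_
  exact setLIntegral_mono' measurableSet_Ioc fun μ hμ => step2 μ hμ

end

section
variable {Q : Set (ℝ × E3)} {η : ℝ × E3 → ℝ}
variable {u ut : ℝ × E3 → ℝ} {ui : Fin 3 → ℝ × E3 → ℝ} {uij : Fin 3 → Fin 3 → ℝ × E3 → ℝ}

/-- Distance of `momentAvg` to the function itself. -/
theorem enorm_momentAvg_sub_le (hQm : MeasurableSet Q) (hQ : ParabolicStar Q)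
    (hη : ContDiff ℝ ∞ η) (hc : HasCompactSupport η) (hs : tsupport η ⊆ Q) (h1 : ∫ w, η w = 1)
    (hu : IntegrableOn u Q) (hum : Measurable u) {z : ℝ × E3} (hz : z ∈ Q) {C : ℝ}
    (hC0 : ∀ ζ, |momentKernel (fun ζ => η (z + ζ)) ζ| ≤ C) {μ : ℝ} (hμ0 : 0 < μ) (hμ1 : μ ≤ 1) :
    ‖u z - momentAvg Q η u z μ‖ₑ ≤ ENNReal.ofReal C *
      contractAvg Q (fun w => ‖Q.indicator u w - Q.indicator u z‖ₑ) μ z := by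
  have hθs := contDiff_momentKernel (contDiff_shift hη z)
  have hθc := hasCompactSupport_momentKernel_shift hc z
  -- Subtracting the constant `u z` under the integral needs total mass one at every scale: the
  -- rescaled kernel is supported in `Q`, the dilation contributes `μ ^ 5`, and the moment kernel
  -- integrates to `∫ η = 1`.
  have hmass : (μ ^ 5)⁻¹ * ∫ w in Q, rescale z μ (momentKernel fun ζ => η (z + ζ)) w = 1 := by
    rw [setIntegral_eq_integral_of_forall_compl_eq_zero]
    · have h := integral_dil (a := (μ ^ 2)⁻¹) (b := μ⁻¹) (by positivity) (by positivity)
        (-dil (μ ^ 2)⁻¹ μ⁻¹ z) (momentKernel fun ζ => η (z + ζ))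
      have e : (fun w => rescale z μ (momentKernel fun ζ => η (z + ζ)) w) = fun w =>
          momentKernel (fun ζ => η (z + ζ)) (dil (μ ^ 2)⁻¹ μ⁻¹ w + -dil (μ ^ 2)⁻¹ μ⁻¹ z) := by
        ext w
        rw [rescale, map_sub, sub_eq_add_neg]
      have hF : ∫ ζ, η (z + ζ) = 1 := by rw [integral_add_left_eq_self]; exact h1
      rw [e, h, integral_momentKernel (contDiff_shift hη z)
        (HasCompactSupport.intro (shift_support hc z).1 fun ζ hζ =>
          image_eq_zero_of_notMem_tsupport (((shift_support hc z).2 ζ).1 hζ)), hF]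
      field_simp
    · intro w hw
      by_contra hne
      obtain ⟨hK, hKiff⟩ := shift_support hc z
      refine hw (tsupport_rescale_subset_of_star hQ hK (fun ζ hζ =>
        momentKernel_shift_eq_zero hc ((hKiff ζ).1 hζ)) hz ?_ hμ0 hμ1 (subset_tsupport _ hne))
      rintro _ ⟨w, hw, rfl⟩
      simpa using hs hw
  have hi1 := integrable_mul_rescale hu hθs.continuous hθc z (μ := μ)
  have hi2 : IntegrableOn (fun w => u z * rescale z μ (momentKernel fun ζ => η (z + ζ)) w) Q := by
    have : HasCompactSupport (rescale z μ (momentKernel fun ζ => η (z + ζ))) :=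
      (tsupport_rescale_subset hθc.isCompact
        (fun ζ hζ => image_eq_zero_of_notMem_tsupport hζ) z hμ0.ne').2
    exact (((contDiff_rescale hθs z μ).continuous.integrable_of_hasCompactSupport
      this).const_mul _).integrableOn
  have e : u z - momentAvg Q η u z μ = (μ ^ 5)⁻¹ *
      ∫ w in Q, (u z - u w) * rescale z μ (momentKernel fun ζ => η (z + ζ)) w := by
    simp_rw [sub_mul]
    rw [integral_sub hi2 hi1, integral_const_mul, mul_sub, momentAvg, mul_left_comm, hmass, mul_one]
  have hgm : Measurable fun w => ‖Q.indicator u w - Q.indicator u z‖ₑ :=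
    ((hum.indicator hQm).sub_const _).enorm
  have h := enorm_integral_mul_rescale_le hQm hC0 (v := fun w => u z - u w)
    (fun ζ hζ => momentKernel_shift_eq_zero hc (fun h => hζ (hs h)))
    (fun w hw => by rw [indicator_of_mem hw, indicator_of_mem hz, enorm_sub_rev]) hgm hμ0
  rw [e, enorm_mul, Real.enorm_eq_ofReal (by positivity)]
  refine (mul_le_mul_right h _).trans (le_of_eq ?_)
  rw [← mul_assoc, mul_comm (ENNReal.ofReal C), ← mul_assoc, ← ENNReal.ofReal_mul (by positivity),
    inv_mul_cancel₀ (by positivity)]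
  simp

/-- Contractions act continuously in `L¹`. -/
theorem exists_lintegral_contractAvg_sub_le (hQm : MeasurableSet Q) (hQb : Bornology.IsBounded Q)
    (hu : IntegrableOn u Q) (hum : Measurable u) {δ : ℝ} (hδ : 0 < δ) :
    ∃ μ, 0 < μ ∧ μ < 1 / 2 ∧
      ∫⁻ z in Q, contractAvg Q (fun w => ‖Q.indicator u w - Q.indicator u z‖ₑ) μ z ≤
        ENNReal.ofReal δ * (12 * volume Q + volume Q ^ 2) := by
  have hu0 : Integrable (Q.indicator u) := (integrable_indicator_iff hQm).2 hu
  have hu0m : Measurable (Q.indicator u) := hum.indicator hQm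
  obtain ⟨c, hcc, hcu, hcont, -⟩ := hu0.exists_hasCompactSupport_lintegral_sub_le
    (ε := ENNReal.ofReal δ) (by simpa using hδ)
  obtain ⟨ρ, hρ, hunif⟩ := Metric.uniformContinuous_iff.1
    (hcc.uniformContinuous_of_continuous hcont) δ hδ
  obtain ⟨R, hR⟩ := Metric.isBounded_iff.1 hQb
  -- A contraction by `μ` displaces `z` by at most `μ |R|`, which must be below the modulus `ρ` of
  -- uniform continuity of the approximating function; `|R| + 1` avoids a zero denominator.
  set μ : ℝ := min (1 / 4) (ρ / (2 * (|R| + 1)))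
  have hμ0 : 0 < μ := by positivity
  have hμ1 : μ ≤ 1 / 4 := min_le_left _ _
  have hμ2 : μ * |R| < ρ := by
    calc μ * |R| ≤ ρ / (2 * (|R| + 1)) * |R| := by gcongr; exact min_le_right _ _
      _ = ρ * (|R| / (2 * (|R| + 1))) := by ring
      _ < ρ * 1 := by
        gcongr
        rw [div_lt_one (by positivity)]
        linarith [abs_nonneg R]
      _ = ρ := mul_one _
  refine ⟨μ, hμ0, by linarith, ?_⟩
  set g : ℝ × E3 → ℝ≥0∞ := fun w => ‖Q.indicator u w - c w‖ₑ with hg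
  have hgm : Measurable g := (hu0m.sub hcont.measurable).enorm
  have hgi : ∫⁻ w, g w ≤ ENNReal.ofReal δ := hcu
  have hpt (z : ℝ × E3) (hz : z ∈ Q) :
      contractAvg Q (fun w => ‖Q.indicator u w - Q.indicator u z‖ₑ) μ z ≤
        contractAvg Q g μ z + (ENNReal.ofReal δ + g z) * volume Q := by
    rw [← setLIntegral_const, contractAvg, contractAvg, ← lintegral_add_right _ measurable_const]
    refine setLIntegral_mono' hQm fun w hw => ?_
    have hdist : dist (z + dil (μ ^ 2) μ (w - z)) z < ρ := by
      rw [dist_eq_norm, add_sub_cancel_left]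
      refine lt_of_le_of_lt ?_ hμ2
      have hwz : ‖w - z‖ ≤ |R| := by
        rw [← dist_eq_norm]; exact (hR hw hz).trans (le_abs_self R)
      rw [dil_apply, Prod.norm_def, max_le_iff]
      constructor
      · rw [norm_mul, norm_pow, Real.norm_of_nonneg hμ0.le]
        have := (norm_fst_le (w - z)).trans hwz
        have : μ ^ 2 ≤ μ := by nlinarith
        gcongr
      · rw [norm_smul, Real.norm_of_nonneg hμ0.le]
        have := (norm_snd_le (w - z)).trans hwz
        gcongr
    have hclose := (hunif hdist).le
    set p := z + dil (μ ^ 2) μ (w - z)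
    have e : Q.indicator u p - Q.indicator u z =
        (Q.indicator u p - c p) + ((c p - c z) - (Q.indicator u z - c z)) := by ring
    calc ‖Q.indicator u p - Q.indicator u z‖ₑ
        ≤ ‖Q.indicator u p - c p‖ₑ + (‖c p - c z‖ₑ + ‖Q.indicator u z - c z‖ₑ) := by
          rw [e]
          exact (enorm_add_le _ _).trans (by gcongr; exact enorm_sub_le)
      _ ≤ g p + (ENNReal.ofReal δ + g z) := by
          gcongr
          rw [Real.enorm_eq_ofReal_abs]
          exact ENNReal.ofReal_le_ofReal (by simpa [Real.dist_eq] using hclose)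
  calc ∫⁻ z in Q, contractAvg Q (fun w => ‖Q.indicator u w - Q.indicator u z‖ₑ) μ z
      ≤ ∫⁻ z in Q, (contractAvg Q g μ z + (ENNReal.ofReal δ + g z) * volume Q) :=
        setLIntegral_mono' hQm hpt
    _ = (∫⁻ z in Q, contractAvg Q g μ z) +
        (ENNReal.ofReal δ * volume Q + ∫⁻ z in Q, g z) * volume Q := by
        rw [lintegral_add_right _ (by fun_prop), lintegral_mul_const _ (by fun_prop),
          lintegral_add_right _ hgm, setLIntegral_const]
    _ ≤ 11 * volume Q * ENNReal.ofReal δ +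
        (ENNReal.ofReal δ * volume Q + ENNReal.ofReal δ) * volume Q := by
        gcongr
        · exact (lintegral_contractAvg_le hgm hμ0 (by linarith)).trans (by gcongr)
        · exact (setLIntegral_le_lintegral _ _).trans hgi
    _ = _ := by ring

/-- A function with `L²` derivatives `u_t`, `u_{x_i x_j}` is controlled almost everywhere by a
parabolic potential. -/
theorem ae_enorm_le_potential (hQm : MeasurableSet Q) (hQ : ParabolicStar Q)
    (hQb : Bornology.IsBounded Q)
    (hη : ContDiff ℝ ∞ η) (hc : HasCompactSupport η) (hs : tsupport η ⊆ Q) (h1 : ∫ w, η w = 1)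
    (hu : IntegrableOn u Q) (hum : Measurable u)
    (hut : IsWeakDerivOn Q u ut timeDir) (hui : ∀ i, IsWeakDerivOn Q u (ui i) (spaceDir i))
    (huij : ∀ i j, IsWeakDerivOn Q (ui i) (uij i j) (spaceDir j))
    {C : ℝ} (hC : ∀ z ∈ Q,
      (∀ ζ, |momentKernel (fun ζ => η (z + ζ)) ζ| ≤ C) ∧
      (∀ ζ, |2 * ζ.1 * momentKernel (fun ζ => η (z + ζ)) ζ| ≤ C) ∧
      (∀ i j ζ, |quadKernel (fun ζ => η (z + ζ)) i j ζ| ≤ C))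
    {g : ℝ × E3 → ℝ≥0∞} (hg : Measurable g) (hug : ∀ w ∈ Q, ‖u w‖ₑ ≤ g w)
    (hutg : ∀ w ∈ Q, ‖ut w‖ₑ ≤ g w) (huijg : ∀ i j, ∀ w ∈ Q, ‖uij i j w‖ₑ ≤ g w) :
    ∀ᵐ z ∂(volume.restrict Q), ‖u z‖ₑ ≤ ENNReal.ofReal C * contractAvg Q g (1 / 2) z +
      10 * ENNReal.ofReal C *
        ∫⁻ μ in Ioc (0 : ℝ) (1 / 2), ENNReal.ofReal μ * contractAvg Q g μ z := by
  set B : ℝ × E3 → ℝ≥0∞ := fun z => ENNReal.ofReal C * contractAvg Q g (1 / 2) z +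
      10 * ENNReal.ofReal C *
        ∫⁻ μ in Ioc (0 : ℝ) (1 / 2), ENNReal.ofReal μ * contractAvg Q g μ z with hB
  have hm := measurable_contractAvg_uncurry (Q := Q) hg
  have hBm : Measurable B := by
    have hm3 : Measurable (Function.uncurry fun (z : ℝ × E3) (μ : ℝ) =>
        ENNReal.ofReal μ * contractAvg Q g μ z) := by
      unfold Function.uncurry
      exact Measurable.mul (by fun_prop) (hm.comp (measurable_snd.prodMk measurable_fst))
    refine (Measurable.const_mul ?_ _).add (Measurable.const_mul hm3.lintegral_prod_right' _)
    exact hm.comp (measurable_const.prodMk measurable_id)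
  have hvol : volume Q ≠ ⊤ := hQb.measure_lt_top.ne
  -- The majorant `B` does not depend on the scale of the average, so the excess of `‖u‖ₑ` over `B`
  -- can be made arbitrarily small in `L¹` and hence vanishes almost everywhere.
  have hle (δ : ℝ) (hδ : 0 < δ) : ∫⁻ z in Q, (‖u z‖ₑ - B z) ≤
      ENNReal.ofReal δ * (ENNReal.ofReal C * (12 * volume Q + volume Q ^ 2)) := by
    obtain ⟨μ, hμ0, hμ1, hμ⟩ := exists_lintegral_contractAvg_sub_le hQm hQb hu hum hδ
    calc ∫⁻ z in Q, (‖u z‖ₑ - B z) ≤ ∫⁻ z in Q, ENNReal.ofReal C *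
          contractAvg Q (fun w => ‖Q.indicator u w - Q.indicator u z‖ₑ) μ z := by
          refine setLIntegral_mono' hQm fun z hz => ?_
          rw [tsub_le_iff_right]
          obtain ⟨c0, c1, c2⟩ := hC z hz
          have t1 := enorm_momentAvg_sub_le hQm hQ hη hc hs h1 hu hum hz c0 hμ0 (by linarith)
          have t2 := enorm_momentAvg_le_potential hQm hQ hη hc hs hu hut hui huij hz c0 c1 c2 hg
            hug hutg huijg hμ0 hμ1
          calc ‖u z‖ₑ = ‖(u z - momentAvg Q η u z μ) + momentAvg Q η u z μ‖ₑ := by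
                rw [sub_add_cancel]
            _ ≤ _ := (enorm_add_le _ _).trans (add_le_add t1 t2)
      _ = ENNReal.ofReal C * ∫⁻ z in Q,
          contractAvg Q (fun w => ‖Q.indicator u w - Q.indicator u z‖ₑ) μ z :=
          lintegral_const_mul' _ _ (by simp)
      _ ≤ ENNReal.ofReal C * (ENNReal.ofReal δ * (12 * volume Q + volume Q ^ 2)) := by gcongr
      _ = _ := by ring
  have hzero : ∫⁻ z in Q, (‖u z‖ₑ - B z) = 0 := by
    have hK : ENNReal.ofReal C * (12 * volume Q + volume Q ^ 2) ≠ ⊤ := by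
      refine ENNReal.mul_ne_top (by simp) (ENNReal.add_ne_top.2 ⟨ENNReal.mul_ne_top (by simp) hvol,
        ENNReal.pow_ne_top hvol⟩)
    have ht : Filter.Tendsto (fun δ : ℝ => ENNReal.ofReal δ *
        (ENNReal.ofReal C * (12 * volume Q + volume Q ^ 2))) (nhdsWithin 0 (Ioi 0)) (nhds 0) := by
      have h2 : Filter.Tendsto (fun δ : ℝ => ENNReal.ofReal δ) (nhdsWithin 0 (Ioi 0)) (nhds 0) := by
        have := (ENNReal.continuous_ofReal.tendsto 0).mono_left
          (nhdsWithin_le_nhds (s := Ioi (0 : ℝ)))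
        simpa using this
      simpa using ENNReal.Tendsto.mul_const h2 (Or.inr hK)
    refine le_antisymm (ge_of_tendsto ht ?_) zero_le
    filter_upwards [self_mem_nhdsWithin] with δ hδ using hle δ hδ
  have hzero := (lintegral_eq_zero_iff (hum.enorm.sub hBm)).1 hzero
  filter_upwards [hzero] with z hz
  exact tsub_eq_zero_iff_le.1 hz

/-- The parabolic Sobolev inequality. -/
theorem exists_lintegral_pow_eight_le (hQm : MeasurableSet Q) (hQ : ParabolicStar Q)
    (hQo : IsOpen Q) (hQne : Q.Nonempty) (hQb : Bornology.IsBounded Q) :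
    ∃ K : ℝ≥0∞, K ≠ ⊤ ∧ ∀ (u ut : ℝ × E3 → ℝ) (ui : Fin 3 → ℝ × E3 → ℝ)
      (uij : Fin 3 → Fin 3 → ℝ × E3 → ℝ) (g : ℝ × E3 → ℝ≥0∞), IntegrableOn u Q → Measurable u →
      IsWeakDerivOn Q u ut timeDir → (∀ i, IsWeakDerivOn Q u (ui i) (spaceDir i)) →
      (∀ i j, IsWeakDerivOn Q (ui i) (uij i j) (spaceDir j)) →
      Measurable g → (∀ w ∈ Q, ‖u w‖ₑ ≤ g w) → (∀ w ∈ Q, ‖ut w‖ₑ ≤ g w) →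
      (∀ i j, ∀ w ∈ Q, ‖uij i j w‖ₑ ≤ g w) →
      ∫⁻ z in Q, ‖u z‖ₑ ^ 8 ≤ K * (∫⁻ z, g z ^ 2) ^ 4 := by
  obtain ⟨z₀, hz₀⟩ := hQne
  obtain ⟨r, hr, hball⟩ := Metric.isOpen_iff.1 hQo z₀ hz₀
  have hsub : Metric.closedBall z₀ (r / 2) ⊆ Q :=
    (Metric.closedBall_subset_ball (by linarith)).trans hball
  -- One bump inside `Q` generates all the kernels, so the constant below depends on `Q` alone.
  let b : ContDiffBump z₀ := ⟨r / 4, r / 2, by linarith, by linarith⟩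
  have hbη : ContDiff ℝ ∞ (b.normed volume) := b.contDiff_normed
  have hbc : HasCompactSupport (b.normed volume) := b.hasCompactSupport_normed
  have hbs : tsupport (b.normed volume) ⊆ Q := by rw [b.tsupport_normed_eq]; exact hsub
  have hb1 : ∫ w, b.normed volume w = 1 := b.integral_normed
  obtain ⟨C, hC0, hC⟩ := exists_kernel_bound hQb hbη hbc hbs
  have hvol : volume Q ≠ ⊤ := hQb.measure_lt_top.ne
  set A1 := ∫⁻ μ in Ioc (0 : ℝ) (1 / 2), ENNReal.ofReal (μ ^ (-13 / 14 : ℝ))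
  set A2 := ∫⁻ μ in Ioc (0 : ℝ) (1 / 2), ENNReal.ofReal (μ ^ (-1 / 2 : ℝ))
  have hA1 : A1 ≠ ⊤ := (lintegral_rpow_Ioc_lt_top (by norm_num)).ne
  have hA2 : A2 ≠ ⊤ := (lintegral_rpow_Ioc_lt_top (by norm_num)).ne
  -- `2 ^ 7` comes from `(a + b) ^ 8 ≤ 2 ^ 7 (a ^ 8 + b ^ 8)`, and `32 = (1/2)⁻⁵` from the average
  -- at the largest scale; `A1` and `A2` are the two integrals over scales.
  refine ⟨2 ^ 7 * (ENNReal.ofReal C ^ 8 * (volume Q * ENNReal.ofReal 32) ^ 4 * volume Q +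
    (10 * ENNReal.ofReal C) ^ 8 * (A1 ^ 7 * (A2 * (11 * volume Q ^ 5)))), ?_, ?_⟩
  · finiteness
  intro u ut ui uij g hu hum hut hui huij hg hug hutg huijg
  have h := ae_enorm_le_potential hQm hQ hQb hbη hbc hbs hb1 hu hum hut hui huij hC hg hug hutg huijg
  have hP := lintegral_potential_pow_le (Q := Q) hg
  set P : ℝ × E3 → ℝ≥0∞ := fun z =>
    ∫⁻ μ in Ioc (0 : ℝ) (1 / 2), ENNReal.ofReal μ * contractAvg Q g μ z
  set N := ∫⁻ z, g z ^ 2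
  have hc8 (z : ℝ × E3) : contractAvg Q g (1 / 2) z ^ 8 ≤
      (volume Q * ENNReal.ofReal 32) ^ 4 * N ^ 4 := by
    have h2 := contractAvg_sq_le (Q := Q) hg (1 / 2) z
    have h3 := contractAvg_le (Q := Q) (g := fun w => g w ^ 2) (by fun_prop)
      (by norm_num : (0 : ℝ) < 1 / 2) z
    norm_num at h3
    calc contractAvg Q g (1 / 2) z ^ 8 = (contractAvg Q g (1 / 2) z ^ 2) ^ 4 := by ring
      _ ≤ (volume Q * (ENNReal.ofReal 32 * N)) ^ 4 := by
        gcongr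
        refine h2.trans ?_
        gcongr
        simpa using h3
      _ = _ := by ring
  calc ∫⁻ z in Q, ‖u z‖ₑ ^ 8
      ≤ ∫⁻ z in Q, 2 ^ 7 * (ENNReal.ofReal C ^ 8 * ((volume Q * ENNReal.ofReal 32) ^ 4 * N ^ 4) +
          (10 * ENNReal.ofReal C) ^ 8 * P z ^ 8) := by
        refine lintegral_mono_ae ?_
        filter_upwards [h] with z hz
        calc ‖u z‖ₑ ^ 8 ≤ (ENNReal.ofReal C * contractAvg Q g (1 / 2) z +
              10 * ENNReal.ofReal C * P z) ^ 8 := by gcongr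
          _ ≤ 2 ^ 7 * ((ENNReal.ofReal C * contractAvg Q g (1 / 2) z) ^ 8 +
              (10 * ENNReal.ofReal C * P z) ^ 8) := by
              have := ENNReal.rpow_add_le_mul_rpow_add_rpow
                (ENNReal.ofReal C * contractAvg Q g (1 / 2) z) (10 * ENNReal.ofReal C * P z)
                (p := 8) (by norm_num)
              norm_num at this
              norm_num
              exact_mod_cast this
          _ ≤ _ := by
              rw [mul_pow, mul_pow]
              gcongr
              exact hc8 z
    _ ≤ 2 ^ 7 * (ENNReal.ofReal C ^ 8 * ((volume Q * ENNReal.ofReal 32) ^ 4 * N ^ 4) * volume Q +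
          (10 * ENNReal.ofReal C) ^ 8 * ∫⁻ z in Q, P z ^ 8) := by
        rw [lintegral_const_mul' _ _ (by finiteness), lintegral_add_left measurable_const,
          setLIntegral_const, lintegral_const_mul' _ _ (by finiteness)]
    _ ≤ 2 ^ 7 * (ENNReal.ofReal C ^ 8 * ((volume Q * ENNReal.ofReal 32) ^ 4 * N ^ 4) * volume Q +
          (10 * ENNReal.ofReal C) ^ 8 * (A1 ^ 7 * (A2 * (11 * volume Q ^ 5 * N ^ 4)))) := by
        gcongr
    _ = _ := by ring

end

/-! ### Embedding of the parabolic Sobolev space into `L⁸` of the cylinder. -/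

theorem cylinderMeasure_eq (Ω : Set E3) (τ : ℝ) :
    cylinderMeasure Ω τ = (volume : Measure (ℝ × E3)).restrict (Ioo 0 τ ×ˢ Ω) := by
  rw [cylinderMeasure, timeMeasure, Measure.prod_restrict]
  rfl

theorem integral_cylinder (Ω : Set E3) (τ : ℝ) (f : ℝ × E3 → ℝ) :
    ∫ z, f z ∂(cylinderMeasure Ω τ) = ∫ z in Ioo 0 τ ×ˢ Ω, f z := by
  rw [cylinderMeasure_eq]

theorem lintegral_cylinder (Ω : Set E3) (τ : ℝ) (f : ℝ × E3 → ℝ≥0∞) :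
    ∫⁻ z, f z ∂(cylinderMeasure Ω τ) = ∫⁻ z in Ioo 0 τ ×ˢ Ω, f z := by
  rw [cylinderMeasure_eq]

theorem integrable_cylinder_iff (Ω : Set E3) (τ : ℝ) (f : ℝ × E3 → ℝ) :
    Integrable f (cylinderMeasure Ω τ) ↔ IntegrableOn f (Ioo 0 τ ×ˢ Ω) := by
  rw [cylinderMeasure_eq, IntegrableOn]

theorem lintegral_enorm_sq_eq {α : Type*} [MeasurableSpace α] {μ : Measure α} (f : Lp ℝ 2 μ) :
    ∫⁻ x, ‖f x‖ₑ ^ 2 ∂μ = ENNReal.ofReal (‖f‖ ^ 2) := by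
  have h : eLpNorm f 2 μ = ENNReal.ofReal ‖f‖ := by
    rw [Lp.norm_def, ENNReal.ofReal_toReal (Lp.eLpNorm_ne_top f)]
  have h2 := eLpNorm_nnreal_pow_eq_lintegral (f := f) (μ := μ) (p := 2) (by norm_num)
  rw [ENNReal.ofReal_pow (norm_nonneg _), ← h]
  simpa using h2.symm

/-- `W^{2,1}_2(Q_τ)` embeds into `L⁸(Q_τ)`. -/
theorem exists_eLpNorm_eight_le {Ω : Set E3} (hΩo : IsOpen Ω) (hΩne : Ω.Nonempty)
    (hΩc : Convex ℝ Ω) (hΩb : Bornology.IsBounded Ω) {τ : ℝ} (hτ : 0 < τ) :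
    ∃ K : ℝ, 0 ≤ K ∧ ∀ T : W21 Ω τ,
      ∫⁻ z, ‖((T : PiLp 2 fun _ : W21Index => L2Q Ω τ) .val) z‖ₑ ^ 8 ∂(cylinderMeasure Ω τ) ≤
        ENNReal.ofReal (K * ‖T‖ ^ 8) := by
  have hQo : IsOpen (Ioo 0 τ ×ˢ Ω) := isOpen_Ioo.prod hΩo
  have hQb : Bornology.IsBounded (Ioo 0 τ ×ˢ Ω) := (Metric.isBounded_Ioo 0 τ).prod hΩb
  have hQne : (Ioo 0 τ ×ˢ Ω).Nonempty := (nonempty_Ioo.2 hτ).prod hΩne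
  obtain ⟨K, hK, h⟩ := exists_lintegral_pow_eight_le hQo.measurableSet
    (parabolicStar_prod (convex_Ioo 0 τ) hΩc) hQo hQne hQb
  refine ⟨K.toReal, ENNReal.toReal_nonneg, fun T => ?_⟩
  set p : PiLp 2 fun _ : W21Index => L2Q Ω τ := T.1 with hp
  have hfin : IsFiniteMeasure (cylinderMeasure Ω τ) := by
    rw [cylinderMeasure_eq]
    exact ⟨by simpa using hQb.measure_lt_top⟩
  have hpm (i : W21Index) : Measurable (p i) := (Lp.stronglyMeasurable (p i)).measurable
  -- The pointwise Euclidean length of all components majorizes each of them, and the integral of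
  -- its square is exactly the squared `W21` norm.
  set g : ℝ × E3 → ℝ≥0∞ := (Ioo 0 τ ×ˢ Ω).indicator
    fun z => (∑ i, ‖p i z‖ₑ ^ 2) ^ (1 / 2 : ℝ) with hg
  have hgm : Measurable g := by
    refine Measurable.indicator ?_ hQo.measurableSet
    fun_prop
  have hle (i : W21Index) : ∀ w ∈ Ioo 0 τ ×ˢ Ω, ‖p i w‖ₑ ≤ g w := by
    intro w hw
    rw [hg, indicator_of_mem hw]
    calc ‖p i w‖ₑ = (‖p i w‖ₑ ^ 2) ^ (1 / 2 : ℝ) := by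
          rw [← ENNReal.rpow_natCast, ← ENNReal.rpow_mul]; norm_num
      _ ≤ _ := by
          gcongr
          exact Finset.single_le_sum (f := fun i => ‖p i w‖ₑ ^ 2) (fun _ _ => zero_le)
            (Finset.mem_univ i)
  have hg2 : ∫⁻ z, g z ^ 2 = ENNReal.ofReal (‖T‖ ^ 2) := by
    have e : (fun z => g z ^ 2) = (Ioo 0 τ ×ˢ Ω).indicator fun z => ∑ i, ‖p i z‖ₑ ^ 2 := by
      ext z
      by_cases hz : z ∈ Ioo 0 τ ×ˢ Ω
      · rw [hg, indicator_of_mem hz, indicator_of_mem hz, ← ENNReal.rpow_natCast,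
          ← ENNReal.rpow_mul]
        norm_num
      · rw [hg, indicator_of_notMem hz, indicator_of_notMem hz]; simp
    rw [e, lintegral_indicator hQo.measurableSet, ← lintegral_cylinder,
      lintegral_finsetSum _ (fun i _ => by fun_prop)]
    simp_rw [lintegral_enorm_sq_eq]
    rw [← ENNReal.ofReal_sum_of_nonneg (fun _ _ => by positivity), Submodule.coe_norm,
      PiLp.norm_sq_eq_of_L2]
  obtain ⟨hT1, hT2, hT3⟩ := T.2
  have wk {a b : L2Q Ω τ} {e : ℝ × E3} (hab : HasWeakDeriv a b e) :
      IsWeakDerivOn (Ioo 0 τ ×ˢ Ω) a b e := by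
    intro φ h1 h2 h3
    have := hab φ h1 h2 h3
    rwa [integral_cylinder, integral_cylinder] at this
  have hint : IntegrableOn (p .val) (Ioo 0 τ ×ˢ Ω) := by
    have := (Lp.memLp (p .val)).integrable (by norm_num)
    rwa [integrable_cylinder_iff] at this
  have := h (p .val) (p .dt) (fun i => p (.dx i)) (fun i j => p (.dxx i j)) g hint (hpm _)
    (wk hT1) (fun i => wk (hT2 i)) (fun i j => wk (hT3 i j)) hgm (hle _) (hle _)
    (fun i j => hle _)
  rw [lintegral_cylinder]
  refine this.trans (le_of_eq ?_)
  rw [hg2, ENNReal.ofReal_mul ENNReal.toReal_nonneg, ENNReal.ofReal_toReal hK,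
    ← ENNReal.ofReal_pow (by positivity), ← pow_mul]

/-! ### The outward normal of a convex domain -/

open Filter Topology

section
variable {Ω U : Set E3} {ρ : E3 → ℝ} {x : E3}

theorem IsC2DefiningFunction.hasStrictFDerivAt (h : IsC2DefiningFunction Ω U ρ) (hx : x ∈ U) :
    HasStrictFDerivAt ρ (fderiv ℝ ρ x) x :=
  ((h.2.1 x hx).contDiffAt (h.1.mem_nhds hx)).hasStrictFDerivAt (by norm_num)

theorem inner_gradient_eq (ρ : E3 → ℝ) (x v : E3) :
    inner ℝ (gradient ρ x) v = fderiv ℝ ρ x v := by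
  rw [gradient, InnerProductSpace.toDual_symm_apply]

theorem IsC2DefiningFunction.mem_iff (h : IsC2DefiningFunction Ω U ρ) (hx : x ∈ U) :
    x ∈ Ω ↔ ρ x < 0 := by
  have : x ∈ Ω ∩ U ↔ x ∈ {x ∈ U | ρ x < 0} := by rw [h.2.2.2]
  simpa [hx] using this

theorem IsC2DefiningFunction.eq_zero (h : IsC2DefiningFunction Ω U ρ) (hΩ : IsOpen Ω)
    (hx : x ∈ U) (hxf : x ∈ frontier Ω) : ρ x = 0 := by
  rw [hΩ.frontier_eq] at hxf
  refine le_antisymm ?_ (not_lt.1 fun hlt => hxf.2 ((h.mem_iff hx).2 hlt))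
  have hc : ContinuousAt ρ x := (h.hasStrictFDerivAt hx).hasFDerivAt.continuousAt
  have hfr : ∃ᶠ y in 𝓝 x, y ∈ Ω := mem_closure_iff_frequently.1 hxf.1
  by_contra! hpos
  have h1 : ∀ᶠ y in 𝓝 x, 0 < ρ y := hc.eventually (lt_mem_nhds hpos)
  obtain ⟨y, hyΩ, hy1, hyU⟩ := (hfr.and_eventually (h1.and (h.1.mem_nhds hx))).exists
  exact absurd ((h.mem_iff hyU).1 hyΩ) (not_lt.2 hy1.le)

/-- Moving from a boundary point in a direction of negative slope enters the domain. -/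
theorem IsC2DefiningFunction.eventually_mem (h : IsC2DefiningFunction Ω U ρ) (hΩ : IsOpen Ω)
    (hx : x ∈ U) (hxf : x ∈ frontier Ω) {v : E3} (hv : inner ℝ (gradient ρ x) v < 0) :
    ∀ᶠ s in 𝓝[>] (0 : ℝ), x + s • v ∈ Ω := by
  rw [inner_gradient_eq] at hv
  have hd : HasDerivAt (fun s : ℝ => ρ (x + s • v)) (fderiv ℝ ρ x v) 0 := by
    have h1 : HasDerivAt (fun s : ℝ => x + s • v) v 0 := by
      simpa using ((hasDerivAt_id (0 : ℝ)).smul_const v).const_add x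
    have h2 : HasFDerivAt ρ (fderiv ℝ ρ x) (x + (0 : ℝ) • v) := by
      simpa using (h.hasStrictFDerivAt hx).hasFDerivAt
    exact h2.comp_hasDerivAt 0 h1
  have hslope := hd.hasDerivWithinAt (s := Ioi 0)
  rw [hasDerivWithinAt_iff_tendsto_slope' (by simp)] at hslope
  have h3 : ∀ᶠ s in 𝓝[>] (0 : ℝ), slope (fun s : ℝ => ρ (x + s • v)) 0 s < 0 :=
    hslope.eventually (gt_mem_nhds hv)
  have h4 : ∀ᶠ s in 𝓝[>] (0 : ℝ), x + s • v ∈ U := by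
    have : Tendsto (fun s : ℝ => x + s • v) (𝓝[>] 0) (𝓝 x) := by
      have : Continuous fun s : ℝ => x + s • v := by fun_prop
      simpa using (this.tendsto 0).mono_left nhdsWithin_le_nhds
    exact this.eventually (h.1.mem_nhds hx)
  filter_upwards [h3, h4, self_mem_nhdsWithin] with s hs hsU hs0
  rw [h.mem_iff hsU]
  simp only [slope, sub_zero, zero_smul, add_zero, h.eq_zero hΩ hx hxf, vsub_eq_sub,
    smul_eq_mul] at hs
  have hs0' : 0 < s := hs0
  by_contra! hge
  exact absurd hs (not_lt.2 (by positivity))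

/-- The gradient of a defining function supports a convex domain. -/
theorem IsC2DefiningFunction.inner_sub_neg (h : IsC2DefiningFunction Ω U ρ) (hΩ : IsOpen Ω)
    (hc : Convex ℝ Ω) (hx : x ∈ U) (hxf : x ∈ frontier Ω) {z : E3} (hz : z ∈ Ω) :
    inner ℝ (gradient ρ x) (z - x) < 0 := by
  have hle : ∀ z ∈ Ω, inner ℝ (gradient ρ x) (z - x) ≤ 0 := by
    intro z hz
    by_contra! hpos
    rw [inner_gradient_eq] at hpos
    have hd : HasDerivAt (fun s : ℝ => ρ (x + s • (z - x))) (fderiv ℝ ρ x (z - x)) 0 := by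
      have h1 : HasDerivAt (fun s : ℝ => x + s • (z - x)) (z - x) 0 := by
        simpa using ((hasDerivAt_id (0 : ℝ)).smul_const (z - x)).const_add x
      have h2 : HasFDerivAt ρ (fderiv ℝ ρ x) (x + (0 : ℝ) • (z - x)) := by
        simpa using (h.hasStrictFDerivAt hx).hasFDerivAt
      exact h2.comp_hasDerivAt 0 h1
    have hslope := hd.hasDerivWithinAt (s := Ioi 0)
    rw [hasDerivWithinAt_iff_tendsto_slope' (by simp)] at hslope
    have h3 : ∀ᶠ s in 𝓝[>] (0 : ℝ), 0 < slope (fun s : ℝ => ρ (x + s • (z - x))) 0 s :=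
      hslope.eventually (lt_mem_nhds hpos)
    have h4 : ∀ᶠ s in 𝓝[>] (0 : ℝ), x + s • (z - x) ∈ U := by
      have : Tendsto (fun s : ℝ => x + s • (z - x)) (𝓝[>] 0) (𝓝 x) := by
        have : Continuous fun s : ℝ => x + s • (z - x) := by fun_prop
        simpa using (this.tendsto 0).mono_left nhdsWithin_le_nhds
      exact this.eventually (h.1.mem_nhds hx)
    have h5 : ∀ᶠ s in 𝓝[>] (0 : ℝ), s ∈ Ioc (0 : ℝ) 1 :=
      mem_of_superset (Ioo_mem_nhdsGT one_pos) Ioo_subset_Ioc_self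
    obtain ⟨s, hs, hsU, hs0, hs1⟩ := (h3.and (h4.and h5)).exists
    have hmem : x + s • (z - x) ∈ Ω := by
      have := hc.combo_closure_interior_mem_interior (frontier_subset_closure hxf)
        (by rwa [hΩ.interior_eq] : z ∈ interior Ω) (a := 1 - s) (b := s) (by linarith) hs0 (by ring)
      rw [hΩ.interior_eq] at this
      convert this using 1
      rw [smul_sub, sub_smul, one_smul]; abel
    rw [h.mem_iff hsU] at hmem
    simp only [slope, sub_zero, zero_smul, add_zero, h.eq_zero hΩ hx hxf, vsub_eq_sub,
      smul_eq_mul] at hs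
    have : s⁻¹ * ρ (x + s • (z - x)) ≤ 0 :=
      mul_nonpos_of_nonneg_of_nonpos (by positivity) hmem.le
    linarith
  -- Strictness: `z` can be pushed a little along the gradient while staying in `Ω`, and the weak
  -- inequality at the pushed point is strict at `z`.
  obtain ⟨r, hr, hball⟩ := Metric.isOpen_iff.1 hΩ z hz
  have hg : 0 < ‖gradient ρ x‖ := norm_pos_iff.2 (h.2.2.1 x hx)
  set g := gradient ρ x
  have hz' : z + (r / (2 * ‖g‖)) • g ∈ Ω := by
    apply hball
    rw [Metric.mem_ball, dist_eq_norm, add_sub_cancel_left, norm_smul, Real.norm_of_nonneg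
      (by positivity)]
    field_simp
    linarith
  have h6 := hle _ hz'
  rw [add_sub_right_comm, inner_add_right, inner_smul_right, real_inner_self_eq_norm_sq] at h6
  have : 0 < r / (2 * ‖g‖) * ‖g‖ ^ 2 := by positivity
  linarith

/-- If two unit normals differ, `v = n₂ - n₁` has negative product with `n₁`, so `x + s • v` enters
`Ω`; its product with `n₂` is positive, which the supporting half-space of `n₂` forbids. Thus the
chosen normal agrees locally with the normalized gradient of any defining function, and continuity
follows. -/
theorem isOutwardNormal_unique (hΩ : IsOpen Ω) (hc : Convex ℝ Ω) {n₁ n₂ : E3}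
    (h₁ : IsOutwardNormal Ω x n₁) (h₂ : IsOutwardNormal Ω x n₂) : n₁ = n₂ := by
  have key {m : E3} (h : IsOutwardNormal Ω x m) : ‖m‖ = 1 ∧
      (∀ z ∈ Ω, inner ℝ m (z - x) < 0) ∧
      ∀ v, inner ℝ m v < 0 → ∀ᶠ s in 𝓝[>] (0 : ℝ), x + s • v ∈ Ω := by
    obtain ⟨hxf, U, ρ, hxU, hρ, rfl⟩ := h
    have hg : 0 < ‖gradient ρ x‖ := norm_pos_iff.2 (hρ.2.2.1 x hxU)
    refine ⟨by rw [norm_smul, norm_inv, norm_norm, inv_mul_cancel₀ hg.ne'], fun z hz => ?_,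
      fun v hv => ?_⟩
    · rw [real_inner_smul_left]
      exact mul_neg_of_pos_of_neg (by positivity) (hρ.inner_sub_neg hΩ hc hxU hxf hz)
    · rw [real_inner_smul_left] at hv
      refine hρ.eventually_mem hΩ hxU hxf ?_
      by_contra! hge
      exact absurd hv (not_lt.2 (by positivity))
  obtain ⟨a1, a2, a3⟩ := key h₁
  obtain ⟨b1, b2, b3⟩ := key h₂
  by_contra hne
  have hlt : inner ℝ n₁ n₂ < 1 := by
    rcases lt_or_eq_of_le (real_inner_le_norm n₁ n₂) with h | h
    · simpa [a1, b1] using h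
    · rw [a1, b1, one_mul] at h
      exact absurd ((inner_eq_one_iff_of_norm_eq_one a1 b1).1 h) hne
  have hv : inner ℝ n₁ (n₂ - n₁) < 0 := by
    rw [inner_sub_right, real_inner_self_eq_norm_sq, a1]; linarith
  obtain ⟨s, hs, hs0⟩ := ((a3 _ hv).and self_mem_nhdsWithin).exists
  have h7 := b2 _ hs
  have hs0' : 0 < s := hs0
  rw [add_sub_cancel_left, inner_smul_right, inner_sub_right, real_inner_self_eq_norm_sq, b1,
    real_inner_comm] at h7
  have : 0 < s * (1 ^ 2 - inner ℝ n₁ n₂) := by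
    apply mul_pos hs0'
    linarith
  linarith

variable (hΩ : IsOpen Ω) (hc : Convex ℝ Ω) (h2 : HasC2Boundary Ω)
include h2

theorem isOutwardNormal_outwardNormal (hx : x ∈ frontier Ω) :
    IsOutwardNormal Ω x (outwardNormal Ω x) := by
  have hex : ∃ ν, IsOutwardNormal Ω x ν := by
    obtain ⟨U, ρ, hxU, hρ⟩ := h2 x hx
    exact ⟨_, hx, U, ρ, hxU, hρ, rfl⟩
  rw [outwardNormal, dif_pos hex]
  exact hex.choose_spec

theorem norm_outwardNormal (hx : x ∈ frontier Ω) : ‖outwardNormal Ω x‖ = 1 := by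
  obtain ⟨-, U, ρ, hxU, hρ, h⟩ := isOutwardNormal_outwardNormal h2 hx
  have hg : 0 < ‖gradient ρ x‖ := norm_pos_iff.2 (hρ.2.2.1 x hxU)
  rw [h, norm_smul, norm_inv, norm_norm, inv_mul_cancel₀ hg.ne']

include hΩ

theorem eventually_mem_of_inner_neg (hx : x ∈ frontier Ω) {v : E3}
    (hv : inner ℝ v (outwardNormal Ω x) < 0) : ∀ᶠ s in 𝓝[>] (0 : ℝ), x + s • v ∈ Ω := by
  obtain ⟨-, U, ρ, hxU, hρ, h⟩ := isOutwardNormal_outwardNormal h2 hx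
  rw [h, real_inner_smul_right, real_inner_comm] at hv
  refine hρ.eventually_mem hΩ hxU hx ?_
  by_contra! hge
  exact absurd hv (not_lt.2 (by positivity))

/-- Nearby boundary points differ by almost tangential vectors. -/
theorem eventually_abs_inner_le (hx : x ∈ frontier Ω) {ε : ℝ} (hε : 0 < ε) :
    ∃ V ∈ 𝓝 x, ∀ a ∈ V ∩ frontier Ω, ∀ b ∈ V ∩ frontier Ω,
      |inner ℝ (outwardNormal Ω x) (a - b)| ≤ ε * ‖a - b‖ := by
  obtain ⟨-, U, ρ, hxU, hρ, h⟩ := isOutwardNormal_outwardNormal h2 hx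
  have hg : 0 < ‖gradient ρ x‖ := norm_pos_iff.2 (hρ.2.2.1 x hxU)
  have hst := (hρ.hasStrictFDerivAt hxU).isLittleO.def (mul_pos hε hg)
  rw [nhds_prod_eq] at hst
  obtain ⟨V, hV, hVs⟩ := mem_prod_self_iff.1 hst
  refine ⟨V ∩ U, inter_mem hV (hρ.1.mem_nhds hxU), ?_⟩
  rintro a ⟨⟨haV, haU⟩, haf⟩ b ⟨⟨hbV, hbU⟩, hbf⟩
  have h3 : ‖ρ a - ρ b - fderiv ℝ ρ x (a - b)‖ ≤ ε * ‖gradient ρ x‖ * ‖a - b‖ :=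
    hVs (mk_mem_prod haV hbV)
  rw [hρ.eq_zero hΩ haU haf, hρ.eq_zero hΩ hbU hbf, sub_zero, zero_sub, norm_neg,
    ← inner_gradient_eq, Real.norm_eq_abs] at h3
  rw [h, real_inner_smul_left, abs_mul, abs_of_nonneg (by positivity), inv_mul_le_iff₀ hg]
  linarith

include hc

theorem inner_sub_neg_of_mem (hx : x ∈ frontier Ω) {z : E3} (hz : z ∈ Ω) :
    inner ℝ (z - x) (outwardNormal Ω x) < 0 := by
  obtain ⟨-, U, ρ, hxU, hρ, h⟩ := isOutwardNormal_outwardNormal h2 hx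
  have hg : 0 < ‖gradient ρ x‖ := norm_pos_iff.2 (hρ.2.2.1 x hxU)
  rw [h, real_inner_smul_right, real_inner_comm]
  exact mul_neg_of_pos_of_neg (by positivity) (hρ.inner_sub_neg hΩ hc hxU hx hz)

theorem continuousOn_outwardNormal : ContinuousOn (outwardNormal Ω) (frontier Ω) := by
  intro x hx
  obtain ⟨U, ρ, hxU, hρ⟩ := h2 x hx
  have hev : ∀ᶠ y in 𝓝[frontier Ω] x,
      outwardNormal Ω y = ‖gradient ρ y‖⁻¹ • gradient ρ y := by
    filter_upwards [self_mem_nhdsWithin, mem_nhdsWithin_of_mem_nhds (hρ.1.mem_nhds hxU)] with y hy hyU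
    exact isOutwardNormal_unique hΩ hc (isOutwardNormal_outwardNormal h2 hy)
      ⟨hy, U, ρ, hyU, hρ, rfl⟩
  have hgc : ContinuousAt (gradient ρ) x := by
    have : ContinuousAt (fderiv ℝ ρ) x :=
      ((hρ.2.1.continuousOn_fderiv_of_isOpen hρ.1 (by norm_num)).continuousAt (hρ.1.mem_nhds hxU))
    exact (InnerProductSpace.toDual ℝ E3).symm.continuous.continuousAt.comp this
  have hg : ‖gradient ρ x‖ ≠ 0 := norm_ne_zero_iff.2 (hρ.2.2.1 x hxU)
  have : ContinuousAt (fun y => ‖gradient ρ y‖⁻¹ • gradient ρ y) x :=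
    (hgc.norm.inv₀ hg).smul hgc
  exact this.continuousWithinAt.congr_of_eventuallyEq hev (hev.self_of_nhdsWithin hx)

omit hΩ hc h2 in
theorem outwardNormal_of_notMem (hx : x ∉ frontier Ω) : outwardNormal Ω x = 0 := by
  rw [outwardNormal, dif_neg]
  rintro ⟨ν, hν, -⟩
  exact hx hν

theorem measurable_outwardNormal : Measurable (outwardNormal Ω) := by
  classical
  have h : outwardNormal Ω = (frontier Ω).piecewise (outwardNormal Ω) (fun _ => 0) := by
    ext1 x
    by_cases hx : x ∈ frontier Ω
    · rw [piecewise_eq_of_mem _ _ _ hx]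
    · rw [piecewise_eq_of_notMem _ _ _ hx, outwardNormal_of_notMem hx]
  rw [h]
  exact (continuousOn_outwardNormal hΩ hc h2).measurable_piecewise continuousOn_const
    isClosed_frontier.measurableSet

theorem measurable_normalFlux : Measurable (normalFlux Ω) := by
  have := measurable_outwardNormal hΩ hc h2
  unfold normalFlux
  have h3 : Measurable fun z : E3 × S2 => (z.2 : E3) := measurable_subtype_coe.comp measurable_snd
  exact h3.inner (this.comp measurable_fst)

end

/-! ### Lengths, areas and volumes along a direction -/

open Filter Topology Module

section
variable {K : Submodule ℝ E3} {β n : E3}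

/-- The parametrisation of space by the coordinate along `β` and the orthogonal component. -/
def lineMap (K : Submodule ℝ E3) (β : E3) (q : ℝ × Kᗮ) : E3 := q.1 • β + q.2

theorem measurePreserving_lineMap (hK : K = ℝ ∙ β) (hβ : ‖β‖ = 1) :
    MeasurePreserving (lineMap K β) (volume.prod volume) volume := by
  subst hK
  have h1 := ((ℝ ∙ β).measurePreserving_measurableEquivProd (0 : E3)).symm
  rw [InnerProductSpace.euclideanHausdorffMeasure_eq_volume] at h1
  have h2 := ((LinearIsometryEquiv.toSpanUnitSingleton (𝕜 := ℝ) β hβ).measurePreserving).prod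
    (MeasurePreserving.id (volume : Measure (ℝ ∙ β)ᗮ))
  have h3 := h1.comp h2
  have e : lineMap (ℝ ∙ β) β = ⇑((ℝ ∙ β).measurableEquivProd (0 : E3)).symm ∘
      Prod.map (⇑(LinearIsometryEquiv.toSpanUnitSingleton (𝕜 := ℝ) β hβ)) id := by
    funext q
    simp [lineMap]
  rw [e]
  exact h3

theorem lintegral_lineMap (hK : K = ℝ ∙ β) (hβ : ‖β‖ = 1) {f : E3 → ℝ≥0∞} (hf : Measurable f) :
    ∫⁻ x, f x = ∫⁻ y : Kᗮ, ∫⁻ s : ℝ, f (s • β + y) := by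
  have h := measurePreserving_lineMap hK hβ
  rw [← h.lintegral_comp hf, lintegral_prod_symm]
  · rfl
  · exact (hf.comp h.measurable).aemeasurable

/-- Projecting a plane orthogonal to `n` along `β` changes areas by the factor `⟨n, β⟩`. -/
theorem map_proj_plane (hK : K = ℝ ∙ β) (hβ : ‖β‖ = 1) (hn : ‖n‖ = 1) (hc : inner ℝ n β ≠ 0) :
    (volume : Measure (ℝ ∙ n)ᗮ).map (fun b : ↥(ℝ ∙ n)ᗮ => Kᗮ.orthogonalProjectionOnto (b : E3)) =
      ENNReal.ofReal |inner ℝ n β|⁻¹ • (volume : Measure Kᗮ) := by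
  set c : ℝ := inner ℝ n β with hcdef
  set P := Kᗮ.orthogonalProjectionOnto with hP
  have hPm : Measurable fun b : (ℝ ∙ n)ᗮ => P (b : E3) := by fun_prop
  -- This transvection fixes the plane orthogonal to `n` and sends `n` to `β`; its determinant is
  -- `⟨n, β⟩`. Slicing the unit slab `S` along `β` measures `D`, while slicing `T ⁻¹' S` along `n`
  -- measures the preimage of `D` in the plane, since every nonempty slice has length one.
  set T : E3 →ₗ[ℝ] E3 := LinearMap.transvection ((innerSL ℝ n : E3 →L[ℝ] ℝ) : E3 →ₗ[ℝ] ℝ) (β - n)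
    with hT
  have hTapp (x : E3) : T x = x + inner ℝ n x • (β - n) := by simp [hT, LinearMap.transvection.apply]
  have hdet : LinearMap.det T = c := by
    rw [hT, LinearMap.transvection.det]
    simp [inner_sub_right, hn, hcdef]
  have hmapT := Measure.map_linearMap_addHaar_eq_smul_addHaar (volume : Measure E3)
    (f := T) (by rw [hdet]; exact hc)
  rw [hdet] at hmapT
  have hTc : Continuous T := T.continuous_of_finiteDimensional
  ext D hD
  rw [Measure.map_apply hPm hD, Measure.smul_apply, smul_eq_mul]
  -- the test set, a unit slab over `D`
  set S : Set E3 := {x | inner ℝ β x ∈ Icc (0 : ℝ) 1 ∧ P x ∈ D} with hS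
  have hSm : MeasurableSet S := by
    refine MeasurableSet.inter ?_ ?_
    · exact measurableSet_Icc.preimage (by fun_prop)
    · exact hD.preimage (by fun_prop)
  have hPβ : P β = 0 := by
    rw [hP, Submodule.orthogonalProjectionOnto_orthogonal_apply_eq_zero]
    rw [hK]; exact Submodule.mem_span_singleton_self β
  have hind {α : Type} [MeasurableSpace α] (m : Measure α) (A : Set α) (hA : MeasurableSet A) :
      m A = ∫⁻ x, A.indicator 1 x ∂m := (lintegral_indicator_one hA).symm
  have hvolS : volume S = volume D := by
    rw [hind _ S hSm, lintegral_lineMap hK hβ (by measurability), hind _ D hD]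
    congr with y
    have hy : inner ℝ β (y : E3) = 0 :=
      (Submodule.mem_orthogonal _ _).1 y.2 β (hK ▸ Submodule.mem_span_singleton_self β)
    have hmem (s : ℝ) : s • β + (y : E3) ∈ S ↔ s ∈ Icc (0 : ℝ) 1 ∧ y ∈ D := by
      have hPy : P (y : E3) = y := Submodule.orthogonalProjectionOnto_mem_subspace_eq_self y
      simp only [hS, mem_ofPred_eq, inner_add_right, inner_smul_right, real_inner_self_eq_norm_sq,
        hβ, hy, map_add, map_smul, hPβ, hPy, smul_zero, zero_add, one_pow, mul_one, add_zero]
    by_cases hyD : y ∈ D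
    · have : (fun s : ℝ => S.indicator (1 : E3 → ℝ≥0∞) (s • β + (y : E3))) =
          (Icc (0 : ℝ) 1).indicator 1 := by
        ext s
        by_cases hs : s ∈ Icc (0 : ℝ) 1
        · rw [indicator_of_mem ((hmem s).2 ⟨hs, hyD⟩), indicator_of_mem hs]; rfl
        · rw [indicator_of_notMem (fun h => hs ((hmem s).1 h).1), indicator_of_notMem hs]
      rw [this, lintegral_indicator_one measurableSet_Icc, indicator_of_mem hyD]
      simp
    · have : (fun s : ℝ => S.indicator (1 : E3 → ℝ≥0∞) (s • β + (y : E3))) = fun _ => 0 := by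
        ext s
        rw [indicator_of_notMem (fun h => hyD ((hmem s).1 h).2)]
      rw [this, indicator_of_notMem hyD]
      simp
  have hvolT : volume (T ⁻¹' S) = ENNReal.ofReal |c|⁻¹ * volume D := by
    rw [← Measure.map_apply hTc.measurable hSm, hmapT, Measure.smul_apply, hvolS, abs_inv]
    rfl
  rw [← hvolT]
  have hTm : MeasurableSet (T ⁻¹' S) := hSm.preimage hTc.measurable
  have hDm : MeasurableSet ((fun b : (ℝ ∙ n)ᗮ => P (b : E3)) ⁻¹' D) := hD.preimage hPm
  rw [hind _ (T ⁻¹' S) hTm, lintegral_lineMap (K := ℝ ∙ n) rfl hn (by measurability),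
    hind _ _ hDm]
  congr with b
  have hb : inner ℝ n (b : E3) = 0 := Submodule.mem_orthogonal_singleton_iff_inner_right.1 b.2
  have hTb (s : ℝ) : T (s • n + b) = s • β + b := by
    rw [hTapp, inner_add_right, inner_smul_right, hb, real_inner_self_eq_norm_sq, hn, smul_sub]
    simp only [one_pow, mul_one, add_zero]
    abel
  have hmem (s : ℝ) : s • n + (b : E3) ∈ T ⁻¹' S ↔
      s ∈ Icc (-inner ℝ β (b : E3)) (1 - inner ℝ β (b : E3)) ∧ P (b : E3) ∈ D := by
    rw [mem_preimage, hTb]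
    simp only [hS, mem_ofPred_eq, inner_add_right, inner_smul_right, real_inner_self_eq_norm_sq, hβ,
      map_add, map_smul, hPβ, smul_zero, zero_add, mem_Icc]
    constructor
    · rintro ⟨⟨h1, h2⟩, h3⟩; exact ⟨⟨by linarith, by linarith⟩, h3⟩
    · rintro ⟨⟨h1, h2⟩, h3⟩; exact ⟨⟨by linarith, by linarith⟩, h3⟩
  by_cases hbD : P (b : E3) ∈ D
  · have : (fun s : ℝ => (T ⁻¹' S).indicator (1 : E3 → ℝ≥0∞) (s • n + (b : E3))) =
        (Icc (-inner ℝ β (b : E3)) (1 - inner ℝ β (b : E3))).indicator 1 := by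
      ext s
      by_cases hs : s ∈ Icc (-inner ℝ β (b : E3)) (1 - inner ℝ β (b : E3))
      · rw [indicator_of_mem ((hmem s).2 ⟨hs, hbD⟩), indicator_of_mem hs]; rfl
      · rw [indicator_of_notMem (fun h => hs ((hmem s).1 h).1), indicator_of_notMem hs]
    rw [this, lintegral_indicator_one measurableSet_Icc, indicator_of_mem (by exact hbD)]
    simp
  · have : (fun s : ℝ => (T ⁻¹' S).indicator (1 : E3 → ℝ≥0∞) (s • n + (b : E3))) = fun _ => 0 := by
      ext s
      rw [indicator_of_notMem (fun h => hbD ((hmem s).1 h).2)]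
    rw [this, indicator_of_notMem (by exact hbD)]
    simp

theorem _root_.LipschitzOnWith.euclideanHausdorffMeasure_image_le {X Y : Type*}
    [EMetricSpace X] [MeasurableSpace X] [BorelSpace X]
    [EMetricSpace Y] [MeasurableSpace Y] [BorelSpace Y] {C : NNReal} {f : X → Y} {s : Set X}
    (h : LipschitzOnWith C f s) (d : ℕ) :
    (μHE[d] : Measure Y) (f '' s) ≤ (C : ℝ≥0∞) ^ d * (μHE[d] : Measure X) s := by
  rw [Measure.euclideanHausdorffMeasure_def, Measure.euclideanHausdorffMeasure_def,
    Measure.smul_apply, Measure.smul_apply, ENNReal.smul_def, ENNReal.smul_def, smul_eq_mul,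
    smul_eq_mul, mul_left_comm]
  gcongr
  simpa using h.hausdorffMeasure_image_le (d := d) (by positivity)

theorem euclideanHausdorffMeasure_plane (hn : n ≠ 0) :
    (μHE[2] : Measure (ℝ ∙ n)ᗮ) = volume := by
  have : Fact (finrank ℝ E3 = 2 + 1) := ⟨by simp⟩
  have h := InnerProductSpace.euclideanHausdorffMeasure_eq_volume (V := (ℝ ∙ n)ᗮ)
  rwa [Submodule.finrank_orthogonal_span_singleton (n := 2) hn] at h

end

/-! ### Chords -/

open Filter Topology Module

/-- The last parameter at which the line `s ↦ x + s β` meets `Ω`. -/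
def exitTime (Ω : Set E3) (x β : E3) : ℝ := sSup {s : ℝ | x + s • β ∈ Ω}

/-- The point at which the line `s ↦ x + s β` leaves `Ω`. -/
def exitPoint (Ω : Set E3) (x β : E3) : E3 := x + exitTime Ω x β • β

section
variable {Ω : Set E3} {x β : E3}

theorem bddAbove_line (hb : Bornology.IsBounded Ω) (hβ : ‖β‖ = 1) (x : E3) :
    BddAbove {s : ℝ | x + s • β ∈ Ω} := by
  obtain ⟨R, hR⟩ := hb.exists_norm_le
  refine ⟨R + ‖x‖, fun s hs => ?_⟩
  have h1 := hR _ hs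
  have h2 : ‖s • β‖ ≤ ‖x + s • β‖ + ‖x‖ := by
    calc ‖s • β‖ = ‖(x + s • β) - x‖ := by rw [add_sub_cancel_left]
      _ ≤ _ := norm_sub_le _ _
  rw [norm_smul, hβ, mul_one, Real.norm_eq_abs] at h2
  linarith [le_abs_self s]

theorem le_exitTime (hb : Bornology.IsBounded Ω) (hβ : ‖β‖ = 1) {s : ℝ} (hs : x + s • β ∈ Ω) :
    s ≤ exitTime Ω x β := le_csSup (bddAbove_line hb hβ x) hs

theorem lt_exitTime (hΩ : IsOpen Ω) (hb : Bornology.IsBounded Ω) (hβ : ‖β‖ = 1) {s : ℝ}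
    (hs : x + s • β ∈ Ω) : s < exitTime Ω x β := by
  have hc : Continuous fun s : ℝ => x + s • β := by fun_prop
  have h1 : ∀ᶠ t in 𝓝[>] s, x + t • β ∈ Ω :=
    mem_nhdsWithin_of_mem_nhds (hc.continuousAt.preimage_mem_nhds (hΩ.mem_nhds hs))
  obtain ⟨t, ht, hst⟩ := (h1.and self_mem_nhdsWithin).exists
  exact lt_of_lt_of_le hst (le_exitTime hb hβ ht)

theorem exists_mem_of_lt_exitTime (hne : ∃ s : ℝ, x + s • β ∈ Ω) {s : ℝ}
    (hs : s < exitTime Ω x β) : ∃ t, s < t ∧ x + t • β ∈ Ω := by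
  obtain ⟨t, ht, hst⟩ := exists_lt_of_lt_csSup hne hs
  exact ⟨t, hst, ht⟩

/-- The line has to meet `Ω`: on an empty chord the supremum is `0` for every base point and the
translation rule fails. -/
theorem exitTime_add_smul (hb : Bornology.IsBounded Ω) (hβ : ‖β‖ = 1)
    (hne : ∃ s : ℝ, x + s • β ∈ Ω) (r : ℝ) :
    exitTime Ω (x + r • β) β = exitTime Ω x β - r := by
  obtain ⟨s₀, hs₀⟩ := hne
  have e (s : ℝ) : x + r • β + s • β = x + (r + s) • β := by rw [add_smul]; abel
  refine le_antisymm ?_ ?_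
  · refine csSup_le ⟨s₀ - r, ?_⟩ fun s hs => ?_
    · change x + r • β + (s₀ - r) • β ∈ Ω
      rw [e]; simpa using hs₀
    · have hs' : x + r • β + s • β ∈ Ω := hs
      rw [e] at hs'
      linarith [le_exitTime hb hβ hs']
  · rw [sub_le_iff_le_add]
    refine csSup_le ⟨s₀, hs₀⟩ fun s hs => ?_
    have : x + r • β + (s - r) • β ∈ Ω := by rw [e]; simpa using hs
    linarith [le_exitTime hb hβ this]

theorem exitPoint_add_smul (hb : Bornology.IsBounded Ω) (hβ : ‖β‖ = 1)
    (hne : ∃ s : ℝ, x + s • β ∈ Ω) (r : ℝ) :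
    exitPoint Ω (x + r • β) β = exitPoint Ω x β := by
  rw [exitPoint, exitTime_add_smul hb hβ hne, exitPoint, sub_smul]
  abel

theorem exitPoint_mem_frontier (hΩ : IsOpen Ω) (hb : Bornology.IsBounded Ω) (hβ : ‖β‖ = 1)
    (hne : ∃ s : ℝ, x + s • β ∈ Ω) : exitPoint Ω x β ∈ frontier Ω := by
  rw [hΩ.frontier_eq]
  refine ⟨?_, fun h => (lt_exitTime hΩ hb hβ h).false⟩
  have hc : Continuous fun s : ℝ => x + s • β := by fun_prop
  have h1 : exitTime Ω x β ∈ closure {s : ℝ | x + s • β ∈ Ω} :=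
    csSup_mem_closure hne (bddAbove_line hb hβ x)
  exact map_mem_closure (f := fun s : ℝ => x + s • β) hc h1 fun s hs => hs

theorem normalFlux_exitPoint_pos (hΩ : IsOpen Ω) (hc : Convex ℝ Ω) (h2 : HasC2Boundary Ω)
    (hb : Bornology.IsBounded Ω) (hβ : ‖β‖ = 1) (hne : ∃ s : ℝ, x + s • β ∈ Ω) :
    0 < inner ℝ β (outwardNormal Ω (exitPoint Ω x β)) := by
  obtain ⟨s, hs⟩ := hne
  have h := inner_sub_neg_of_mem hΩ hc h2 (exitPoint_mem_frontier hΩ hb hβ ⟨s, hs⟩) hs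
  have e : x + s • β - exitPoint Ω x β = (s - exitTime Ω x β) • β := by
    rw [exitPoint, sub_smul]; abel
  rw [e, real_inner_smul_left] at h
  have := lt_exitTime hΩ hb hβ hs
  by_contra! hle
  exact absurd h (not_lt.2 (mul_nonneg_of_nonpos_of_nonpos (by linarith) hle))

/-- At an outflow boundary point the ray has left the domain for good. -/
theorem notMem_of_outflow (hΩ : IsOpen Ω) (hc : Convex ℝ Ω) (h2 : HasC2Boundary Ω)
    (hx : x ∈ frontier Ω) (hn : 0 < inner ℝ β (outwardNormal Ω x)) {s : ℝ} (hs : 0 ≤ s) :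
    x + s • β ∉ Ω := by
  intro h
  have h3 := inner_sub_neg_of_mem hΩ hc h2 hx h
  rw [add_sub_cancel_left, real_inner_smul_left] at h3
  exact absurd h3 (not_lt.2 (mul_nonneg hs hn.le))

theorem exists_mem_of_outflow (hΩ : IsOpen Ω) (h2 : HasC2Boundary Ω)
    (hx : x ∈ frontier Ω) (hn : 0 < inner ℝ β (outwardNormal Ω x)) :
    ∀ᶠ s in 𝓝[>] (0 : ℝ), x + (-s) • β ∈ Ω := by
  have := eventually_mem_of_inner_neg hΩ h2 hx (v := -β) (by rw [inner_neg_left]; linarith)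
  filter_upwards [this] with s hs
  rwa [smul_neg, ← neg_smul] at hs

theorem exitTime_eq_zero_of_outflow (hΩ : IsOpen Ω) (hc : Convex ℝ Ω) (h2 : HasC2Boundary Ω)
    (hb : Bornology.IsBounded Ω) (hβ : ‖β‖ = 1)
    (hx : x ∈ frontier Ω) (hn : 0 < inner ℝ β (outwardNormal Ω x)) : exitTime Ω x β = 0 := by
  have hev := exists_mem_of_outflow hΩ h2 hx hn
  refine le_antisymm ?_ ?_
  · obtain ⟨s, hs⟩ := hev.exists
    refine csSup_le ⟨-s, hs⟩ fun t ht => ?_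
    by_contra! hlt
    exact notMem_of_outflow hΩ hc h2 hx hn hlt.le ht
  · by_contra! hlt
    have h3 : ∀ᶠ s in 𝓝[>] (0 : ℝ), s < -exitTime Ω x β :=
      mem_nhdsWithin_of_mem_nhds (Iio_mem_nhds (by linarith))
    obtain ⟨s, hs, hs2⟩ := (hev.and h3).exists
    linarith [le_exitTime hb hβ hs]

theorem exitPoint_eq_of_outflow (hΩ : IsOpen Ω) (hc : Convex ℝ Ω) (h2 : HasC2Boundary Ω)
    (hb : Bornology.IsBounded Ω) (hβ : ‖β‖ = 1)
    (hx : x ∈ frontier Ω) (hn : 0 < inner ℝ β (outwardNormal Ω x)) : exitPoint Ω x β = x := by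
  rw [exitPoint, exitTime_eq_zero_of_outflow hΩ hc h2 hb hβ hx hn]; simp

/-- The intersection of a line with the domain is an interval. -/
theorem mem_line_iff (hΩ : IsOpen Ω) (hc : Convex ℝ Ω) (hb : Bornology.IsBounded Ω)
    (hβ : ‖β‖ = 1) (hne : ∃ s : ℝ, x + s • β ∈ Ω) {s : ℝ} :
    x + s • β ∈ Ω ↔ s ∈ Ioo (-exitTime Ω x (-β)) (exitTime Ω x β) := by
  have hneg (t : ℝ) : x + t • -β = x + (-t) • β := by rw [smul_neg, neg_smul]
  have hβ' : ‖-β‖ = 1 := by rwa [norm_neg]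
  constructor
  · intro h
    refine ⟨?_, lt_exitTime hΩ hb hβ h⟩
    have : x + (-s) • -β ∈ Ω := by rw [hneg, neg_neg]; exact h
    linarith [lt_exitTime hΩ hb hβ' this]
  · rintro ⟨h1, h3⟩
    obtain ⟨t, hst, ht⟩ := exists_mem_of_lt_exitTime hne h3
    have hne' : ∃ s : ℝ, x + s • -β ∈ Ω := by
      obtain ⟨u, hu⟩ := hne
      exact ⟨-u, by rw [hneg, neg_neg]; exact hu⟩
    obtain ⟨u, hsu, hu⟩ := exists_mem_of_lt_exitTime hne' (s := -s) (by linarith)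
    rw [hneg] at hu
    have hconv : Convex ℝ ((fun s : ℝ => x + s • β) ⁻¹' Ω) := by
      have e : (fun s : ℝ => x + s • β) = (AffineMap.lineMap x (x + β) : ℝ →ᵃ[ℝ] E3) := by
        funext s
        simp [AffineMap.lineMap_apply, add_comm]
      rw [e]
      exact hc.affine_preimage _
    exact hconv.ordConnected.out (mem_preimage.2 hu) (mem_preimage.2 ht) ⟨by linarith, hst.le⟩

/-- The set where the exit time exceeds `c` is a union of open conditions over `s > c`, corrected on
the lines missing `Ω`, where the supremum of the empty set is `0`. -/
theorem measurable_exitTime (hΩ : IsOpen Ω) (hb : Bornology.IsBounded Ω) :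
    Measurable fun z : E3 × S2 => exitTime Ω z.1 z.2 := by
  have hβ (b : S2) : ‖(b : E3)‖ = 1 := by simp
  refine measurable_of_Ioi fun c => ?_
  set A : Set (E3 × S2) := {z | ∃ s : ℝ, z.1 + s • (z.2 : E3) ∈ Ω}
  have hopen (I : Set ℝ) : IsOpen {z : E3 × S2 | ∃ s ∈ I, z.1 + s • (z.2 : E3) ∈ Ω} := by
    have : {z : E3 × S2 | ∃ s ∈ I, z.1 + s • (z.2 : E3) ∈ Ω} =
        ⋃ s ∈ I, (fun z : E3 × S2 => z.1 + s • (z.2 : E3)) ⁻¹' Ω := by ext; simp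
    rw [this]
    exact isOpen_biUnion fun s _ => hΩ.preimage (by fun_prop)
  have hA : MeasurableSet A := by
    have e : A = {z : E3 × S2 | ∃ s ∈ (univ : Set ℝ), z.1 + s • (z.2 : E3) ∈ Ω} := by
      ext z; simp [A]
    rw [e]
    exact (hopen univ).measurableSet
  have e : (fun z : E3 × S2 => exitTime Ω z.1 z.2) ⁻¹' Ioi c =
      {z : E3 × S2 | ∃ s ∈ Ioi c, z.1 + s • (z.2 : E3) ∈ Ω} ∪ (Aᶜ ∩ {_z | c < 0}) := by
    ext z
    simp only [mem_preimage, mem_Ioi, mem_union, mem_inter_iff, mem_compl_iff, mem_ofPred_eq]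
    by_cases hz : z ∈ A
    · constructor
      · intro h
        exact Or.inl (exists_mem_of_lt_exitTime hz h)
      · rintro (⟨s, hs, hs2⟩ | h)
        · exact lt_of_lt_of_le hs (le_exitTime hb (hβ _) hs2)
        · exact absurd hz h.1
    · have h0 : exitTime Ω z.1 z.2 = 0 := by
        have : {s : ℝ | z.1 + s • (z.2 : E3) ∈ Ω} = ∅ := by
          ext s; simp only [mem_ofPred_eq, mem_empty_iff_false, iff_false]
          exact fun h => hz ⟨s, h⟩
        rw [exitTime, this, Real.sSup_empty]
      rw [h0]
      constructor
      · intro h; exact Or.inr ⟨hz, h⟩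
      · rintro (⟨s, hs, hs2⟩ | h)
        · exact absurd ⟨s, hs2⟩ hz
        · exact h.2
  rw [e]
  exact (hopen _).measurableSet.union (hA.compl.inter (MeasurableSet.const _))

end

/-! ### The flux measure of the inflow boundary in a fixed direction -/

open Filter Topology Module

/-- `-β·n dΓ` on the part of the boundary where `β·n < 0`. -/
def fluxMeasure (Ω : Set E3) (β : E3) : Measure E3 :=
  ((surfaceMeasure Ω).restrict {x | inner ℝ β (outwardNormal Ω x) < 0}).withDensity
    fun x => ENNReal.ofReal (-inner ℝ β (outwardNormal Ω x))

/-- The part of the boundary where `β·n < 0`. -/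
def inflowPart (Ω : Set E3) (β : E3) : Set E3 :=
  {x | x ∈ frontier Ω ∧ inner ℝ β (outwardNormal Ω x) < 0}

section
variable {Ω : Set E3} {x β : E3} {K : Submodule ℝ E3}

theorem proj_eq_iff (hK : K = ℝ ∙ β) {a b : E3} :
    Kᗮ.orthogonalProjectionOnto a = Kᗮ.orthogonalProjectionOnto b ↔ ∃ t : ℝ, a = b + t • β := by
  rw [← sub_eq_zero, ← map_sub, Submodule.orthogonalProjectionOnto_eq_zero_iff,
    Submodule.orthogonal_orthogonal, hK, Submodule.mem_span_singleton]
  constructor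
  · rintro ⟨t, ht⟩; exact ⟨t, by rw [ht]; abel⟩
  · rintro ⟨t, ht⟩; exact ⟨t, by rw [ht]; abel⟩

/-- Near `x` differences of boundary points are almost tangential, so projecting along `β` onto the
tangent plane is bi-Lipschitz with constant `r` on the boundary and changes two-dimensional
Hausdorff measure by at most `r ^ 2`. Passing from the tangent plane to the plane orthogonal to `β`
is linear and contributes the exact factor `|⟨n, β⟩|`. -/
theorem exists_nhds_area (hΩ : IsOpen Ω) (h2 : HasC2Boundary Ω) (hx : x ∈ frontier Ω)
    (hK : K = ℝ ∙ β) (hβ : ‖β‖ = 1) (hc : inner ℝ (outwardNormal Ω x) β ≠ 0) {r : NNReal}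
    (hr : 1 < r) :
    ∃ V ∈ 𝓝 x, ∀ A ⊆ V ∩ frontier Ω, MeasurableSet A →
      volume (Kᗮ.orthogonalProjectionOnto '' A) ≤
        ENNReal.ofReal |inner ℝ (outwardNormal Ω x) β| * ((r : ℝ≥0∞) ^ 2 * (μHE[2] : Measure E3) A) ∧
      ENNReal.ofReal |inner ℝ (outwardNormal Ω x) β| * (μHE[2] : Measure E3) A ≤
        (r : ℝ≥0∞) ^ 2 * volume (Kᗮ.orthogonalProjectionOnto '' A) := by
  set n := outwardNormal Ω x with hndef
  set c : ℝ := inner ℝ n β with hcdef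
  have hn : ‖n‖ = 1 := norm_outwardNormal h2 hx
  have hn0 : n ≠ 0 := fun h => by simp [h] at hn
  have hr' : (1 : ℝ) < r := by exact_mod_cast hr
  have hr0 : (0 : ℝ) < r := by linarith
  set ε : ℝ := (r - 1) / r with hε
  have hε0 : 0 < ε := div_pos (by linarith) hr0
  have hcpos : 0 < |c| := abs_pos.2 hc
  obtain ⟨V, hV, hVs⟩ := eventually_abs_inner_le hΩ h2 hx (mul_pos hε0 hcpos)
  refine ⟨V, hV, fun A hA hAm => ?_⟩
  set P := Kᗮ.orthogonalProjectionOnto with hP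
  -- the projection along `β` onto the tangent plane
  set ψ : E3 → (ℝ ∙ n)ᗮ := fun v =>
    (ℝ ∙ n)ᗮ.orthogonalProjectionOnto (v - (inner ℝ n v / c) • β) with hψ
  have hψc : Continuous ψ := by fun_prop
  have hψv (v : E3) : (ψ v : E3) = v - (inner ℝ n v / c) • β := by
    have hmem : v - (inner ℝ n v / c) • β ∈ (ℝ ∙ n)ᗮ := by
      rw [Submodule.mem_orthogonal_singleton_iff_inner_right, inner_sub_right, inner_smul_right,
        ← hcdef]
      field_simp
      ring
    exact congrArg Subtype.val
      (Submodule.orthogonalProjectionOnto_mem_subspace_eq_self (⟨_, hmem⟩ : (ℝ ∙ n)ᗮ))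
  have hclose (a : E3) (ha : a ∈ A) (b : E3) (hb : b ∈ A) :
      ‖(a - b) - ((ψ a : E3) - ψ b)‖ ≤ ε * ‖a - b‖ := by
    have h := hVs a (hA ha) b (hA hb)
    have e : (a - b) - ((ψ a : E3) - ψ b) = (inner ℝ n (a - b) / c) • β := by
      rw [hψv, hψv, inner_sub_right, sub_div, sub_smul]; abel
    rw [e, norm_smul, hβ, mul_one, Real.norm_eq_abs, abs_div, div_le_iff₀ hcpos]
    linarith
  have hup (a : E3) (ha : a ∈ A) (b : E3) (hb : b ∈ A) : dist (ψ a) (ψ b) ≤ r * dist a b := by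
    rw [dist_eq_norm, dist_eq_norm, Submodule.coe_norm, Submodule.coe_sub]
    have h := hclose a ha b hb
    have h3 : ‖(ψ a : E3) - ψ b‖ ≤ ‖a - b‖ + ‖(a - b) - ((ψ a : E3) - ψ b)‖ := by
      calc ‖(ψ a : E3) - ψ b‖ = ‖(a - b) - ((a - b) - ((ψ a : E3) - ψ b))‖ := by congr 1; abel
        _ ≤ _ := norm_sub_le _ _
    have h4 : 1 + ε ≤ r := by
      rw [hε, ← sub_nonneg]
      have : (r : ℝ) - (1 + (r - 1) / r) = (r - 1) ^ 2 / r := by field_simp; ring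
      rw [this]; positivity
    nlinarith [norm_nonneg (a - b)]
  have hlow (a : E3) (ha : a ∈ A) (b : E3) (hb : b ∈ A) : dist a b ≤ r * dist (ψ a) (ψ b) := by
    rw [dist_eq_norm, dist_eq_norm, Submodule.coe_norm, Submodule.coe_sub]
    have h := hclose a ha b hb
    have h3 : ‖a - b‖ ≤ ‖(a - b) - ((ψ a : E3) - ψ b)‖ + ‖(ψ a : E3) - ψ b‖ := by
      calc ‖a - b‖ = ‖((a - b) - ((ψ a : E3) - ψ b)) + ((ψ a : E3) - ψ b)‖ := by congr 1; abel
        _ ≤ _ := norm_add_le _ _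
    have h4 : (r : ℝ) * (1 - ε) = 1 := by rw [hε]; field_simp; ring
    nlinarith [norm_nonneg (a - b)]
  have hinj : InjOn ψ A := by
    intro a ha b hb hab
    have h := hlow a ha b hb
    rw [hab, dist_self, mul_zero] at h
    exact dist_le_zero.1 h
  have hPβ (t : ℝ) (a : E3) : P (a + t • β) = P a := (proj_eq_iff hK).2 ⟨t, rfl⟩
  have hPψ (a : E3) : P (ψ a : E3) = P a := by
    rw [hψv, sub_eq_add_neg, ← neg_smul, hPβ]
  have hψβ (a : E3) (t : ℝ) : ψ (a + t • β) = ψ a := by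
    apply Subtype.ext
    rw [hψv, hψv, inner_add_right, inner_smul_right, ← hcdef, add_div, mul_div_cancel_right₀ _ hc,
      add_smul]
    abel
  have hPinj : InjOn P A := by
    intro a ha b hb hab
    obtain ⟨t, rfl⟩ := (proj_eq_iff hK).1 hab
    exact hinj ha hb (hψβ b t)
  have hPAm : MeasurableSet (P '' A) := hAm.image_of_continuousOn_injOn P.continuous.continuousOn hPinj
  have hvol : volume (P '' A) = ENNReal.ofReal |c| * (μHE[2] : Measure (ℝ ∙ n)ᗮ) (ψ '' A) := by
    have h := congrArg (fun m => m (P '' A)) (map_proj_plane hK hβ hn hc)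
    rw [Measure.map_apply (by fun_prop) hPAm, Measure.smul_apply, smul_eq_mul] at h
    have e : (fun b : ↥(ℝ ∙ n)ᗮ => Kᗮ.orthogonalProjectionOnto (b : E3)) ⁻¹' (P '' A) = ψ '' A := by
      ext b
      constructor
      · rintro ⟨a, ha, hab⟩
        refine ⟨a, ha, ?_⟩
        have hab' : P (b : E3) = P a := hab.symm
        obtain ⟨t, ht⟩ := (proj_eq_iff hK).1 hab'
        rw [← hψβ a t, ← ht]
        apply Subtype.ext
        rw [hψv, Submodule.mem_orthogonal_singleton_iff_inner_right.1 b.2]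
        simp
      · rintro ⟨a, ha, rfl⟩
        exact ⟨a, ha, (hPψ a).symm⟩
    rw [e] at h
    rw [euclideanHausdorffMeasure_plane hn0, h, ← mul_assoc, ← ENNReal.ofReal_mul (abs_nonneg _),
      mul_inv_cancel₀ hcpos.ne']
    simp
  have hL1 : LipschitzOnWith r ψ A := LipschitzOnWith.of_dist_le_mul hup
  have hL2 : LipschitzOnWith r (Function.invFunOn ψ A) (ψ '' A) := by
    refine LipschitzOnWith.of_dist_le_mul ?_
    rintro _ ⟨a, ha, rfl⟩ _ ⟨b, hb, rfl⟩
    rw [hinj.leftInvOn_invFunOn ha, hinj.leftInvOn_invFunOn hb]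
    exact hlow a ha b hb
  have m1 := hL1.euclideanHausdorffMeasure_image_le 2
  have m2 := hL2.euclideanHausdorffMeasure_image_le 2
  rw [hinj.invFunOn_image subset_rfl] at m2
  rw [hvol]
  refine ⟨by gcongr, ?_⟩
  rw [mul_left_comm]
  gcongr

/-- By compactness a local bound is enough. Near `x`, project along the normal itself, where the
flux factor is `1`, and compare with a bounded planar set. -/
theorem isFiniteMeasure_surfaceMeasure (hΩ : IsOpen Ω) (h2 : HasC2Boundary Ω)
    (hb : Bornology.IsBounded Ω) : IsFiniteMeasure (surfaceMeasure Ω) := by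
  have hcomp : IsCompact (frontier Ω) :=
    Metric.isCompact_of_isClosed_isBounded isClosed_frontier
      (hb.closure.subset frontier_subset_closure)
  refine ⟨?_⟩
  rw [surfaceMeasure, Measure.restrict_apply_univ]
  refine hcomp.measure_lt_top_of_nhdsWithin fun x hx => ?_
  set n := outwardNormal Ω x
  have hn : ‖n‖ = 1 := norm_outwardNormal h2 hx
  have hnn : inner ℝ n n = (1 : ℝ) := by rw [real_inner_self_eq_norm_sq, hn, one_pow]
  obtain ⟨V, hV, h⟩ := exists_nhds_area hΩ h2 hx (K := ℝ ∙ n) rfl hn (by rw [hnn]; simp)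
    (r := 2) (by norm_num)
  obtain ⟨W, hWV, hWo, hxW⟩ := mem_nhds_iff.1 hV
  refine ⟨W ∩ frontier Ω, inter_mem (mem_nhdsWithin_of_mem_nhds (hWo.mem_nhds hxW))
    self_mem_nhdsWithin, ?_⟩
  have h3 := (h (W ∩ frontier Ω) (inter_subset_inter_left _ hWV)
    (hWo.measurableSet.inter isClosed_frontier.measurableSet)).2
  rw [hnn, abs_one, ENNReal.ofReal_one, one_mul] at h3
  refine h3.trans_lt (ENNReal.mul_lt_top (by simp) ?_)
  have hbd : Bornology.IsBounded ((ℝ ∙ n)ᗮ.orthogonalProjectionOnto '' (W ∩ frontier Ω)) := by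
    have := ((hcomp.isBounded).subset (inter_subset_right : W ∩ frontier Ω ⊆ _))
    exact (ℝ ∙ n)ᗮ.lipschitzWith_orthogonalProjectionOnto.isBounded_image this
  exact hbd.measure_lt_top

variable (hΩ : IsOpen Ω) (hc : Convex ℝ Ω) (h2 : HasC2Boundary Ω)

include hΩ hc h2 in
theorem measurableSet_inflowPart (β : E3) : MeasurableSet (inflowPart Ω β) := by
  refine isClosed_frontier.measurableSet.inter ?_
  exact measurableSet_Iio.preimage
    ((measurable_outwardNormal hΩ hc h2).const_inner (𝕜 := ℝ) (c := β))

include hΩ hc h2 in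
theorem fluxMeasure_apply {A : Set E3} (hA : MeasurableSet A) :
    fluxMeasure Ω β A = ∫⁻ x in A ∩ inflowPart Ω β,
      ENNReal.ofReal (-inner ℝ β (outwardNormal Ω x)) ∂μHE[2] := by
  have hm : MeasurableSet {x | inner ℝ β (outwardNormal Ω x) < 0} :=
    measurableSet_Iio.preimage
      ((measurable_outwardNormal hΩ hc h2).const_inner (𝕜 := ℝ) (c := β))
  rw [fluxMeasure, withDensity_apply _ hA, surfaceMeasure, Measure.restrict_restrict hm,
    Measure.restrict_restrict hA]
  congr 2
  rw [inter_comm _ (frontier Ω)]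
  rfl

include hΩ hc h2 in
-- A line enters a convex domain only once. Just after an entry point `b` it lies in `Ω`, while at a
-- second entry point `b + t • β` the supporting half-space excludes all earlier points of the line.
theorem injOn_proj_inflowPart (hK : K = ℝ ∙ β) :
    InjOn Kᗮ.orthogonalProjectionOnto (inflowPart Ω β) := by
  have key : ∀ b ∈ inflowPart Ω β, ∀ t : ℝ, 0 < t → b + t • β ∈ inflowPart Ω β → False := by
    intro b hb t ht ha
    have h3 := eventually_mem_of_inner_neg hΩ h2 hb.1 hb.2
    have h4 : ∀ᶠ s in 𝓝[>] (0 : ℝ), s < t := mem_nhdsWithin_of_mem_nhds (Iio_mem_nhds ht)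
    obtain ⟨s, hs, hst⟩ := (h3.and h4).exists
    have h5 := inner_sub_neg_of_mem hΩ hc h2 ha.1 hs
    have e : b + s • β - (b + t • β) = (s - t) • β := by rw [sub_smul]; abel
    rw [e, real_inner_smul_left] at h5
    have h6 := ha.2
    exact absurd h5 (not_lt.2 (mul_nonneg_of_nonpos_of_nonpos (by linarith) h6.le))
  intro a ha b hb hab
  obtain ⟨t, rfl⟩ := (proj_eq_iff hK).1 hab
  rcases lt_trichotomy t 0 with h | h | h
  · exact (key _ ha (-t) (by linarith) (by simpa using hb)).elim
  · simp [h]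
  · exact (key _ hb t h ha).elim

include hΩ hc h2 in
/-- The flux measure of a part of the inflow boundary is the area of its projection along `β`. -/
theorem volume_proj_inflow (hK : K = ℝ ∙ β) (hβ : ‖β‖ = 1) {A : Set E3} (hA : MeasurableSet A)
    (hAs : A ⊆ inflowPart Ω β) :
    volume (Kᗮ.orthogonalProjectionOnto '' A) = fluxMeasure Ω β A := by
  set P := Kᗮ.orthogonalProjectionOnto with hP
  have hinj := injOn_proj_inflowPart hΩ hc h2 hK
  -- Two factors `r` come from the local area comparison and one from the variation of `β·n` over a
  -- small piece; letting `r` decrease to `1` at the end gives equality.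
  have step (r : NNReal) (hr : 1 < r) : volume (P '' A) ≤ (r : ℝ≥0∞) ^ 3 * fluxMeasure Ω β A ∧
      fluxMeasure Ω β A ≤ (r : ℝ≥0∞) ^ 3 * volume (P '' A) := by
    have hr0 : (0 : ℝ) < r := by have : (1 : ℝ) < r := by exact_mod_cast hr
                                 linarith
    have hloc : ∀ x ∈ inflowPart Ω β, ∃ V ∈ 𝓝 x, IsOpen V ∧ ∀ B ⊆ V ∩ inflowPart Ω β,
        MeasurableSet B → volume (P '' B) ≤ (r : ℝ≥0∞) ^ 3 * fluxMeasure Ω β B ∧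
          fluxMeasure Ω β B ≤ (r : ℝ≥0∞) ^ 3 * volume (P '' B) := by
      intro x hx
      have hcne : inner ℝ (outwardNormal Ω x) β ≠ 0 := by
        rw [real_inner_comm]; exact hx.2.ne
      obtain ⟨V, hV, h⟩ := exists_nhds_area hΩ h2 hx.1 hK hβ hcne hr
      set c : ℝ := -inner ℝ β (outwardNormal Ω x) with hcd
      have hc0 : 0 < c := by rw [hcd]; linarith [hx.2]
      have habs : |inner ℝ (outwardNormal Ω x) β| = c := by
        rw [real_inner_comm, abs_of_neg hx.2]
      rw [habs] at h
      have hcont : ContinuousWithinAt (fun y => -inner ℝ β (outwardNormal Ω y)) (frontier Ω) x :=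
        (continuousWithinAt_const.inner (continuousOn_outwardNormal hΩ hc h2 x hx.1)).neg
      have hcr1 : c < r * c := by
        have : (1 : ℝ) < r := by exact_mod_cast hr
        nlinarith
      have hcr2 : c / r < c := by
        rw [div_lt_iff₀ hr0]; linarith
      have hI := hcont.preimage_mem_nhdsWithin (Ioo_mem_nhds hcr2 hcr1)
      obtain ⟨V', hV', hV's⟩ := mem_nhdsWithin_iff_exists_mem_nhds_inter.1 hI
      obtain ⟨W, hWs, hWo, hxW⟩ := mem_nhds_iff.1 (inter_mem hV hV')
      refine ⟨W, hWo.mem_nhds hxW, hWo, fun B hB hBm => ?_⟩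
      have hBs : B ⊆ inflowPart Ω β := fun y hy => (hB hy).2
      obtain ⟨u1, u2⟩ := h B (fun y hy => ⟨(hWs (hB hy).1).1, (hBs hy).1⟩) hBm
      have hval (y : E3) (hy : y ∈ B) : -inner ℝ β (outwardNormal Ω y) ∈ Ioo (c / r) (r * c) :=
        hV's ⟨(hWs (hB hy).1).2, (hBs hy).1⟩
      have hflux : fluxMeasure Ω β B = ∫⁻ y in B,
          ENNReal.ofReal (-inner ℝ β (outwardNormal Ω y)) ∂μHE[2] := by
        rw [fluxMeasure_apply hΩ hc h2 hBm, inter_eq_left.2 hBs]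
      have f1 : ENNReal.ofReal c * μHE[2] B ≤ r * fluxMeasure Ω β B := by
        rw [hflux, ← lintegral_const_mul' _ _ (by simp), ← setLIntegral_const]
        refine setLIntegral_mono' hBm fun y hy => ?_
        rw [← ENNReal.ofReal_coe_nnreal, ← ENNReal.ofReal_mul hr0.le]
        apply ENNReal.ofReal_le_ofReal
        have := (hval y hy).1
        rw [div_lt_iff₀ hr0] at this
        linarith
      have f2 : fluxMeasure Ω β B ≤ r * (ENNReal.ofReal c * μHE[2] B) := by
        rw [hflux, ← mul_assoc, ← setLIntegral_const]
        refine setLIntegral_mono' hBm fun y hy => ?_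
        rw [← ENNReal.ofReal_coe_nnreal, ← ENNReal.ofReal_mul hr0.le]
        exact ENNReal.ofReal_le_ofReal (hval y hy).2.le
      constructor
      · calc volume (P '' B) ≤ (r : ℝ≥0∞) ^ 2 * (ENNReal.ofReal c * μHE[2] B) := by
              refine u1.trans (le_of_eq (by ring))
          _ ≤ (r : ℝ≥0∞) ^ 2 * (r * fluxMeasure Ω β B) := by gcongr
          _ = _ := by ring
      · calc fluxMeasure Ω β B ≤ r * (ENNReal.ofReal c * μHE[2] B) := f2
          _ ≤ r * ((r : ℝ≥0∞) ^ 2 * volume (P '' B)) := by gcongr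
          _ = _ := by ring
    choose! V hV hVo hVs using hloc
    obtain ⟨t, htM, htc, hcov⟩ := TopologicalSpace.countable_cover_nhdsWithin
      (f := V) (fun x hx => mem_nhdsWithin_of_mem_nhds (hV x hx))
    rcases eq_empty_or_nonempty t with rfl | htne
    · have : A = ∅ := by
        have h3 := hAs.trans hcov
        simpa using h3
      simp [this]
    obtain ⟨e, rfl⟩ := htc.exists_eq_range htne
    -- Cutting the countable cover into disjoint pieces lets both sides be summed; injectivity of
    -- the projection on the inflow part keeps the projected pieces disjoint.
    set D : ℕ → Set E3 := disjointed fun k => V (e k) with hD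
    have hDm (k : ℕ) : MeasurableSet (D k) :=
      MeasurableSet.disjointed (fun k => (hVo (e k) (htM ⟨k, rfl⟩)).measurableSet) k
    have hAD : A = ⋃ k, A ∩ D k := by
      rw [← inter_iUnion, hD, iUnion_disjointed, eq_comm, inter_eq_left]
      refine (hAs.trans hcov).trans ?_
      simp
    have hdisj : Pairwise (Function.onFun Disjoint fun k => A ∩ D k) := fun i j hij =>
      (disjoint_disjointed (fun k => V (e k)) hij).mono inter_subset_right inter_subset_right
    have hPA : volume (P '' A) = ∑' k, volume (P '' (A ∩ D k)) := by
      conv_lhs => rw [hAD, image_iUnion]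
      refine measure_iUnion ?_ fun k => ?_
      · intro i j hij
        rw [Function.onFun, disjoint_left]
        rintro _ ⟨a, ha, rfl⟩ ⟨b, hb, hab⟩
        have := hinj (hAs hb.1) (hAs ha.1) hab
        subst this
        exact disjoint_left.1 (hdisj hij) ha hb
      · exact (hA.inter (hDm k)).image_of_continuousOn_injOn P.continuous.continuousOn
          (hinj.mono fun a ha => hAs ha.1)
    have hfA : fluxMeasure Ω β A = ∑' k, fluxMeasure Ω β (A ∩ D k) := by
      conv_lhs => rw [hAD]
      exact measure_iUnion hdisj fun k => hA.inter (hDm k)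
    have hk (k : ℕ) := hVs (e k) (htM ⟨k, rfl⟩) (A ∩ D k)
      (fun a ha => ⟨disjointed_subset (fun k => V (e k)) k ha.2, hAs ha.1⟩) (hA.inter (hDm k))
    rw [hPA, hfA, ← ENNReal.tsum_mul_left, ← ENNReal.tsum_mul_left]
    exact ⟨ENNReal.tsum_le_tsum fun k => (hk k).1, ENNReal.tsum_le_tsum fun k => (hk k).2⟩
  have hlim {a b : ℝ≥0∞} (h : ∀ r : NNReal, 1 < r → a ≤ (r : ℝ≥0∞) ^ 3 * b) : a ≤ b := by
    by_cases hb : b = ⊤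
    · rw [hb]; exact le_top
    have ht : Tendsto (fun r : NNReal => (r : ℝ≥0∞) ^ 3 * b) (𝓝[>] 1) (𝓝 b) := by
      have h1 : Tendsto (fun r : NNReal => (r : ℝ≥0∞) ^ 3) (𝓝[>] 1) (𝓝 1) := by
        have : Continuous fun r : NNReal => (r : ℝ≥0∞) ^ 3 :=
          (ENNReal.continuous_pow 3).comp ENNReal.continuous_coe
        simpa using (this.tendsto 1).mono_left nhdsWithin_le_nhds
      simpa using ENNReal.Tendsto.mul_const h1 (Or.inr hb)
    refine ge_of_tendsto ht ?_
    filter_upwards [self_mem_nhdsWithin] with r hr using h r hr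
  exact le_antisymm (hlim fun r hr => (step r hr).1) (hlim fun r hr => (step r hr).2)

end

/-! ### Disintegration of Lebesgue measure along chords -/

open Filter Topology Module

/-- The standing assumptions on the domain. -/
structure IsC2ConvexDomain (Ω : Set E3) : Prop where
  isOpen : IsOpen Ω
  convex : Convex ℝ Ω
  c2 : HasC2Boundary Ω
  bounded : Bornology.IsBounded Ω

namespace IsC2ConvexDomain

variable {Ω : Set E3} {x β : E3} {K : Submodule ℝ E3} (hD : IsC2ConvexDomain Ω)
include hD

theorem exists_mem_of_inflow (hx : x ∈ inflowPart Ω β) : ∃ s : ℝ, x + s • β ∈ Ω :=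
  (eventually_mem_of_inner_neg hD.isOpen hD.c2 hx.1 hx.2).exists

theorem exitTime_neg_of_inflow (hβ : ‖β‖ = 1) (hx : x ∈ inflowPart Ω β) :
    exitTime Ω x (-β) = 0 :=
  exitTime_eq_zero_of_outflow hD.isOpen hD.convex hD.c2 hD.bounded (by rwa [norm_neg]) hx.1
    (by rw [inner_neg_left]; linarith [hx.2])

theorem mem_chord_iff (hβ : ‖β‖ = 1) (hx : x ∈ inflowPart Ω β) {s : ℝ} :
    x + s • β ∈ Ω ↔ s ∈ Ioo 0 (exitTime Ω x β) := by
  rw [mem_line_iff hD.isOpen hD.convex hD.bounded hβ (hD.exists_mem_of_inflow hx),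
    hD.exitTime_neg_of_inflow hβ hx, neg_zero]

theorem exitTime_pos_of_inflow (hβ : ‖β‖ = 1) (hx : x ∈ inflowPart Ω β) :
    0 < exitTime Ω x β := by
  obtain ⟨s, hs⟩ := hD.exists_mem_of_inflow hx
  have := (hD.mem_chord_iff hβ hx).1 hs
  exact this.1.trans this.2

theorem exitPoint_mem_inflowPart_neg (hβ : ‖β‖ = 1) (hne : ∃ s : ℝ, x + s • β ∈ Ω) :
    exitPoint Ω x β ∈ inflowPart Ω (-β) :=
  ⟨exitPoint_mem_frontier hD.isOpen hD.bounded hβ hne, by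
    rw [inner_neg_left]
    linarith [normalFlux_exitPoint_pos hD.isOpen hD.convex hD.c2 hD.bounded hβ hne]⟩

theorem fluxMeasure_compl : fluxMeasure Ω β (inflowPart Ω β)ᶜ = 0 := by
  rw [fluxMeasure_apply hD.isOpen hD.convex hD.c2
    (measurableSet_inflowPart hD.isOpen hD.convex hD.c2 β).compl]
  simp

theorem ae_mem_inflowPart : ∀ᵐ p ∂(fluxMeasure Ω β), p ∈ inflowPart Ω β :=
  hD.fluxMeasure_compl

theorem image_proj_inflowPart (hK : K = ℝ ∙ β) (hβ : ‖β‖ = 1) :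
    Kᗮ.orthogonalProjectionOnto '' (inflowPart Ω β) = Kᗮ.orthogonalProjectionOnto '' Ω := by
  apply Subset.antisymm
  · rintro _ ⟨p, hp, rfl⟩
    obtain ⟨s, hs⟩ := hD.exists_mem_of_inflow hp
    exact ⟨_, hs, (proj_eq_iff hK).2 ⟨s, rfl⟩⟩
  · rintro _ ⟨y, hy, rfl⟩
    have h := hD.exitPoint_mem_inflowPart_neg (x := y) (β := -β) (by rwa [norm_neg])
      ⟨0, by simpa using hy⟩
    rw [neg_neg] at h
    exact ⟨_, h, (proj_eq_iff hK).2 ⟨-exitTime Ω y (-β), by rw [exitPoint]; simp⟩⟩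

theorem map_proj_fluxMeasure (hK : K = ℝ ∙ β) (hβ : ‖β‖ = 1) :
    (fluxMeasure Ω β).map Kᗮ.orthogonalProjectionOnto =
      volume.restrict (Kᗮ.orthogonalProjectionOnto '' Ω) := by
  ext B hB
  have hmI := measurableSet_inflowPart hD.isOpen hD.convex hD.c2 β
  have hPm : Measurable Kᗮ.orthogonalProjectionOnto := by fun_prop
  rw [Measure.map_apply hPm hB, Measure.restrict_apply hB, ← hD.image_proj_inflowPart hK hβ,
    ← image_preimage_inter, volume_proj_inflow hD.isOpen hD.convex hD.c2 hK hβ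
      ((hPm hB).inter hmI) inter_subset_right,
    measure_inter_conull' (measure_mono_null (fun y hy => hy.2) (hD.fluxMeasure_compl (β := β)))]

/-- Fubini in the coordinates `(s, y)` with `y` orthogonal to `β`, followed by labelling each line
meeting `Ω` by its entry point. That relabelling turns area on the projection of `Ω` into the flux
measure, and translation invariance on the line moves the origin of `s` to the entry point. -/
theorem lintegral_line (hβ : ‖β‖ = 1) {f : E3 → ℝ≥0∞} (hf : Measurable f) :
    ∫⁻ x in Ω, f x = ∫⁻ p, ∫⁻ s : ℝ in Ioo 0 (exitTime Ω p β), f (p + s • β) ∂volume ∂(fluxMeasure Ω β) := by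
  set K := ℝ ∙ β with hK
  set P := Kᗮ.orthogonalProjectionOnto with hP
  have hPm : Measurable P := by fun_prop
  have hΩm := hD.isOpen.measurableSet
  set F : E3 → ℝ≥0∞ := Ω.indicator f with hF
  have hFm : Measurable F := hf.indicator hΩm
  set h : Kᗮ → ℝ≥0∞ := fun y => ∫⁻ s : ℝ, F (s • β + y) with hh
  have hhm : Measurable h := by
    refine Measurable.lintegral_prod_right' (f := fun q : Kᗮ × ℝ => F (q.2 • β + q.1)) ?_
    exact hFm.comp (by fun_prop)
  have hsupp : Function.support h ⊆ P '' Ω := by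
    intro y hy
    by_contra hcon
    apply hy
    have : ∀ s : ℝ, F (s • β + y) = 0 := by
      intro s
      rw [hF, indicator_of_notMem]
      intro hmem
      refine hcon ⟨_, hmem, ?_⟩
      rw [hP, ← Submodule.orthogonalProjectionOnto_mem_subspace_eq_self y, proj_eq_iff hK]
      exact ⟨s, by rw [add_comm]; simp⟩
    simp [hh, this]
  have hline (p : E3) : h (P p) = ∫⁻ s : ℝ, F (p + s • β) := by
    obtain ⟨t, ht⟩ : ∃ t : ℝ, (P p : E3) = p + t • β := by
      rw [← proj_eq_iff hK]
      exact Submodule.orthogonalProjectionOnto_mem_subspace_eq_self _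
    rw [hh]
    simp only [ht]
    rw [← lintegral_add_right_eq_self (fun s : ℝ => F (p + s • β)) t]
    congr 1 with s
    congr 1
    rw [add_smul]; abel
  rw [← lintegral_indicator hΩm, lintegral_lineMap hK hβ hFm]
  change ∫⁻ y, h y = _
  have hPΩ : MeasurableSet (P '' Ω) := by
    have h0 := (measurableSet_inflowPart hD.isOpen hD.convex hD.c2 β).image_of_continuousOn_injOn
      P.continuous.continuousOn (injOn_proj_inflowPart hD.isOpen hD.convex hD.c2 hK)
    rwa [hD.image_proj_inflowPart hK hβ] at h0
  rw [← setLIntegral_eq_of_support_subset hsupp,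
    ← hD.map_proj_fluxMeasure hK hβ, lintegral_map hhm hPm]
  refine lintegral_congr_ae ?_
  filter_upwards [hD.ae_mem_inflowPart (β := β)] with p hp
  rw [hline, ← lintegral_indicator measurableSet_Ioo]
  congr 1 with s
  by_cases hs : p + s • β ∈ Ω
  · rw [hF, indicator_of_mem hs, indicator_of_mem ((hD.mem_chord_iff hβ hp).1 hs)]
  · rw [hF, indicator_of_notMem hs, indicator_of_notMem fun h => hs ((hD.mem_chord_iff hβ hp).2 h)]

theorem measurable_exitPoint : Measurable fun z : E3 × S2 => exitPoint Ω z.1 z.2 := by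
  unfold exitPoint
  have := measurable_exitTime hD.isOpen hD.bounded
  fun_prop

/-- The two ends of a chord have the same projection along `β`, and the exit points for `β` are the
entry points for `-β`. Both flux measures are the area of this common projection. -/
theorem map_exitPoint_fluxMeasure (β : S2) :
    (fluxMeasure Ω β).map (fun p => exitPoint Ω p β) = fluxMeasure Ω (-(β : E3)) := by
  have hβ : ‖(β : E3)‖ = 1 := by simp
  have hβ' : ‖-(β : E3)‖ = 1 := by simp
  set K := ℝ ∙ (β : E3) with hK
  have hK' : K = ℝ ∙ (-(β : E3)) := by
    rw [hK, ← Submodule.span_neg]; simp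
  set P := Kᗮ.orthogonalProjectionOnto with hP
  have hXm : Measurable fun p => exitPoint Ω p β :=
    hD.measurable_exitPoint.comp (by fun_prop : Measurable fun p : E3 => (p, β))
  have hmI := measurableSet_inflowPart hD.isOpen hD.convex hD.c2 (β : E3)
  have hmO := measurableSet_inflowPart hD.isOpen hD.convex hD.c2 (-(β : E3))
  ext A hA
  rw [Measure.map_apply hXm hA,
    ← measure_inter_conull' (s := (fun p => exitPoint Ω p β) ⁻¹' A) (t := inflowPart Ω (β : E3))
      (measure_mono_null (fun y hy => hy.2) (hD.fluxMeasure_compl (β := (β : E3)))),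
    ← measure_inter_conull' (s := A) (t := inflowPart Ω (-(β : E3)))
      (measure_mono_null (fun y hy => hy.2) (hD.fluxMeasure_compl (β := -(β : E3)))),
    ← volume_proj_inflow hD.isOpen hD.convex hD.c2 hK hβ ((hXm hA).inter hmI) inter_subset_right,
    ← volume_proj_inflow hD.isOpen hD.convex hD.c2 hK' hβ' (hA.inter hmO) inter_subset_right]
  congr 1
  apply Subset.antisymm
  · rintro _ ⟨p, ⟨hpA, hp⟩, rfl⟩
    exact ⟨_, ⟨hpA, hD.exitPoint_mem_inflowPart_neg hβ (hD.exists_mem_of_inflow hp)⟩,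
      (proj_eq_iff hK).2 ⟨_, rfl⟩⟩
  · rintro _ ⟨q, ⟨hqA, hq⟩, rfl⟩
    have hq' : 0 < inner ℝ (β : E3) (outwardNormal Ω q) := by
      have := hq.2; rw [inner_neg_left] at this; linarith
    obtain ⟨s, hs⟩ := hD.exists_mem_of_inflow hq
    have hs' : q + (-s) • (β : E3) ∈ Ω := by rwa [smul_neg, ← neg_smul] at hs
    have hent := hD.exitPoint_mem_inflowPart_neg hβ' ⟨s, hs⟩
    rw [neg_neg] at hent
    have e : exitPoint Ω q (-(β : E3)) = q + (-exitTime Ω q (-(β : E3))) • (β : E3) := by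
      rw [exitPoint, smul_neg, neg_smul]
    refine ⟨exitPoint Ω q (-(β : E3)), ⟨?_, hent⟩, (proj_eq_iff hK).2 ⟨_, e⟩⟩
    rw [mem_preimage, e, exitPoint_add_smul hD.bounded hβ ⟨_, hs'⟩,
      exitPoint_eq_of_outflow hD.isOpen hD.convex hD.c2 hD.bounded hβ hq.1 hq']
    exact hqA

end IsC2ConvexDomain

/-! ### Disintegration of the phase space measure -/

open Filter Topology Module

instance : IsFiniteMeasure sphereMeasure := by unfold sphereMeasure; infer_instance

/-- The length of the chord of direction `β` starting at the inflow boundary point `x`. -/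
def chordLength (Ω : Set E3) (z : E3 × S2) : ℝ := exitTime Ω z.1 z.2

/-- The chords, parametrized by their starting point, direction and arclength. -/
def chordMap (q : (E3 × S2) × ℝ) : E3 × S2 := (q.1.1 + q.2 • (q.1.2 : E3), q.1.2)

/-- The map sending the starting point of a chord to its end point. -/
def chordEnd (Ω : Set E3) (z : E3 × S2) : E3 × S2 := (exitPoint Ω z.1 z.2, z.2)

/-- `-β·n dΓ dβ ds` on the set of chords. -/
def chordMeasure (Ω : Set E3) : Measure ((E3 × S2) × ℝ) :=
  ((inflowMeasure Ω).prod volume).restrict {q | q.2 ∈ Ioo 0 (chordLength Ω q.1)}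

theorem measurable_chordMap : Measurable chordMap := by unfold chordMap; fun_prop

theorem norm_outwardNormal_le {Ω : Set E3} (h2 : HasC2Boundary Ω) (x : E3) :
    ‖outwardNormal Ω x‖ ≤ 1 := by
  by_cases hx : x ∈ frontier Ω
  · exact (norm_outwardNormal h2 hx).le
  · rw [outwardNormal_of_notMem hx]; simp

theorem abs_normalFlux_le {Ω : Set E3} (h2 : HasC2Boundary Ω) (z : E3 × S2) :
    |normalFlux Ω z| ≤ 1 := by
  refine (abs_real_inner_le_norm _ _).trans ?_
  have h3 : ‖(z.2 : E3)‖ = 1 := by simp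
  rw [h3, one_mul]
  exact norm_outwardNormal_le h2 _

namespace IsC2ConvexDomain

variable {Ω : Set E3} (hD : IsC2ConvexDomain Ω)
include hD

theorem measurable_flux : Measurable (normalFlux Ω) :=
  measurable_normalFlux hD.isOpen hD.convex hD.c2

theorem measurable_chordLength : Measurable (chordLength Ω) :=
  measurable_exitTime hD.isOpen hD.bounded

theorem measurable_chordEnd : Measurable (chordEnd Ω) :=
  hD.measurable_exitPoint.prodMk measurable_snd

theorem isFiniteMeasure_surface : IsFiniteMeasure (surfaceMeasure Ω) :=
  isFiniteMeasure_surfaceMeasure hD.isOpen hD.c2 hD.bounded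

theorem isFiniteMeasure_boundary : IsFiniteMeasure (boundaryMeasure Ω) := by
  have := hD.isFiniteMeasure_surface
  unfold boundaryMeasure
  infer_instance

theorem isFiniteMeasure_inflow : IsFiniteMeasure (inflowMeasure Ω) := by
  have := hD.isFiniteMeasure_boundary
  refine isFiniteMeasure_withDensity (ne_top_of_le_ne_top (b := ∫⁻ _, 1 ∂
    ((boundaryMeasure Ω).restrict (inflowBoundary Ω))) (by simp) ?_)
  refine lintegral_mono fun z => ENNReal.ofReal_le_one.2 ?_
  linarith [neg_abs_le (normalFlux Ω z), abs_normalFlux_le hD.c2 z]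

theorem isFiniteMeasure_outflow : IsFiniteMeasure (outflowMeasure Ω) := by
  have := hD.isFiniteMeasure_boundary
  refine isFiniteMeasure_withDensity (ne_top_of_le_ne_top (b := ∫⁻ _, 1 ∂
    ((boundaryMeasure Ω).restrict (outflowBoundary Ω))) (by simp) ?_)
  refine lintegral_mono fun z => ENNReal.ofReal_le_one.2 ?_
  linarith [le_abs_self (normalFlux Ω z), abs_normalFlux_le hD.c2 z]

theorem isFiniteMeasure_volume : IsFiniteMeasure (volume.restrict Ω) :=
  ⟨by rw [Measure.restrict_apply_univ]; exact hD.bounded.measure_lt_top⟩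

theorem isFiniteMeasure_phase : IsFiniteMeasure (phaseMeasure Ω) := by
  have := hD.isFiniteMeasure_volume
  unfold phaseMeasure
  infer_instance

theorem measurableSet_inflowBoundary : MeasurableSet (inflowBoundary Ω) :=
  (measurable_fst isClosed_frontier.measurableSet).inter
    (hD.measurable_flux measurableSet_Iio)

theorem measurableSet_outflowBoundary : MeasurableSet (outflowBoundary Ω) :=
  (measurable_fst isClosed_frontier.measurableSet).inter
    (hD.measurable_flux measurableSet_Ioi)

theorem lintegral_fluxMeasure (β : E3) {f : E3 → ℝ≥0∞} (hf : Measurable f) :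
    ∫⁻ x, f x ∂(fluxMeasure Ω β) = ∫⁻ x, {x | inner ℝ β (outwardNormal Ω x) < 0}.indicator
      (fun x => ENNReal.ofReal (-inner ℝ β (outwardNormal Ω x)) * f x) x ∂(surfaceMeasure Ω) := by
  have hm := (measurable_outwardNormal hD.isOpen hD.convex hD.c2).const_inner (𝕜 := ℝ) (c := β)
  have hmn : Measurable fun x => ENNReal.ofReal (-inner ℝ β (outwardNormal Ω x)) :=
    hm.neg.ennreal_ofReal
  have hs : MeasurableSet {x | inner ℝ β (outwardNormal Ω x) < 0} := hm measurableSet_Iio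
  rw [fluxMeasure, lintegral_withDensity_eq_lintegral_mul _ hmn hf, lintegral_indicator hs]
  rfl

theorem ae_boundary_mem : ∀ᵐ z ∂(boundaryMeasure Ω), z.1 ∈ frontier Ω := by
  have := hD.isFiniteMeasure_surface
  exact Measure.quasiMeasurePreserving_fst.ae
    (ae_restrict_mem isClosed_frontier.measurableSet)

theorem lintegral_inflow {F : E3 × S2 → ℝ≥0∞} (hF : Measurable F) :
    ∫⁻ z, F z ∂(inflowMeasure Ω) =
      ∫⁻ β, ∫⁻ x, F (x, β) ∂(fluxMeasure Ω (β : E3)) ∂sphereMeasure := by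
  have := hD.isFiniteMeasure_surface
  have hm := hD.measurable_flux
  have hmn : Measurable fun z => ENNReal.ofReal (-normalFlux Ω z) := hm.neg.ennreal_ofReal
  have hs : MeasurableSet {z | normalFlux Ω z < 0} := hm measurableSet_Iio
  rw [inflowMeasure, lintegral_withDensity_eq_lintegral_mul _ hmn hF,
    ← lintegral_indicator hD.measurableSet_inflowBoundary]
  have e : ∫⁻ z, (inflowBoundary Ω).indicator
      ((fun z => ENNReal.ofReal (-normalFlux Ω z)) * F) z ∂(boundaryMeasure Ω) =
      ∫⁻ z, {z | normalFlux Ω z < 0}.indicator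
      ((fun z => ENNReal.ofReal (-normalFlux Ω z)) * F) z ∂(boundaryMeasure Ω) := by
    refine lintegral_congr_ae ?_
    filter_upwards [hD.ae_boundary_mem] with z hz
    by_cases h : normalFlux Ω z < 0
    · rw [indicator_of_mem (show z ∈ inflowBoundary Ω from ⟨hz, h⟩), indicator_of_mem (by exact h)]
    · rw [indicator_of_notMem (fun h' : z ∈ inflowBoundary Ω => h h'.2),
        indicator_of_notMem (by exact h)]
  rw [e, boundaryMeasure, lintegral_prod_symm _
    ((hmn.mul hF).indicator hs).aemeasurable]
  refine lintegral_congr fun β => ?_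
  rw [hD.lintegral_fluxMeasure _ (by fun_prop)]
  rfl

theorem lintegral_outflow {F : E3 × S2 → ℝ≥0∞} (hF : Measurable F) :
    ∫⁻ z, F z ∂(outflowMeasure Ω) =
      ∫⁻ β, ∫⁻ x, F (x, β) ∂(fluxMeasure Ω (-(β : E3))) ∂sphereMeasure := by
  have := hD.isFiniteMeasure_surface
  have hm := hD.measurable_flux
  have hs : MeasurableSet {z | 0 < normalFlux Ω z} := hm measurableSet_Ioi
  rw [outflowMeasure, lintegral_withDensity_eq_lintegral_mul _ hm.ennreal_ofReal hF,
    ← lintegral_indicator hD.measurableSet_outflowBoundary]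
  have e : ∫⁻ z, (outflowBoundary Ω).indicator
      ((fun z => ENNReal.ofReal (normalFlux Ω z)) * F) z ∂(boundaryMeasure Ω) =
      ∫⁻ z, {z | 0 < normalFlux Ω z}.indicator
      ((fun z => ENNReal.ofReal (normalFlux Ω z)) * F) z ∂(boundaryMeasure Ω) := by
    refine lintegral_congr_ae ?_
    filter_upwards [hD.ae_boundary_mem] with z hz
    by_cases h : 0 < normalFlux Ω z
    · rw [indicator_of_mem (show z ∈ outflowBoundary Ω from ⟨hz, h⟩), indicator_of_mem (by exact h)]
    · rw [indicator_of_notMem (fun h' : z ∈ outflowBoundary Ω => h h'.2),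
        indicator_of_notMem (by exact h)]
  rw [e, boundaryMeasure, lintegral_prod_symm _
    ((hm.ennreal_ofReal.mul hF).indicator hs).aemeasurable]
  refine lintegral_congr fun β => ?_
  rw [hD.lintegral_fluxMeasure _ (by fun_prop)]
  refine lintegral_congr fun x => ?_
  simp only [inner_neg_left, neg_neg, indicator, mem_ofPred_eq, neg_lt_zero, Pi.mul_apply,
    normalFlux]
  congr

theorem ae_inflow_mem : ∀ᵐ z ∂(inflowMeasure Ω), z.1 ∈ inflowPart Ω (z.2 : E3) :=
  (withDensity_absolutelyContinuous _ _).ae_le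
    (ae_restrict_mem hD.measurableSet_inflowBoundary)

theorem measurableSet_chord : MeasurableSet {q : (E3 × S2) × ℝ | q.2 ∈ Ioo 0 (chordLength Ω q.1)} :=
  (measurableSet_lt measurable_const measurable_snd).inter
    (measurableSet_lt measurable_snd (hD.measurable_chordLength.comp measurable_fst))

theorem lintegral_chordMeasure {F : (E3 × S2) × ℝ → ℝ≥0∞} (hF : Measurable F) :
    ∫⁻ q, F q ∂(chordMeasure Ω) =
      ∫⁻ z, ∫⁻ s : ℝ in Ioo 0 (chordLength Ω z), F (z, s) ∂volume ∂(inflowMeasure Ω) := by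
  have := hD.isFiniteMeasure_inflow
  rw [chordMeasure, ← lintegral_indicator hD.measurableSet_chord,
    lintegral_prod _ (hF.indicator hD.measurableSet_chord).aemeasurable]
  refine lintegral_congr fun z => ?_
  rw [← lintegral_indicator measurableSet_Ioo]
  rfl

/-- The fixed-direction disintegration `lintegral_line`, integrated over the sphere: with respect to
`-β·n dΓ dβ ds` the chords fill phase space exactly once, up to null sets. -/
theorem map_chordMap : (chordMeasure Ω).map chordMap = phaseMeasure Ω := by
  have := hD.isFiniteMeasure_inflow
  have := hD.isFiniteMeasure_volume
  refine Measure.ext_of_lintegral _ fun F hF => ?_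
  rw [lintegral_map hF measurable_chordMap,
    hD.lintegral_chordMeasure (F := fun q => F (chordMap q)) (hF.comp measurable_chordMap), phaseMeasure,
    lintegral_prod_symm _ hF.aemeasurable, hD.lintegral_inflow]
  · refine lintegral_congr fun β => ?_
    rw [hD.lintegral_line (β := (β : E3)) (by simp) (by fun_prop)]
    rfl
  · have h : Measurable fun q : (E3 × S2) × ℝ =>
        {q : (E3 × S2) × ℝ | q.2 ∈ Ioo 0 (chordLength Ω q.1)}.indicator
          (fun q => F (chordMap q)) q :=
      (hF.comp measurable_chordMap).indicator hD.measurableSet_chord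
    convert h.lintegral_prod_right' (ν := volume) using 2 with z
    rw [← lintegral_indicator measurableSet_Ioo]
    rfl

theorem map_chordEnd : (inflowMeasure Ω).map (chordEnd Ω) = outflowMeasure Ω := by
  refine Measure.ext_of_lintegral _ fun F hF => ?_
  rw [lintegral_map hF hD.measurable_chordEnd, hD.lintegral_outflow hF,
    hD.lintegral_inflow (F := fun q => F (chordEnd Ω q)) (hF.comp hD.measurable_chordEnd)]
  refine lintegral_congr fun β => ?_
  rw [← hD.map_exitPoint_fluxMeasure, lintegral_map (by fun_prop)]
  · rfl
  · exact hD.measurable_exitPoint.comp (by fun_prop : Measurable fun p : E3 => (p, β))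

/-- The boundary flux splits into its outflow and inflow parts. -/
theorem integrable_flux {h : E3 × S2 → ℝ} (h1 : Integrable h (inflowMeasure Ω))
    (h3 : Integrable h (outflowMeasure Ω)) :
    Integrable (fun z => normalFlux Ω z * h z) (boundaryMeasure Ω) ∧
    ∫ z, normalFlux Ω z * h z ∂(boundaryMeasure Ω) =
      ∫ z, h z ∂(outflowMeasure Ω) - ∫ z, h z ∂(inflowMeasure Ω) := by
  have hm := hD.measurable_flux
  have hmn : Measurable fun z => ENNReal.ofReal (-normalFlux Ω z) := hm.neg.ennreal_ofReal
  rw [inflowMeasure, integrable_withDensity_iff_integrable_smul' hmn (by simp)] at h1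
  rw [outflowMeasure, integrable_withDensity_iff_integrable_smul' hm.ennreal_ofReal (by simp)] at h3
  rw [inflowMeasure, outflowMeasure,
    integral_withDensity_eq_integral_toReal_smul hmn (by simp),
    integral_withDensity_eq_integral_toReal_smul hm.ennreal_ofReal (by simp),
    ← integral_indicator hD.measurableSet_inflowBoundary,
    ← integral_indicator hD.measurableSet_outflowBoundary]
  have h1' := (integrable_indicator_iff hD.measurableSet_inflowBoundary).2 h1
  have h3' := (integrable_indicator_iff hD.measurableSet_outflowBoundary).2 h3
  rw [← integral_sub h3' h1']
  have e : (fun z => normalFlux Ω z * h z) =ᵐ[boundaryMeasure Ω] fun z =>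
      (outflowBoundary Ω).indicator (fun z => (ENNReal.ofReal (normalFlux Ω z)).toReal • h z) z -
      (inflowBoundary Ω).indicator (fun z => (ENNReal.ofReal (-normalFlux Ω z)).toReal • h z) z := by
    filter_upwards [hD.ae_boundary_mem] with z hz
    rcases lt_trichotomy (normalFlux Ω z) 0 with h | h | h
    · rw [indicator_of_mem (show z ∈ inflowBoundary Ω from ⟨hz, h⟩),
        indicator_of_notMem (fun h' : z ∈ outflowBoundary Ω => h.not_gt h'.2),
        ENNReal.toReal_ofReal (by linarith), smul_eq_mul]
      ring
    · rw [indicator_of_notMem (fun h' : z ∈ inflowBoundary Ω => h.not_lt h'.2),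
        indicator_of_notMem (fun h' : z ∈ outflowBoundary Ω => h.not_gt h'.2), h]
      ring
    · rw [indicator_of_mem (show z ∈ outflowBoundary Ω from ⟨hz, h⟩),
        indicator_of_notMem (fun h' : z ∈ inflowBoundary Ω => h.not_gt h'.2),
        ENNReal.toReal_ofReal h.le, smul_eq_mul]
      ring
  exact ⟨(h3'.sub h1').congr e.symm, integral_congr_ae e⟩

end IsC2ConvexDomain

/-! ### The transport equation on a chord -/

open Filter Topology Module

theorem ennreal_add_sq_le (a b : ℝ≥0∞) : (a + b) ^ 2 ≤ 2 * (a ^ 2 + b ^ 2) := by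
  rcases eq_or_ne a ⊤ with rfl | ha
  · simp [ENNReal.mul_top]
  rcases eq_or_ne b ⊤ with rfl | hb
  · simp [ENNReal.mul_top]
  lift a to NNReal using ha
  lift b to NNReal using hb
  exact_mod_cast (add_sq_le : (a + b) ^ 2 ≤ 2 * (a ^ 2 + b ^ 2))

section
variable {α : Type*} [MeasurableSpace α] {μ : Measure α} {f : α → ℝ}

theorem eLpNorm_two_sq : eLpNorm f 2 μ ^ 2 = ∫⁻ x, ‖f x‖ₑ ^ 2 ∂μ := by
  have h := eLpNorm_nnreal_pow_eq_lintegral (f := f) (μ := μ) (p := 2) (by norm_num)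
  have e : ((2 : NNReal) : ℝ) = ((2 : ℕ) : ℝ) := by norm_num
  rw [e, ENNReal.rpow_natCast] at h
  simp only [ENNReal.rpow_natCast] at h
  exact_mod_cast h

theorem memLp_two_iff_lintegral (hf : AEStronglyMeasurable f μ) :
    MemLp f 2 μ ↔ ∫⁻ x, ‖f x‖ₑ ^ 2 ∂μ < ⊤ := by
  rw [← eLpNorm_two_sq]
  refine ⟨fun h => ENNReal.pow_lt_top h.2, fun h => ⟨hf, ?_⟩⟩
  by_contra hcon
  rw [not_lt, top_le_iff] at hcon
  simp [hcon] at h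

end

/-- The solution along a chord, with boundary value `c` and source `f`. -/
def chordSolution (c : ℝ) (f : ℝ → ℝ) (r : ℝ) : ℝ :=
  Real.exp (-r) * (c + ∫ σ in Ioc 0 r, Real.exp σ * f σ)

theorem chordSolution_zero (c : ℝ) (f : ℝ → ℝ) : chordSolution c f 0 = c := by
  simp [chordSolution]

theorem chordSolution_nonneg {c : ℝ} {f : ℝ → ℝ} {r : ℝ} (hc : 0 ≤ c) (hf : ∀ s, 0 ≤ f s) :
    0 ≤ chordSolution c f r :=
  mul_nonneg (Real.exp_pos _).le (add_nonneg hc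
    (integral_nonneg fun s => mul_nonneg (Real.exp_pos _).le (hf s)))

theorem integrableOn_exp_mul {f : ℝ → ℝ} {L r : ℝ} (hr : r ≤ L)
    (hf : IntegrableOn f (Ioo 0 L)) : IntegrableOn (fun σ => Real.exp σ * f σ) (Ioc 0 r) := by
  rw [← integrableOn_Ioc_iff_integrableOn_Ioo] at hf
  refine (hf.mono_set (Ioc_subset_Ioc_right hr)).continuousOn_mul_of_subset
    (Real.continuous_exp.continuousOn (s := Icc 0 r)) isCompact_Icc measurableSet_Ioc
      Ioc_subset_Icc_self

/-- The transport equation on a chord, integrated against a test function. -/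
theorem integral_chordSolution {f φ φ' : ℝ → ℝ} {L : ℝ} (c : ℝ) (hL : 0 ≤ L)
    (hf : IntegrableOn f (Ioo 0 L)) (hφ : ∀ r, HasDerivAt φ (φ' r) r) (hφ' : Continuous φ') :
    ∫ r in Ioo 0 L, ((f r - chordSolution c f r) * φ r + chordSolution c f r * φ' r) =
      chordSolution c f L * φ L - c * φ 0 := by
  set F : ℝ → ℝ := fun σ => Real.exp σ * f σ with hF
  have hFi : IntervalIntegrable F volume 0 L := by
    rw [intervalIntegrable_iff_integrableOn_Ioc_of_le hL]
    exact integrableOn_exp_mul le_rfl hf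
  -- The source is only integrable, so `W` is only absolutely continuous. Writing the solution as
  -- `exp (-r) * W r` and attaching the exponential to the test function leaves an integration by
  -- parts between `W` and a `C¹` function.
  set W : ℝ → ℝ := fun r => c + ∫ σ in (0 : ℝ)..r, F σ with hW
  have hW1 : AbsolutelyContinuousOnInterval W 0 L := by
    have h1 : AbsolutelyContinuousOnInterval (fun _ : ℝ => c) 0 L :=
      contDiffOn_const.absolutelyContinuousOnInterval
    exact h1.add (hFi.absolutelyContinuousOnInterval_intervalIntegral (by simp))
  set h : ℝ → ℝ := fun r => Real.exp (-r) * φ r with hh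
  have hh1 (r : ℝ) : HasDerivAt h (Real.exp (-r) * (φ' r - φ r)) r := by
    have h1 : HasDerivAt (fun r : ℝ => Real.exp (-r)) (Real.exp (-r) * -1) r :=
      (hasDerivAt_neg r).exp
    exact (h1.mul (hφ r)).congr_deriv (by ring)
  have hφc : Continuous φ := continuous_iff_continuousAt.2 fun r => (hφ r).continuousAt
  have hhC : ContDiff ℝ 1 h := by
    rw [contDiff_one_iff_deriv]
    refine ⟨fun r => (hh1 r).differentiableAt, ?_⟩
    have : deriv h = fun r => Real.exp (-r) * (φ' r - φ r) := funext fun r => (hh1 r).deriv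
    rw [this]
    fun_prop
  have key := hW1.integral_deriv_mul_eq_sub hhC.contDiffOn.absolutelyContinuousOnInterval
  have hsol (r : ℝ) (hr : 0 ≤ r) : chordSolution c f r = Real.exp (-r) * W r := by
    rw [chordSolution, hW]
    simp only [hF]
    rw [intervalIntegral.integral_of_le hr]
  have e0 : W 0 * h 0 = c * φ 0 := by simp [hW, hh]
  rw [e0] at key
  have eL : W L * h L = chordSolution c f L * φ L := by rw [hsol L hL, hh]; ring
  rw [eL] at key
  rw [← key, ← integral_Ioc_eq_integral_Ioo, ← intervalIntegral.integral_of_le hL]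
  refine intervalIntegral.integral_congr_ae ?_
  filter_upwards [hFi.ae_hasDerivAt_integral] with r hr hrm
  rw [uIoc_of_le hL] at hrm
  have hr' := hr (by rw [uIcc_of_le hL]; exact Ioc_subset_Icc_self hrm) 0 (by simp)
  have hWd : deriv W r = F r := (hr'.const_add c).deriv
  rw [hWd, (hh1 r).deriv, hsol r hrm.1.le, hF, hh]
  have : Real.exp r * Real.exp (-r) = 1 := by rw [← Real.exp_add]; simp
  simp only
  linear_combination (-(f r * φ r)) * this

theorem chordSolution_sub {c₁ c₂ : ℝ} {f₁ f₂ : ℝ → ℝ} {L r : ℝ} (hr : r ≤ L)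
    (h₁ : IntegrableOn f₁ (Ioo 0 L)) (h₂ : IntegrableOn f₂ (Ioo 0 L)) :
    chordSolution c₁ f₁ r - chordSolution c₂ f₂ r =
      chordSolution (c₁ - c₂) (fun s => f₁ s - f₂ s) r := by
  unfold chordSolution
  have := integral_sub (integrableOn_exp_mul hr h₁) (integrableOn_exp_mul hr h₂)
  simp only [mul_sub] at this ⊢
  rw [this]
  ring

theorem enorm_chordSolution_le (c : ℝ) (f : ℝ → ℝ) {L r : ℝ} (h0 : 0 ≤ r) (hr : r ≤ L) :
    ‖chordSolution c f r‖ₑ ≤ ‖c‖ₑ + ∫⁻ s in Ioo 0 L, ‖f s‖ₑ := by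
  have e : chordSolution c f r =
      Real.exp (-r) * c + ∫ σ in Ioc 0 r, Real.exp (σ - r) * f σ := by
    rw [chordSolution, mul_add, ← integral_const_mul]
    congr 2 with σ
    rw [← mul_assoc, ← Real.exp_add]
    ring_nf
  rw [e]
  refine (enorm_add_le _ _).trans (add_le_add ?_ ?_)
  · rw [enorm_mul]
    refine mul_le_of_le_one_left' ?_
    rw [Real.enorm_eq_ofReal (Real.exp_pos _).le, ENNReal.ofReal_le_one]
    exact Real.exp_le_one_iff.2 (by linarith)
  · refine (enorm_integral_le_lintegral_enorm _).trans ?_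
    rw [restrict_Ioo_eq_restrict_Ioc]
    refine (setLIntegral_mono' measurableSet_Ioc fun s hs => ?_).trans
      (lintegral_mono_set (Ioc_subset_Ioc_right hr))
    rw [enorm_mul]
    refine mul_le_of_le_one_left' ?_
    rw [Real.enorm_eq_ofReal (Real.exp_pos _).le, ENNReal.ofReal_le_one]
    exact Real.exp_le_one_iff.2 (by linarith [hs.2])

/-- All exponential weights are at most one on `0 ≤ σ ≤ r`; Cauchy–Schwarz on the chord costs its
length, hence the factor `d`. -/
theorem enorm_chordSolution_sq_le (c : ℝ) {f : ℝ → ℝ} {L r d : ℝ} (h0 : 0 ≤ r) (hr : r ≤ L)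
    (hd : L ≤ d) (hf : Measurable f) :
    ‖chordSolution c f r‖ₑ ^ 2 ≤
      2 * (‖c‖ₑ ^ 2 + ENNReal.ofReal d * ∫⁻ s in Ioo 0 L, ‖f s‖ₑ ^ 2) := by
  calc ‖chordSolution c f r‖ₑ ^ 2 ≤ (‖c‖ₑ + ∫⁻ s in Ioo 0 L, ‖f s‖ₑ) ^ 2 := by
        gcongr; exact enorm_chordSolution_le c f h0 hr
    _ ≤ 2 * (‖c‖ₑ ^ 2 + (∫⁻ s in Ioo 0 L, ‖f s‖ₑ) ^ 2) := ennreal_add_sq_le _ _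
    _ ≤ _ := by
        gcongr
        refine (lintegral_sq_le _ hf.enorm.aemeasurable).trans ?_
        gcongr
        rw [Measure.restrict_apply_univ, Real.volume_Ioo, sub_zero]
        exact ENNReal.ofReal_le_ofReal hd

/-! ### The solution of the transport equation -/

open Filter Topology Module

/-- The point at which the ray through `z` has entered the domain. -/
def chordStart (Ω : Set E3) (z : E3 × S2) : E3 × S2 := (exitPoint Ω z.1 (-(z.2 : E3)), z.2)

/-- The distance to the point at which the ray through `z` has entered the domain. -/
def transitLength (Ω : Set E3) (z : E3 × S2) : ℝ := exitTime Ω z.1 (-(z.2 : E3))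

/-- The value at arclength `r` on the chord starting at `z`. -/
def chordValue (S : E3 → ℝ) (g : E3 × S2 → ℝ) (z : E3 × S2) (r : ℝ) : ℝ :=
  chordSolution (g z) (fun s => S (z.1 + s • (z.2 : E3))) r

/-- The solution of the transport equation with source `S` and inflow data `g`. -/
def raySolution (Ω : Set E3) (S : E3 → ℝ) (g : E3 × S2 → ℝ) (z : E3 × S2) : ℝ :=
  chordValue S g (chordStart Ω z) (transitLength Ω z)

theorem raySolution_nonneg {Ω : Set E3} {S : E3 → ℝ} {g : E3 × S2 → ℝ} (hS : ∀ x, 0 ≤ S x)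
    (hg : ∀ z, 0 ≤ g z) (z : E3 × S2) : 0 ≤ raySolution Ω S g z :=
  chordSolution_nonneg (hg _) fun _ => hS _

namespace IsC2ConvexDomain

variable {Ω : Set E3} (hD : IsC2ConvexDomain Ω)
include hD

theorem measurable_transitLength : Measurable (transitLength Ω) := by
  have : Measurable fun z : E3 × S2 => (z.1, -z.2) :=
    measurable_fst.prodMk (continuous_neg.measurable.comp measurable_snd)
  exact hD.measurable_chordLength.comp this

theorem measurable_chordStart : Measurable (chordStart Ω) := by
  have : Measurable fun z : E3 × S2 => (z.1, -z.2) :=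
    measurable_fst.prodMk (continuous_neg.measurable.comp measurable_snd)
  exact (hD.measurable_exitPoint.comp this).prodMk measurable_snd

omit hD in
theorem measurable_chordValue {α : Type*} [MeasurableSpace α] {S : α → E3 → ℝ}
    {g : α → E3 × S2 → ℝ} (hS : Measurable fun p : α × E3 => S p.1 p.2)
    (hg : Measurable fun p : α × E3 × S2 => g p.1 p.2) :
    Measurable fun q : (α × E3 × S2) × ℝ => chordValue (S q.1.1) (g q.1.1) q.1.2 q.2 := by
  unfold chordValue chordSolution
  have h1 : Measurable fun q : ((α × E3 × S2) × ℝ) × ℝ =>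
      (Ioc 0 q.1.2).indicator (fun s => Real.exp s *
        S q.1.1.1 (q.1.1.2.1 + s • (q.1.1.2.2 : E3))) q.2 := by
    have hm : MeasurableSet {q : ((α × E3 × S2) × ℝ) × ℝ | q.2 ∈ Ioc 0 q.1.2} :=
      (measurableSet_lt measurable_const measurable_snd).inter
        (measurableSet_le measurable_snd (by fun_prop))
    have h2 : Measurable fun q : ((α × E3 × S2) × ℝ) × ℝ =>
        Real.exp q.2 * S q.1.1.1 (q.1.1.2.1 + q.2 • (q.1.1.2.2 : E3)) := by
      refine (Real.measurable_exp.comp measurable_snd).mul ?_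
      exact hS.comp (f := fun q : ((α × E3 × S2) × ℝ) × ℝ =>
        (q.1.1.1, q.1.1.2.1 + q.2 • (q.1.1.2.2 : E3))) (by fun_prop)
    exact h2.indicator hm
  have h3 := (h1.stronglyMeasurable.integral_prod_right' (ν := (volume : Measure ℝ))).measurable
  simp only [integral_indicator measurableSet_Ioc] at h3
  have h4 : Measurable fun q : (α × E3 × S2) × ℝ => g q.1.1 q.1.2 := hg.comp measurable_fst
  exact (Real.measurable_exp.comp measurable_snd.neg).mul (h4.add h3)

theorem measurable_raySolution {α : Type*} [MeasurableSpace α] {S : α → E3 → ℝ}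
    {g : α → E3 × S2 → ℝ} (hS : Measurable fun p : α × E3 => S p.1 p.2)
    (hg : Measurable fun p : α × E3 × S2 => g p.1 p.2) :
    Measurable fun q : α × E3 × S2 => raySolution Ω (S q.1) (g q.1) q.2 := by
  have h := measurable_chordValue hS hg
  refine h.comp (f := fun q : α × E3 × S2 => ((q.1, chordStart Ω q.2), transitLength Ω q.2)) ?_
  have h1 := hD.measurable_chordStart
  have h2 := hD.measurable_transitLength
  fun_prop

theorem measurable_raySolution' {S : E3 → ℝ} {g : E3 × S2 → ℝ} (hS : Measurable S)
    (hg : Measurable g) : Measurable (raySolution Ω S g) := by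
  have h1 : Measurable fun p : Unit × E3 => (fun _ : Unit => S) p.1 p.2 := hS.comp measurable_snd
  have h2 : Measurable fun p : Unit × E3 × S2 => (fun _ : Unit => g) p.1 p.2 :=
    hg.comp measurable_snd
  have h3 := hD.measurable_raySolution (S := fun _ : Unit => S) (g := fun _ : Unit => g) h1 h2
  have h4 : Measurable fun z : E3 × S2 => ((), z) := measurable_const.prodMk measurable_id
  have h5 := h3.comp h4
  exact h5

/-- The point at arclength `r` on a chord traces back to the start `z` with transit length `r`. No
restriction on `r` is imposed, so the same formula gives the inflow value at `r = 0` and the outflow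
value at the end of the chord. -/
theorem raySolution_chordMap (S : E3 → ℝ) (g : E3 × S2 → ℝ) {z : E3 × S2}
    (hz : z.1 ∈ inflowPart Ω (z.2 : E3)) (r : ℝ) :
    raySolution Ω S g (chordMap (z, r)) = chordValue S g z r := by
  have hβ : ‖(z.2 : E3)‖ = 1 := by simp
  have hβ' : ‖-(z.2 : E3)‖ = 1 := by simp
  obtain ⟨s, hs⟩ := hD.exists_mem_of_inflow hz
  have hne : ∃ s : ℝ, z.1 + s • -(z.2 : E3) ∈ Ω := ⟨-s, by simpa using hs⟩
  have e : z.1 + r • (z.2 : E3) = z.1 + (-r) • -(z.2 : E3) := by simp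
  have h0 := hD.exitTime_neg_of_inflow hβ hz
  have e1 : transitLength Ω (chordMap (z, r)) = r := by
    change exitTime Ω (z.1 + r • (z.2 : E3)) (-(z.2 : E3)) = r
    rw [e, exitTime_add_smul hD.bounded hβ' hne, h0]; simp
  have e2 : chordStart Ω (chordMap (z, r)) = z := by
    change (exitPoint Ω (z.1 + r • (z.2 : E3)) (-(z.2 : E3)), z.2) = z
    rw [e, exitPoint_add_smul hD.bounded hβ' hne, exitPoint, h0]; simp
  rw [raySolution, e1, e2]

theorem raySolution_inflow (S : E3 → ℝ) (g : E3 × S2 → ℝ) {z : E3 × S2}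
    (hz : z.1 ∈ inflowPart Ω (z.2 : E3)) : raySolution Ω S g z = g z := by
  have h := hD.raySolution_chordMap S g hz 0
  have e : chordMap (z, 0) = z := by simp [chordMap]
  rwa [e, chordValue, chordSolution_zero] at h

omit hD in
theorem chordEnd_eq (z : E3 × S2) : chordEnd Ω z = chordMap (z, chordLength Ω z) := rfl

theorem chordLength_nonneg {z : E3 × S2} (hz : z.1 ∈ inflowPart Ω (z.2 : E3)) :
    0 ≤ chordLength Ω z := (hD.exitTime_pos_of_inflow (by simp) hz).le

theorem exists_chordLength_le : ∃ d : ℝ, 0 < d ∧ ∀ z : E3 × S2,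
    z.1 ∈ inflowPart Ω (z.2 : E3) → chordLength Ω z ≤ d := by
  obtain ⟨R, hR⟩ := hD.bounded.closure.exists_norm_le
  refine ⟨2 * |R| + 1, by positivity, fun z hz => ?_⟩
  have hβ : ‖(z.2 : E3)‖ = 1 := by simp
  refine csSup_le (hD.exists_mem_of_inflow hz) fun s hs => ?_
  have h1 := hR _ (subset_closure hs)
  have h2 := hR _ (frontier_subset_closure hz.1)
  have h3 : ‖s • (z.2 : E3)‖ ≤ ‖z.1 + s • (z.2 : E3)‖ + ‖z.1‖ := by
    calc ‖s • (z.2 : E3)‖ = ‖(z.1 + s • (z.2 : E3)) - z.1‖ := by rw [add_sub_cancel_left]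
      _ ≤ _ := norm_sub_le _ _
  rw [norm_smul, hβ, mul_one, Real.norm_eq_abs] at h3
  linarith [le_abs_self s, le_abs_self R]

theorem lintegral_phase {F : E3 × S2 → ℝ≥0∞} (hF : Measurable F) :
    ∫⁻ z, F z ∂(phaseMeasure Ω) = ∫⁻ z, ∫⁻ s in Ioo 0 (chordLength Ω z), F (chordMap (z, s))
      ∂volume ∂(inflowMeasure Ω) := by
  rw [← hD.map_chordMap, lintegral_map hF measurable_chordMap,
    hD.lintegral_chordMeasure (F := fun q => F (chordMap q)) (hF.comp measurable_chordMap)]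

theorem integral_phase {F : E3 × S2 → ℝ} (hF : Integrable F (phaseMeasure Ω)) :
    Integrable (fun z => ∫ s in Ioo 0 (chordLength Ω z), F (chordMap (z, s))) (inflowMeasure Ω) ∧
    ∫ z, F z ∂(phaseMeasure Ω) =
      ∫ z, ∫ s in Ioo 0 (chordLength Ω z), F (chordMap (z, s)) ∂volume ∂(inflowMeasure Ω) := by
  have := hD.isFiniteMeasure_inflow
  rw [← hD.map_chordMap] at hF ⊢
  rw [integral_map measurable_chordMap.aemeasurable hF.1]
  have h1 := hF.comp_measurable measurable_chordMap
  rw [chordMeasure] at h1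
  rw [chordMeasure, ← integral_indicator hD.measurableSet_chord]
  have h2 := (integrable_indicator_iff hD.measurableSet_chord).2 h1
  have e (z : E3 × S2) : ∫ s in Ioo 0 (chordLength Ω z), F (chordMap (z, s)) =
      ∫ s, {q : (E3 × S2) × ℝ | q.2 ∈ Ioo 0 (chordLength Ω q.1)}.indicator (F ∘ chordMap) (z, s) := by
    rw [← integral_indicator measurableSet_Ioo]
    rfl
  simp only [e]
  exact ⟨h2.integral_prod_left, integral_prod _ h2⟩

theorem lintegral_chord_sq_lt_top {S : E3 → ℝ} (hS : Measurable S)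
    (hS2 : ∫⁻ z, ‖S z.1‖ₑ ^ 2 ∂(phaseMeasure Ω) < ⊤) :
    ∀ᵐ z ∂(inflowMeasure Ω),
      IntegrableOn (fun s : ℝ => S (z.1 + s • (z.2 : E3))) (Ioo 0 (chordLength Ω z)) := by
  have := hD.isFiniteMeasure_inflow
  have hF : Measurable fun z : E3 × S2 => ‖S z.1‖ₑ ^ 2 := by fun_prop
  rw [hD.lintegral_phase hF] at hS2
  have hm : Measurable fun z : E3 × S2 =>
      ∫⁻ s in Ioo 0 (chordLength Ω z), ‖S (chordMap (z, s)).1‖ₑ ^ 2 := by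
    have h : Measurable fun q : (E3 × S2) × ℝ =>
        {q : (E3 × S2) × ℝ | q.2 ∈ Ioo 0 (chordLength Ω q.1)}.indicator
          (fun q => ‖S (chordMap q).1‖ₑ ^ 2) q :=
      (hF.comp measurable_chordMap).indicator hD.measurableSet_chord
    convert h.lintegral_prod_right' (ν := volume) using 2 with z
    rw [← lintegral_indicator measurableSet_Ioo]
    rfl
  filter_upwards [ae_lt_top hm hS2.ne] with z hz
  have hmz : Measurable fun s : ℝ => S (z.1 + s • (z.2 : E3)) := hS.comp (by fun_prop)
  have := (memLp_two_iff_lintegral (μ := volume.restrict (Ioo 0 (chordLength Ω z)))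
    hmz.aestronglyMeasurable).2 hz
  exact this.integrable (by norm_num)

section bounds
variable {S₁ S₂ : E3 → ℝ} {g₁ g₂ : E3 × S2 → ℝ} {d : ℝ}

theorem ae_chordValue_sub_le (hd : ∀ z : E3 × S2, z.1 ∈ inflowPart Ω (z.2 : E3) →
    chordLength Ω z ≤ d) (hS₁ : Measurable S₁) (hS₂ : Measurable S₂)
    (h₁ : ∫⁻ z, ‖S₁ z.1‖ₑ ^ 2 ∂(phaseMeasure Ω) < ⊤)
    (h₂ : ∫⁻ z, ‖S₂ z.1‖ₑ ^ 2 ∂(phaseMeasure Ω) < ⊤) :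
    ∀ᵐ z ∂(inflowMeasure Ω), ∀ r ∈ Icc 0 (chordLength Ω z),
      ‖chordValue S₁ g₁ z r - chordValue S₂ g₂ z r‖ₑ ^ 2 ≤ 2 * (‖g₁ z - g₂ z‖ₑ ^ 2 +
        ENNReal.ofReal d * ∫⁻ s in Ioo 0 (chordLength Ω z),
          ‖S₁ (chordMap (z, s)).1 - S₂ (chordMap (z, s)).1‖ₑ ^ 2) := by
  filter_upwards [hD.ae_inflow_mem, hD.lintegral_chord_sq_lt_top hS₁ h₁,
    hD.lintegral_chord_sq_lt_top hS₂ h₂] with z hz i₁ i₂ r hr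
  rw [chordValue, chordValue, chordSolution_sub hr.2 i₁ i₂]
  exact enorm_chordSolution_sq_le _ hr.1 hr.2 (hd z hz)
    ((hS₁.comp (by fun_prop)).sub (hS₂.comp (by fun_prop)))

omit hD in
theorem lintegral_two_mul_add (hm : Measurable fun z => ‖g₁ z - g₂ z‖ₑ ^ 2) (μ : Measure (E3 × S2))
    (B : E3 × S2 → ℝ≥0∞) (c : ℝ≥0∞) (hc : c ≠ ⊤) :
    ∫⁻ z, 2 * (‖g₁ z - g₂ z‖ₑ ^ 2 + c * B z) ∂μ =
      2 * (∫⁻ z, ‖g₁ z - g₂ z‖ₑ ^ 2 ∂μ + c * ∫⁻ z, B z ∂μ) := by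
  rw [lintegral_const_mul' _ _ (by simp), lintegral_add_left hm, lintegral_const_mul' _ _ hc]

theorem lintegral_raySolution_sub_le (hd : ∀ z : E3 × S2, z.1 ∈ inflowPart Ω (z.2 : E3) →
    chordLength Ω z ≤ d) (hS₁ : Measurable S₁) (hS₂ : Measurable S₂) (hg₁ : Measurable g₁)
    (hg₂ : Measurable g₂) (h₁ : ∫⁻ z, ‖S₁ z.1‖ₑ ^ 2 ∂(phaseMeasure Ω) < ⊤)
    (h₂ : ∫⁻ z, ‖S₂ z.1‖ₑ ^ 2 ∂(phaseMeasure Ω) < ⊤) :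
    ∫⁻ z, ‖raySolution Ω S₁ g₁ z - raySolution Ω S₂ g₂ z‖ₑ ^ 2 ∂(phaseMeasure Ω) ≤
      ENNReal.ofReal d * (2 * (∫⁻ z, ‖g₁ z - g₂ z‖ₑ ^ 2 ∂(inflowMeasure Ω) +
        ENNReal.ofReal d * ∫⁻ z, ‖S₁ z.1 - S₂ z.1‖ₑ ^ 2 ∂(phaseMeasure Ω))) := by
  have hm₁ := hD.measurable_raySolution' hS₁ hg₁
  have hm₂ := hD.measurable_raySolution' hS₂ hg₂
  have hm : Measurable fun z => ‖raySolution Ω S₁ g₁ z - raySolution Ω S₂ g₂ z‖ₑ ^ 2 :=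
    (hm₁.sub hm₂).enorm.pow_const 2
  rw [hD.lintegral_phase hm,
    hD.lintegral_phase (F := fun z => ‖S₁ z.1 - S₂ z.1‖ₑ ^ 2) (by fun_prop),
    ← lintegral_two_mul_add (by fun_prop) _ _ _ (by simp), ← lintegral_const_mul' _ _ (by simp)]
  refine lintegral_mono_ae ?_
  filter_upwards [hD.ae_inflow_mem, hD.ae_chordValue_sub_le (g₁ := g₁) (g₂ := g₂) hd hS₁ hS₂ h₁ h₂]
    with z hz hle
  set M : ℝ≥0∞ := 2 * (‖g₁ z - g₂ z‖ₑ ^ 2 +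
    ENNReal.ofReal d * ∫⁻ s in Ioo 0 (chordLength Ω z),
      ‖S₁ (chordMap (z, s)).1 - S₂ (chordMap (z, s)).1‖ₑ ^ 2) with hM
  refine (setLIntegral_mono' (g := fun _ => M) measurableSet_Ioo fun s hs => ?_).trans ?_
  · rw [hD.raySolution_chordMap _ _ hz, hD.raySolution_chordMap _ _ hz]
    exact hle s ⟨hs.1.le, hs.2.le⟩
  · rw [setLIntegral_const, Real.volume_Ioo, sub_zero, mul_comm]
    gcongr
    exact hd z hz

/-- The end-point map carries the inflow measure to the outflow measure, so the outflow trace is the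
chordwise bound evaluated at the last point. There is no integration in arclength, hence no outer
factor `d`. -/
theorem lintegral_raySolution_sub_outflow_le (hd : ∀ z : E3 × S2, z.1 ∈ inflowPart Ω (z.2 : E3) →
    chordLength Ω z ≤ d) (hS₁ : Measurable S₁) (hS₂ : Measurable S₂) (hg₁ : Measurable g₁)
    (hg₂ : Measurable g₂) (h₁ : ∫⁻ z, ‖S₁ z.1‖ₑ ^ 2 ∂(phaseMeasure Ω) < ⊤)
    (h₂ : ∫⁻ z, ‖S₂ z.1‖ₑ ^ 2 ∂(phaseMeasure Ω) < ⊤) :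
    ∫⁻ z, ‖raySolution Ω S₁ g₁ z - raySolution Ω S₂ g₂ z‖ₑ ^ 2 ∂(outflowMeasure Ω) ≤
      2 * (∫⁻ z, ‖g₁ z - g₂ z‖ₑ ^ 2 ∂(inflowMeasure Ω) +
        ENNReal.ofReal d * ∫⁻ z, ‖S₁ z.1 - S₂ z.1‖ₑ ^ 2 ∂(phaseMeasure Ω)) := by
  have hm₁ := hD.measurable_raySolution' hS₁ hg₁
  have hm₂ := hD.measurable_raySolution' hS₂ hg₂
  have hm : Measurable fun z => ‖raySolution Ω S₁ g₁ z - raySolution Ω S₂ g₂ z‖ₑ ^ 2 :=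
    (hm₁.sub hm₂).enorm.pow_const 2
  rw [← hD.map_chordEnd, lintegral_map hm hD.measurable_chordEnd,
    hD.lintegral_phase (F := fun z => ‖S₁ z.1 - S₂ z.1‖ₑ ^ 2) (by fun_prop),
    ← lintegral_two_mul_add (by fun_prop) _ _ _ (by simp)]
  refine lintegral_mono_ae ?_
  filter_upwards [hD.ae_inflow_mem, hD.ae_chordValue_sub_le (g₁ := g₁) (g₂ := g₂) hd hS₁ hS₂ h₁ h₂]
    with z hz hle
  rw [chordEnd_eq, hD.raySolution_chordMap _ _ hz, hD.raySolution_chordMap _ _ hz]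
  exact hle _ ⟨hD.chordLength_nonneg hz, le_rfl⟩

end bounds

end IsC2ConvexDomain

/-! ### Green's formula -/

open Filter Topology Module

theorem raySolution_zero (Ω : Set E3) : raySolution Ω (fun _ => 0) (fun _ => 0) = fun _ => 0 := by
  funext z
  simp [raySolution, chordValue, chordSolution]

theorem hasDerivAt_chordMap {φ : E3 × E3 → ℝ} (hφ : ContDiff ℝ ∞ φ) (z : E3 × S2) (r : ℝ) :
    HasDerivAt (fun r : ℝ => φ ((chordMap (z, r)).1, ((chordMap (z, r)).2 : E3)))
      (transportDeriv φ (chordMap (z, r))) r := by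
  have h1 : HasDerivAt (fun r : ℝ => z.1 + r • (z.2 : E3)) (z.2 : E3) r := by
    simpa using ((hasDerivAt_id r).smul_const (z.2 : E3)).const_add z.1
  have hd : Differentiable ℝ fun x => φ (x, (z.2 : E3)) :=
    (hφ.differentiable (by simp)).comp (by fun_prop)
  exact (hd (z.1 + r • (z.2 : E3))).hasFDerivAt.comp_hasDerivAt r h1

theorem transportDeriv_eq {φ : E3 × E3 → ℝ} (hφ : ContDiff ℝ ∞ φ) (z : E3 × S2) :
    transportDeriv φ z = fderiv ℝ φ (z.1, (z.2 : E3)) ((z.2 : E3), 0) := by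
  have hd : DifferentiableAt ℝ φ (z.1, (z.2 : E3)) := (hφ.differentiable (by simp)) _
  have h1 : HasFDerivAt (fun x : E3 => (x, (z.2 : E3)))
      ((ContinuousLinearMap.id ℝ E3).prod 0) z.1 :=
    (hasFDerivAt_id z.1).prodMk (hasFDerivAt_const _ _)
  have := (hd.hasFDerivAt.comp z.1 h1).fderiv
  rw [transportDeriv]
  change fderiv ℝ (φ ∘ fun x : E3 => (x, (z.2 : E3))) z.1 _ = _
  rw [this]
  simp

theorem continuous_transportDeriv {φ : E3 × E3 → ℝ} (hφ : ContDiff ℝ ∞ φ) :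
    Continuous (transportDeriv φ) := by
  have : transportDeriv φ = fun z => fderiv ℝ φ (z.1, (z.2 : E3)) ((z.2 : E3), 0) :=
    funext (transportDeriv_eq hφ)
  rw [this]
  have h1 : Continuous fun z : E3 × S2 => fderiv ℝ φ (z.1, (z.2 : E3)) :=
    (hφ.continuous_fderiv (by simp)).comp (by fun_prop)
  exact h1.clm_apply (by fun_prop)

theorem exists_bound_test {φ : E3 × E3 → ℝ} (hφ : ContDiff ℝ ∞ φ) (hc : HasCompactSupport φ) :
    ∃ C : ℝ, (∀ z : E3 × S2, ‖φ (z.1, (z.2 : E3))‖ ≤ C) ∧ ∀ z, ‖transportDeriv φ z‖ ≤ C := by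
  obtain ⟨C₁, h₁⟩ := hφ.continuous.bounded_above_of_compact_support hc
  obtain ⟨C₂, h₂⟩ := (hφ.continuous_fderiv (by simp)).bounded_above_of_compact_support
    (hc.fderiv (𝕜 := ℝ))
  refine ⟨max C₁ C₂, fun z => (h₁ _).trans (le_max_left _ _), fun z => ?_⟩
  rw [transportDeriv_eq hφ]
  refine (ContinuousLinearMap.le_opNorm _ _).trans ?_
  have : ‖((z.2 : E3), (0 : E3))‖ = 1 := by simp
  rw [this, mul_one]
  exact (h₂ _).trans (le_max_right _ _)

section
variable {μ : Measure (E3 × S2)} {v : E3 × S2 → ℝ} {φ : E3 × E3 → ℝ}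

theorem integrable_mul_testFunction (hv : Integrable v μ) (hφ : ContDiff ℝ ∞ φ)
    (hc : HasCompactSupport φ) : Integrable (fun z => v z * φ (z.1, (z.2 : E3))) μ := by
  obtain ⟨C, h, -⟩ := exists_bound_test hφ hc
  have hm : Continuous fun z : E3 × S2 => φ (z.1, (z.2 : E3)) := hφ.continuous.comp (by fun_prop)
  exact hv.mul_bdd hm.aestronglyMeasurable (ae_of_all _ h)

theorem integrable_mul_transportDeriv (hv : Integrable v μ) (hφ : ContDiff ℝ ∞ φ)
    (hc : HasCompactSupport φ) : Integrable (fun z => v z * transportDeriv φ z) μ := by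
  obtain ⟨C, -, h⟩ := exists_bound_test hφ hc
  exact hv.mul_bdd (continuous_transportDeriv hφ).aestronglyMeasurable (ae_of_all _ h)

end

namespace IsC2ConvexDomain

variable {Ω : Set E3} (hD : IsC2ConvexDomain Ω)
include hD

/-- A test function supported over the open set `Ω` vanishes at boundary points, so the boundary
term of Green's formula drops out. -/
theorem isWeakTransportDeriv_of_isTrace {v D γ : E3 × S2 → ℝ} (h : IsTrace Ω v D γ) :
    IsWeakTransportDeriv Ω v D := by
  intro φ hφ hc hs
  have h1 := h.2 φ hφ hc
  have h2 : ∫ z, normalFlux Ω z * γ z * φ (z.1, (z.2 : E3)) ∂(boundaryMeasure Ω) = 0 := by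
    refine integral_eq_zero_of_ae ?_
    filter_upwards [hD.ae_boundary_mem] with z hz
    have : φ (z.1, (z.2 : E3)) = 0 := by
      by_contra hne
      have h3 := hs (subset_tsupport φ hne)
      rw [hD.isOpen.frontier_eq] at hz
      exact hz.2 h3.1
    rw [this, mul_zero]; rfl
  rw [h2] at h1
  linarith

variable {S : E3 → ℝ} {g : E3 × S2 → ℝ}

theorem lintegral_raySolution_le {d : ℝ} (hd : ∀ z : E3 × S2, z.1 ∈ inflowPart Ω (z.2 : E3) →
    chordLength Ω z ≤ d) (hS : Measurable S) (hg : Measurable g)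
    (h : ∫⁻ z, ‖S z.1‖ₑ ^ 2 ∂(phaseMeasure Ω) < ⊤) :
    ∫⁻ z, ‖raySolution Ω S g z‖ₑ ^ 2 ∂(phaseMeasure Ω) ≤
      ENNReal.ofReal d * (2 * (∫⁻ z, ‖g z‖ₑ ^ 2 ∂(inflowMeasure Ω) +
        ENNReal.ofReal d * ∫⁻ z, ‖S z.1‖ₑ ^ 2 ∂(phaseMeasure Ω))) := by
  have := hD.lintegral_raySolution_sub_le hd hS (measurable_const (a := (0 : ℝ))) hg
    (measurable_const (a := (0 : ℝ))) h (by simp)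
  simpa [raySolution_zero] using this

theorem lintegral_raySolution_outflow_le {d : ℝ}
    (hd : ∀ z : E3 × S2, z.1 ∈ inflowPart Ω (z.2 : E3) →
    chordLength Ω z ≤ d) (hS : Measurable S) (hg : Measurable g)
    (h : ∫⁻ z, ‖S z.1‖ₑ ^ 2 ∂(phaseMeasure Ω) < ⊤) :
    ∫⁻ z, ‖raySolution Ω S g z‖ₑ ^ 2 ∂(outflowMeasure Ω) ≤
      2 * (∫⁻ z, ‖g z‖ₑ ^ 2 ∂(inflowMeasure Ω) +
        ENNReal.ofReal d * ∫⁻ z, ‖S z.1‖ₑ ^ 2 ∂(phaseMeasure Ω)) := by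
  have := hD.lintegral_raySolution_sub_outflow_le hd hS (measurable_const (a := (0 : ℝ))) hg
    (measurable_const (a := (0 : ℝ))) h (by simp)
  simpa [raySolution_zero] using this

/-- Both sides disintegrate over chords. The phase-space integrals become arclength integrals, the
boundary integral becomes the value at the end minus the value at the start, and on almost every
chord the identity is `integral_chordSolution`. -/
theorem isTrace_raySolution (hS : Measurable S) (hg : Measurable g)
    (hS2 : ∫⁻ z, ‖S z.1‖ₑ ^ 2 ∂(phaseMeasure Ω) < ⊤)
    (hg2 : ∫⁻ z, ‖g z‖ₑ ^ 2 ∂(inflowMeasure Ω) < ⊤) :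
    IsTrace Ω (raySolution Ω S g) (fun z => S z.1 - raySolution Ω S g z) (raySolution Ω S g) := by
  have := hD.isFiniteMeasure_inflow
  have := hD.isFiniteMeasure_outflow
  have := hD.isFiniteMeasure_phase
  obtain ⟨d, -, hd⟩ := hD.exists_chordLength_le
  set I := raySolution Ω S g with hI
  have hIm : Measurable I := hD.measurable_raySolution' hS hg
  have hfin : ∫⁻ z, ‖g z‖ₑ ^ 2 ∂(inflowMeasure Ω) +
        ENNReal.ofReal d * ∫⁻ z, ‖S z.1‖ₑ ^ 2 ∂(phaseMeasure Ω) < ⊤ :=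
    ENNReal.add_lt_top.2 ⟨hg2, ENNReal.mul_lt_top (by simp) hS2⟩
  have hIp : Integrable I (phaseMeasure Ω) :=
    ((memLp_two_iff_lintegral hIm.aestronglyMeasurable).2
      ((hD.lintegral_raySolution_le hd hS hg hS2).trans_lt (ENNReal.mul_lt_top (by simp)
        (ENNReal.mul_lt_top (by simp) hfin)))).integrable (by norm_num)
  have hIo : Integrable I (outflowMeasure Ω) :=
    ((memLp_two_iff_lintegral hIm.aestronglyMeasurable).2
      ((hD.lintegral_raySolution_outflow_le hd hS hg hS2).trans_lt
        (ENNReal.mul_lt_top (by simp) hfin))).integrable (by norm_num)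
  have hIg : I =ᵐ[inflowMeasure Ω] g := by
    filter_upwards [hD.ae_inflow_mem] with z hz using hD.raySolution_inflow S g hz
  have hgi : Integrable g (inflowMeasure Ω) :=
    ((memLp_two_iff_lintegral hg.aestronglyMeasurable).2 hg2).integrable (by norm_num)
  have hIi : Integrable I (inflowMeasure Ω) := hgi.congr hIg.symm
  have hSp : Integrable (fun z : E3 × S2 => S z.1) (phaseMeasure Ω) :=
    ((memLp_two_iff_lintegral (hS.comp measurable_fst).aestronglyMeasurable).2 hS2).integrable
      (by norm_num)
  have hDp : Integrable (fun z => S z.1 - I z) (phaseMeasure Ω) := hSp.sub hIp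
  refine ⟨(hD.integrable_flux hIi hIo).1, fun φ hφ hc => ?_⟩
  have e (z : E3 × S2) : normalFlux Ω z * I z * φ (z.1, (z.2 : E3)) =
      normalFlux Ω z * (I z * φ (z.1, (z.2 : E3))) := by ring
  simp only [e]
  rw [(hD.integrable_flux (integrable_mul_testFunction hIi hφ hc)
    (integrable_mul_testFunction hIo hφ hc)).2,
    ← integral_add (integrable_mul_testFunction hDp hφ hc)
      (integrable_mul_transportDeriv hIp hφ hc)]
  have hint := (integrable_mul_testFunction hDp hφ hc).add
      (integrable_mul_transportDeriv hIp hφ hc)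
  have hgφ : Integrable (fun z => g z * φ (z.1, (z.2 : E3))) (inflowMeasure Ω) :=
    integrable_mul_testFunction hgi hφ hc
  have hoφ : Integrable (fun z => I z * φ (z.1, (z.2 : E3))) (outflowMeasure Ω) :=
    integrable_mul_testFunction hIo hφ hc
  have e2 : ∫ z, I z * φ (z.1, (z.2 : E3)) ∂(inflowMeasure Ω) =
      ∫ z, g z * φ (z.1, (z.2 : E3)) ∂(inflowMeasure Ω) :=
    integral_congr_ae (hIg.mono fun z hz => by simp only [hz])
  rw [← hD.map_chordEnd] at hoφ
  rw [e2, ← hD.map_chordEnd, integral_map hD.measurable_chordEnd.aemeasurable hoφ.1]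
  have hoφ' := hoφ.comp_measurable hD.measurable_chordEnd
  refine (hD.integral_phase hint).2.trans ?_
  refine Eq.trans ?_ (integral_sub hoφ' hgφ)
  refine integral_congr_ae ?_
  filter_upwards [hD.ae_inflow_mem, hD.lintegral_chord_sq_lt_top hS hS2] with z hz hi
  have key := integral_chordSolution (g z) (hD.chordLength_nonneg hz) hi
    (hasDerivAt_chordMap hφ z)
    ((continuous_transportDeriv hφ).comp (by unfold chordMap; fun_prop))
  have e3 : (chordMap (z, 0)) = z := by simp [chordMap]
  rw [e3] at key
  simp only [chordEnd_eq]
  rw [hI, hD.raySolution_chordMap S g hz, chordValue, ← key]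
  refine setIntegral_congr_fun measurableSet_Ioo fun s hs => ?_
  simp only [Pi.add_apply, hD.raySolution_chordMap S g hz, chordValue]
  rfl

end IsC2ConvexDomain

/-! ### Uniqueness: the adjoint test function -/

open Filter Topology Module

/-- The solution of the adjoint equation `β·∇φ - φ = ψ` (for long enough rays). -/
def adjointTest (R : ℝ) (ψ : E3 × E3 → ℝ) (p : E3 × E3) : ℝ :=
  -∫ s in (0 : ℝ)..R, Real.exp (-s) * ψ (p.1 + s • p.2, p.2)

section
variable {R : ℝ} {ψ : E3 × E3 → ℝ}

/-- The integral is a convolution, evaluated at `0`, of `exp (-s)` cut off to `(0, R]` with a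
function depending smoothly on the parameter `p`. The bump `η` gives that function compact support
and equals one on the range of integration, so it does not change the value. -/
theorem contDiff_adjointTest (hR : 0 < R) (hψ : ContDiff ℝ ∞ ψ) :
    ContDiff ℝ ∞ (adjointTest R ψ) := by
  let η : ContDiffBump (0 : ℝ) := ⟨R, R + 1, hR, by linarith⟩
  set f : ℝ → ℝ := (Ioc 0 R).indicator fun s => Real.exp (-s) with hf
  set g : E3 × E3 → ℝ → ℝ := fun p u => η u * ψ (p.1 + (-u) • p.2, p.2) with hg
  have hfi : LocallyIntegrable f := by
    refine Integrable.locallyIntegrable ((integrable_indicator_iff measurableSet_Ioc).2 ?_)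
    exact (Continuous.integrableOn_Icc (by fun_prop)).mono_set Ioc_subset_Icc_self
  have hgC : ContDiff ℝ ∞ ↿g := by
    have h1 : ContDiff ℝ ∞ fun q : (E3 × E3) × ℝ => η q.2 := η.contDiff.comp contDiff_snd
    have h2 : ContDiff ℝ ∞ fun q : (E3 × E3) × ℝ => ψ (q.1.1 + (-q.2) • q.1.2, q.1.2) :=
      hψ.comp (by fun_prop)
    exact h1.mul h2
  have key := contDiffOn_convolution_right_with_param_comp (n := ⊤)
    (ContinuousLinearMap.mul ℝ ℝ) (s := (univ : Set (E3 × E3)))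
    (v := fun _ => (0 : ℝ)) contDiffOn_const (g := g) isOpen_univ
    (isCompact_closedBall (0 : ℝ) (R + 1)) (fun p u _ hu => by
      have : η u = 0 := η.zero_of_le_dist (by
        rw [Metric.mem_closedBall, not_le] at hu
        exact hu.le)
      simp [hg, this]) hfi hgC.contDiffOn
  rw [contDiffOn_univ] at key
  have e : adjointTest R ψ =
      fun p => -convolution f (g p) (ContinuousLinearMap.mul ℝ ℝ) volume 0 := by
    funext p
    rw [adjointTest, convolution_def, intervalIntegral.integral_of_le hR.le,
      ← integral_indicator measurableSet_Ioc]
    congr 2 with s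
    by_cases hs : s ∈ Ioc 0 R
    · have : η (0 - s) = 1 := η.one_of_mem_closedBall (by
        rw [Metric.mem_closedBall, dist_zero_right, zero_sub, norm_neg, Real.norm_eq_abs,
          abs_of_pos hs.1]
        exact hs.2)
      simp only [hf, hg, indicator_of_mem hs, ContinuousLinearMap.mul_apply', this]
      simp
    · simp [hf, indicator_of_notMem hs]
  rw [e]
  exact key.neg

theorem hasCompactSupport_adjointTest (hR : 0 < R) (hψ : HasCompactSupport ψ) :
    HasCompactSupport (adjointTest R ψ) := by
  obtain ⟨ρ, hρ⟩ := hψ.isBounded.exists_norm_le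
  have hb (p : E3 × E3) (hp : ψ p ≠ 0) : ‖p.1‖ ≤ |ρ| ∧ ‖p.2‖ ≤ |ρ| := by
    have h := (hρ p (subset_tsupport ψ hp)).trans (le_abs_self ρ)
    exact ⟨(norm_fst_le p).trans h, (norm_snd_le p).trans h⟩
  refine HasCompactSupport.of_support_subset_isCompact
    (isCompact_closedBall (0 : E3 × E3) (|ρ| + R * |ρ|)) fun p hp => ?_
  by_contra hcon
  apply hp
  have h0 : ∀ s ∈ uIcc 0 R, Real.exp (-s) * ψ (p.1 + s • p.2, p.2) = 0 := by
    intro s hs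
    rw [uIcc_of_le hR.le] at hs
    by_contra hne
    obtain ⟨h1, h2⟩ := hb _ (right_ne_zero_of_mul hne)
    simp only at h1 h2
    apply hcon
    rw [Metric.mem_closedBall, dist_zero_right, Prod.norm_def]
    have h3 : ‖s • p.2‖ ≤ R * |ρ| := by
      rw [norm_smul, Real.norm_eq_abs, abs_of_nonneg hs.1]
      exact mul_le_mul hs.2 h2 (norm_nonneg _) hR.le
    have h4 : ‖p.1‖ ≤ ‖p.1 + s • p.2‖ + ‖s • p.2‖ := by
      calc ‖p.1‖ = ‖(p.1 + s • p.2) - s • p.2‖ := by rw [add_sub_cancel_right]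
        _ ≤ _ := norm_sub_le _ _
    refine max_le (by linarith) (h2.trans ?_)
    nlinarith [abs_nonneg ρ]
  rw [adjointTest, intervalIntegral.integral_congr h0]
  simp

/-- Along the ray the function is `-exp r * ∫ s in r..(R + r), h s`. Differentiating at `r = 0`
returns the function itself, plus `ψ` at the near end, minus a multiple of `ψ` at the far end; the
last vanishes by `h0`. -/
theorem transportDeriv_adjointTest (hR : 0 < R) (hψ : ContDiff ℝ ∞ ψ) {z : E3 × S2}
    (h0 : ψ (z.1 + R • (z.2 : E3), (z.2 : E3)) = 0) :
    transportDeriv (adjointTest R ψ) z =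
      adjointTest R ψ (z.1, (z.2 : E3)) + ψ (z.1, (z.2 : E3)) := by
  have h1 := hasDerivAt_chordMap (contDiff_adjointTest hR hψ) z 0
  set h : ℝ → ℝ := fun s => Real.exp (-s) * ψ (z.1 + s • (z.2 : E3), (z.2 : E3)) with hh
  have hc : Continuous h := by
    have := hψ.continuous
    fun_prop
  have hi (a b : ℝ) : IntervalIntegrable h volume a b := hc.intervalIntegrable a b
  have e (r : ℝ) : adjointTest R ψ ((chordMap (z, r)).1, ((chordMap (z, r)).2 : E3)) =
      -(Real.exp r * ((∫ s in (0 : ℝ)..(R + r), h s) - ∫ s in (0 : ℝ)..r, h s)) := by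
    rw [intervalIntegral.integral_interval_sub_left (hi _ _) (hi _ _), adjointTest,
      ← intervalIntegral.integral_const_mul]
    have := intervalIntegral.integral_comp_add_left (a := 0) (b := R)
      (fun s => Real.exp r * h s) r
    rw [add_zero, add_comm r R] at this
    rw [← this]
    congr 1
    refine intervalIntegral.integral_congr fun s _ => ?_
    simp only [hh, chordMap, ← mul_assoc, ← Real.exp_add]
    congr 2
    · ring
    · rw [add_smul]; simp [add_assoc]
  have hd1 : HasDerivAt (fun r : ℝ => ∫ s in (0 : ℝ)..(R + r), h s) (h (R + 0)) 0 :=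
    HasDerivAt.comp_const_add R 0 (hc.integral_hasStrictDerivAt 0 (R + 0)).hasDerivAt
  have hd2 : HasDerivAt (fun r : ℝ => ∫ s in (0 : ℝ)..r, h s) (h 0) 0 :=
    (hc.integral_hasStrictDerivAt 0 0).hasDerivAt
  have hd3 := ((Real.hasDerivAt_exp 0).mul (hd1.sub hd2)).neg
  have h2 := h1.congr_of_eventuallyEq (Eventually.of_forall fun r => (e r).symm)
  have h3 := h2.unique hd3
  have e4 : (chordMap (z, 0)) = z := by simp [chordMap]
  rw [e4] at h3
  rw [h3, adjointTest]
  have hR0 : h (R + 0) = 0 := by rw [add_zero, hh]; simp only; rw [h0, mul_zero]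
  have h00 : h 0 = ψ (z.1, (z.2 : E3)) := by simp [hh]
  simp only [hR0, h00, Pi.sub_apply]
  simp
  ring

end

namespace IsC2ConvexDomain

variable {Ω : Set E3} (hD : IsC2ConvexDomain Ω)
include hD

theorem exists_length_notMem : ∃ R : ℝ, 0 < R ∧ ∀ z : E3 × S2, z.1 ∈ Ω →
    z.1 + R • (z.2 : E3) ∉ Ω := by
  obtain ⟨ρ, hρ⟩ := hD.bounded.exists_norm_le
  refine ⟨2 * |ρ| + 1, by positivity, fun z hz hz' => ?_⟩
  have hβ : ‖(z.2 : E3)‖ = 1 := by simp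
  have h1 := hρ _ hz
  have h2 := hρ _ hz'
  have h3 : ‖(2 * |ρ| + 1) • (z.2 : E3)‖ ≤ ‖z.1 + (2 * |ρ| + 1) • (z.2 : E3)‖ + ‖z.1‖ := by
    calc ‖(2 * |ρ| + 1) • (z.2 : E3)‖ = ‖(z.1 + (2 * |ρ| + 1) • (z.2 : E3)) - z.1‖ := by
          rw [add_sub_cancel_left]
      _ ≤ _ := norm_sub_le _ _
  rw [norm_smul, hβ, mul_one, Real.norm_eq_abs, abs_of_pos (by positivity)] at h3
  linarith [le_abs_self ρ]

theorem adjointTest_outflow {R : ℝ} (hR : 0 < R) {ψ : E3 × E3 → ℝ}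
    (hs : tsupport ψ ⊆ Ω ×ˢ univ) {z : E3 × S2} (hz : z ∈ outflowBoundary Ω) :
    adjointTest R ψ (z.1, (z.2 : E3)) = 0 := by
  rw [adjointTest, intervalIntegral.integral_congr (g := fun _ => 0)]
  · simp
  · intro s hs'
    rw [uIcc_of_le hR.le] at hs'
    have h1 := notMem_of_outflow hD.isOpen hD.convex hD.c2 hz.1 hz.2 hs'.1
    have : ψ (z.1 + s • (z.2 : E3), (z.2 : E3)) = 0 := by
      by_contra hne
      exact h1 (hs (subset_tsupport ψ hne)).1
    simp [this]

theorem ae_eq_of_ae_inflow {γ₁ γ₂ : E3 × S2 → ℝ} (hγ : ∀ᵐ z ∂(inflowMeasure Ω), γ₁ z = γ₂ z) :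
    ∀ᵐ z ∂(boundaryMeasure Ω), z ∈ inflowBoundary Ω → γ₁ z = γ₂ z := by
  have hmn : Measurable fun z => ENNReal.ofReal (-normalFlux Ω z) :=
    hD.measurable_flux.neg.ennreal_ofReal
  rw [inflowMeasure, ae_withDensity_iff hmn, ae_restrict_iff' hD.measurableSet_inflowBoundary] at hγ
  filter_upwards [hγ] with z hz hm
  refine hz hm ?_
  rw [Ne, ENNReal.ofReal_eq_zero, not_le]
  linarith [hm.2]

/-- A solution of the transport equation is determined by its source and its inflow trace. -/
theorem ae_eq_of_isTrace {v₁ v₂ D₁ D₂ γ₁ γ₂ : E3 × S2 → ℝ}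
    (hv₁ : Integrable v₁ (phaseMeasure Ω)) (hv₂ : Integrable v₂ (phaseMeasure Ω))
    (hD₁ : Integrable D₁ (phaseMeasure Ω)) (hD₂ : Integrable D₂ (phaseMeasure Ω))
    (h₁ : IsTrace Ω v₁ D₁ γ₁) (h₂ : IsTrace Ω v₂ D₂ γ₂)
    (hS : ∀ᵐ z ∂(phaseMeasure Ω), v₁ z + D₁ z = v₂ z + D₂ z)
    (hγ : ∀ᵐ z ∂(inflowMeasure Ω), γ₁ z = γ₂ z) :
    ∀ᵐ z ∂(phaseMeasure Ω), v₁ z = v₂ z := by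
  obtain ⟨R, hR, hRΩ⟩ := hD.exists_length_notMem
  have := hD.isFiniteMeasure_volume
  have hmem : ∀ᵐ z ∂(phaseMeasure Ω), z.1 ∈ Ω :=
    Measure.quasiMeasurePreserving_fst.ae (ae_restrict_mem hD.isOpen.measurableSet)
  set w : E3 × S2 → ℝ := fun z => v₁ z - v₂ z with hw
  have hwi : Integrable w (phaseMeasure Ω) := hv₁.sub hv₂
  have key (ψ : E3 × E3 → ℝ) (hψ : ContDiff ℝ ∞ ψ) (hψc : HasCompactSupport ψ)
      (hψs : tsupport ψ ⊆ Ω ×ˢ univ) :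
      ∫ z, w z * ψ (z.1, (z.2 : E3)) ∂(phaseMeasure Ω) = 0 := by
    set φ := adjointTest R ψ with hφ
    have hφC := contDiff_adjointTest hR hψ
    have hφc := hasCompactSupport_adjointTest hR hψc
    have e₁ := h₁.2 φ hφC hφc
    have e₂ := h₂.2 φ hφC hφc
    have eb : ∫ z, normalFlux Ω z * γ₁ z * φ (z.1, (z.2 : E3)) ∂(boundaryMeasure Ω) =
        ∫ z, normalFlux Ω z * γ₂ z * φ (z.1, (z.2 : E3)) ∂(boundaryMeasure Ω) := by
      refine integral_congr_ae ?_
      -- The boundary integrands agree for three different reasons: equal traces where the flux is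
      -- negative, zero flux where it vanishes, and a vanishing test function where it is positive.
      filter_upwards [hD.ae_boundary_mem, hD.ae_eq_of_ae_inflow hγ] with z hz hzγ
      rcases lt_trichotomy (normalFlux Ω z) 0 with h | h | h
      · simp only [hzγ ⟨hz, h⟩]
      · simp only [h, zero_mul]
      · simp only [hφ, hD.adjointTest_outflow hR hψs (z := z) ⟨hz, h⟩, mul_zero]
    rw [eb, ← e₂] at e₁
    have i₁ := integrable_mul_testFunction hD₁ hφC hφc
    have i₂ := integrable_mul_testFunction hD₂ hφC hφc
    have j₁ := integrable_mul_transportDeriv hv₁ hφC hφc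
    have j₂ := integrable_mul_transportDeriv hv₂ hφC hφc
    rw [← integral_add i₁ j₁, ← integral_add i₂ j₂, ← sub_eq_zero] at e₁
    refine Eq.trans (integral_congr_ae ?_) ((integral_sub (i₁.add j₁) (i₂.add j₂)).trans e₁)
    filter_upwards [hS, hmem] with z hz hzΩ
    have h0 : ψ (z.1 + R • (z.2 : E3), (z.2 : E3)) = 0 := by
      by_contra hne
      exact hRΩ z hzΩ (hψs (subset_tsupport ψ hne)).1
    simp only [Pi.add_apply, transportDeriv_adjointTest hR hψ h0, hw]
    linear_combination (-adjointTest R ψ (z.1, (z.2 : E3))) * hz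
  -- Test functions live on `ℝ³ × ℝ³`, so the difference is transported there through the closed
  -- embedding of the sphere, and the fundamental lemma of the calculus of variations is applied on
  -- `Ω × ℝ³` to the push-forward measure.
  let ι : E3 × S2 → E3 × E3 := fun z => (z.1, (z.2 : E3))
  have hι : MeasurableEmbedding ι := by
    have : Topology.IsClosedEmbedding ι :=
      Topology.IsClosedEmbedding.id.prodMap (Metric.isClosed_sphere.isClosedEmbedding_subtypeVal)
    exact this.measurableEmbedding
  set W : E3 × E3 → ℝ := Function.extend ι w 0 with hW
  have hWι (z : E3 × S2) : W (ι z) = w z := hι.injective.extend_apply _ _ z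
  have hWi : Integrable W ((phaseMeasure Ω).map ι) := by
    rw [hι.integrable_map_iff]
    exact hwi.congr (ae_of_all _ fun z => (hWι z).symm)
  have hfin := (hD.isOpen.prod isOpen_univ).ae_eq_zero_of_integral_contDiff_smul_eq_zero
    (U := Ω ×ˢ (univ : Set E3)) (hWi.locallyIntegrable.locallyIntegrableOn _) (by
      intro ψ hψ hψc hψs
      rw [hι.integral_map, ← key ψ hψ hψc hψs]
      refine integral_congr_ae (ae_of_all _ fun z => ?_)
      simp only [hWι, smul_eq_mul, ι, mul_comm])
  rw [hι.ae_map_iff] at hfin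
  filter_upwards [hfin, hmem] with z hz hzΩ
  have h3 := hz ⟨hzΩ, mem_univ _⟩
  rw [hWι] at h3
  exact sub_eq_zero.1 h3

end IsC2ConvexDomain

/-! ### The time-dependent problem -/

open Filter Topology Module

instance (τ : ℝ) : IsFiniteMeasure (timeMeasure τ) := by unfold timeMeasure; infer_instance

/-- The solution of the radiative transfer problem with source `S` and inflow data `g`. -/
def rteSolution (Ω : Set E3) (S : ℝ × E3 → ℝ) (g : ℝ × E3 × S2 → ℝ) (p : ℝ × E3 × S2) : ℝ :=
  raySolution Ω (fun x => S (p.1, x)) (fun z => g (p.1, z)) p.2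

theorem measurable_comp_source {E : Type*} [MeasurableSpace E] {F : ℝ × E3 → E}
    (hF : Measurable F) : Measurable fun p : ℝ × E3 × S2 => F (p.1, p.2.1) :=
  hF.comp (measurable_fst.prodMk (measurable_fst.comp measurable_snd))

namespace IsC2ConvexDomain

variable {Ω : Set E3} {τ : ℝ} (hD : IsC2ConvexDomain Ω)
include hD

theorem measurable_rteSolution {S : ℝ × E3 → ℝ} {g : ℝ × E3 × S2 → ℝ} (hS : Measurable S)
    (hg : Measurable g) : Measurable (rteSolution Ω S g) :=
  hD.measurable_raySolution (S := fun t x => S (t, x)) (g := fun t z => g (t, z)) hS hg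

theorem lintegral_time_phase {F : ℝ × E3 → ℝ≥0∞} (hF : Measurable F) :
    ∫⁻ p, F (p.1, p.2.1) ∂((timeMeasure τ).prod (phaseMeasure Ω)) =
      sphereMeasure univ * ∫⁻ q, F q ∂(cylinderMeasure Ω τ) := by
  have := hD.isFiniteMeasure_volume
  have := hD.isFiniteMeasure_phase
  have hm : Measurable fun p : ℝ × E3 × S2 => F (p.1, p.2.1) := hF.comp (by fun_prop)
  rw [lintegral_prod _ hm.aemeasurable, cylinderMeasure, lintegral_prod _ hF.aemeasurable,
    ← lintegral_const_mul' _ _ (measure_ne_top _ _)]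
  refine lintegral_congr fun t => ?_
  have hm2 : Measurable fun z : E3 × S2 => F (t, z.1) := hF.comp (by fun_prop)
  rw [phaseMeasure, lintegral_prod _ hm2.aemeasurable,
    ← lintegral_const_mul' _ _ (measure_ne_top _ _)]
  refine lintegral_congr fun x => ?_
  change ∫⁻ _, F (t, x) ∂sphereMeasure = _
  rw [lintegral_const, mul_comm]

theorem lintegral_source_lt_top {S : ℝ × E3 → ℝ} (hS : Measurable S)
    (hS2 : ∫⁻ q, ‖S q‖ₑ ^ 2 ∂(cylinderMeasure Ω τ) < ⊤) :
    ∀ᵐ t ∂(timeMeasure τ), ∫⁻ z, ‖S (t, z.1)‖ₑ ^ 2 ∂(phaseMeasure Ω) < ⊤ := by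
  have := hD.isFiniteMeasure_phase
  have h := hD.lintegral_time_phase (τ := τ) (hS.enorm.pow_const 2)
  have hm : Measurable fun p : ℝ × E3 × S2 => ‖S (p.1, p.2.1)‖ₑ ^ 2 :=
    measurable_comp_source (hS.enorm.pow_const 2)
  rw [lintegral_prod _ hm.aemeasurable] at h
  refine ae_lt_top hm.lintegral_prod_right' ?_
  rw [h]
  exact (ENNReal.mul_lt_top (measure_lt_top _ _) hS2).ne

section bounds
variable {S₁ S₂ : ℝ × E3 → ℝ} {g₁ g₂ : ℝ × E3 × S2 → ℝ} {d : ℝ}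

theorem lintegral_rteSolution_sub_le (hd : ∀ z : E3 × S2, z.1 ∈ inflowPart Ω (z.2 : E3) →
    chordLength Ω z ≤ d) (hS₁ : Measurable S₁) (hS₂ : Measurable S₂) (hg₁ : Measurable g₁)
    (hg₂ : Measurable g₂) (h₁ : ∫⁻ q, ‖S₁ q‖ₑ ^ 2 ∂(cylinderMeasure Ω τ) < ⊤)
    (h₂ : ∫⁻ q, ‖S₂ q‖ₑ ^ 2 ∂(cylinderMeasure Ω τ) < ⊤) :
    ∫⁻ p, ‖rteSolution Ω S₁ g₁ p - rteSolution Ω S₂ g₂ p‖ₑ ^ 2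
        ∂((timeMeasure τ).prod (phaseMeasure Ω)) ≤
      ENNReal.ofReal d * (2 * (∫⁻ p, ‖g₁ p - g₂ p‖ₑ ^ 2
          ∂((timeMeasure τ).prod (inflowMeasure Ω)) +
        ENNReal.ofReal d * (sphereMeasure univ *
          ∫⁻ q, ‖S₁ q - S₂ q‖ₑ ^ 2 ∂(cylinderMeasure Ω τ)))) := by
  have := hD.isFiniteMeasure_phase
  have := hD.isFiniteMeasure_inflow
  have hm₁ := hD.measurable_rteSolution hS₁ hg₁
  have hm₂ := hD.measurable_rteSolution hS₂ hg₂
  have hm : Measurable fun p => ‖rteSolution Ω S₁ g₁ p - rteSolution Ω S₂ g₂ p‖ₑ ^ 2 :=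
    (hm₁.sub hm₂).enorm.pow_const 2
  have hmS : Measurable fun q => ‖S₁ q - S₂ q‖ₑ ^ 2 := (hS₁.sub hS₂).enorm.pow_const 2
  have hmg : Measurable fun p => ‖g₁ p - g₂ p‖ₑ ^ 2 := (hg₁.sub hg₂).enorm.pow_const 2
  have hmS' : Measurable fun p : ℝ × E3 × S2 => ‖S₁ (p.1, p.2.1) - S₂ (p.1, p.2.1)‖ₑ ^ 2 :=
    measurable_comp_source hmS
  rw [← hD.lintegral_time_phase hmS, lintegral_prod _ hm.aemeasurable,
    lintegral_prod _ hmg.aemeasurable, lintegral_prod _ hmS'.aemeasurable,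
    ← lintegral_const_mul' (ENNReal.ofReal d) _ (by simp),
    ← lintegral_add_left hmg.lintegral_prod_right', ← lintegral_const_mul' 2 _ (by simp),
    ← lintegral_const_mul' (ENNReal.ofReal d) _ (by simp)]
  refine lintegral_mono_ae ?_
  filter_upwards [hD.lintegral_source_lt_top hS₁ h₁, hD.lintegral_source_lt_top hS₂ h₂]
    with t ht₁ ht₂
  have m₁ : Measurable fun x => S₁ (t, x) := hS₁.comp measurable_prodMk_left
  have m₂ : Measurable fun x => S₂ (t, x) := hS₂.comp measurable_prodMk_left
  have n₁ : Measurable fun z => g₁ (t, z) := hg₁.comp measurable_prodMk_left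
  have n₂ : Measurable fun z => g₂ (t, z) := hg₂.comp measurable_prodMk_left
  have := hD.lintegral_raySolution_sub_le hd m₁ m₂ n₁ n₂ ht₁ ht₂
  exact this

end bounds

variable {S : ℝ × E3 → ℝ} {g : ℝ × E3 × S2 → ℝ}

theorem lintegral_rteSolution_le {d : ℝ} (hd : ∀ z : E3 × S2, z.1 ∈ inflowPart Ω (z.2 : E3) →
    chordLength Ω z ≤ d) (hS : Measurable S) (hg : Measurable g)
    (h : ∫⁻ q, ‖S q‖ₑ ^ 2 ∂(cylinderMeasure Ω τ) < ⊤) :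
    ∫⁻ p, ‖rteSolution Ω S g p‖ₑ ^ 2 ∂((timeMeasure τ).prod (phaseMeasure Ω)) ≤
      ENNReal.ofReal d * (2 * (∫⁻ p, ‖g p‖ₑ ^ 2 ∂((timeMeasure τ).prod (inflowMeasure Ω)) +
        ENNReal.ofReal d * (sphereMeasure univ * ∫⁻ q, ‖S q‖ₑ ^ 2 ∂(cylinderMeasure Ω τ)))) := by
  have := hD.lintegral_rteSolution_sub_le hd hS (measurable_const (a := (0 : ℝ))) hg
    (measurable_const (a := (0 : ℝ))) h (by simp)
  simpa [rteSolution, raySolution_zero] using this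

theorem lintegral_rteSolution_outflow_le {d : ℝ}
    (hd : ∀ z : E3 × S2, z.1 ∈ inflowPart Ω (z.2 : E3) → chordLength Ω z ≤ d)
    (hS : Measurable S) (hg : Measurable g)
    (h : ∫⁻ q, ‖S q‖ₑ ^ 2 ∂(cylinderMeasure Ω τ) < ⊤) :
    ∫⁻ p, ‖rteSolution Ω S g p‖ₑ ^ 2 ∂((timeMeasure τ).prod (outflowMeasure Ω)) ≤
      2 * (∫⁻ p, ‖g p‖ₑ ^ 2 ∂((timeMeasure τ).prod (inflowMeasure Ω)) +
        ENNReal.ofReal d * (sphereMeasure univ * ∫⁻ q, ‖S q‖ₑ ^ 2 ∂(cylinderMeasure Ω τ))) := by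
  have := hD.isFiniteMeasure_phase
  have := hD.isFiniteMeasure_inflow
  have := hD.isFiniteMeasure_outflow
  have hm : Measurable fun p => ‖rteSolution Ω S g p‖ₑ ^ 2 :=
    (hD.measurable_rteSolution hS hg).enorm.pow_const 2
  have hmS : Measurable fun q => ‖S q‖ₑ ^ 2 := hS.enorm.pow_const 2
  have hmg : Measurable fun p => ‖g p‖ₑ ^ 2 := hg.enorm.pow_const 2
  have hmS' : Measurable fun p : ℝ × E3 × S2 => ‖S (p.1, p.2.1)‖ₑ ^ 2 :=
    measurable_comp_source hmS
  rw [← hD.lintegral_time_phase hmS, lintegral_prod _ hm.aemeasurable,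
    lintegral_prod _ hmg.aemeasurable, lintegral_prod _ hmS'.aemeasurable,
    ← lintegral_const_mul' (ENNReal.ofReal d) _ (by simp),
    ← lintegral_add_left hmg.lintegral_prod_right', ← lintegral_const_mul' 2 _ (by simp)]
  refine lintegral_mono_ae ?_
  filter_upwards [hD.lintegral_source_lt_top hS h] with t ht
  have m₁ : Measurable fun x => S (t, x) := hS.comp measurable_prodMk_left
  have n₁ : Measurable fun z => g (t, z) := hg.comp measurable_prodMk_left
  have := hD.lintegral_raySolution_outflow_le hd m₁ n₁ ht
  exact this

/-- Existence. -/
theorem isRTESolution_rteSolution (hS : Measurable S) (hg : Measurable g)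
    (hS2 : ∫⁻ q, ‖S q‖ₑ ^ 2 ∂(cylinderMeasure Ω τ) < ⊤)
    (hg2 : ∫⁻ p, ‖g p‖ₑ ^ 2 ∂((timeMeasure τ).prod (inflowMeasure Ω)) < ⊤)
    {Ib : ℝ × E3 × S2 → ℝ}
    (hIb : ∀ᵐ p ∂((timeMeasure τ).prod (inflowMeasure Ω)), g p = Ib p) :
    IsRTESolution Ω τ S Ib (rteSolution Ω S g) := by
  have := hD.isFiniteMeasure_phase
  have := hD.isFiniteMeasure_inflow
  obtain ⟨d, -, hd⟩ := hD.exists_chordLength_le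
  have hIm := hD.measurable_rteSolution hS hg
  have hSm : Measurable fun p : ℝ × E3 × S2 => S (p.1, p.2.1) := measurable_comp_source hS
  have hfin : ∫⁻ p, ‖g p‖ₑ ^ 2 ∂((timeMeasure τ).prod (inflowMeasure Ω)) +
        ENNReal.ofReal d * (sphereMeasure univ * ∫⁻ q, ‖S q‖ₑ ^ 2 ∂(cylinderMeasure Ω τ)) < ⊤ :=
    ENNReal.add_lt_top.2 ⟨hg2, ENNReal.mul_lt_top (by simp)
      (ENNReal.mul_lt_top (measure_lt_top _ _) hS2)⟩
  have hI : MemLp (rteSolution Ω S g) 2 ((timeMeasure τ).prod (phaseMeasure Ω)) :=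
    (memLp_two_iff_lintegral hIm.aestronglyMeasurable).2
      ((hD.lintegral_rteSolution_le hd hS hg hS2).trans_lt (ENNReal.mul_lt_top (by simp)
        (ENNReal.mul_lt_top (by simp) hfin)))
  have hSL : MemLp (fun p : ℝ × E3 × S2 => S (p.1, p.2.1)) 2
      ((timeMeasure τ).prod (phaseMeasure Ω)) := by
    refine (memLp_two_iff_lintegral hSm.aestronglyMeasurable).2 ?_
    rw [hD.lintegral_time_phase (hS.enorm.pow_const 2)]
    exact ENNReal.mul_lt_top (measure_lt_top _ _) hS2
  have htrace : ∀ᵐ t ∂(timeMeasure τ), IsTrace Ω (fun z => rteSolution Ω S g (t, z))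
      (fun z => S (t, z.1) - rteSolution Ω S g (t, z)) (fun z => rteSolution Ω S g (t, z)) := by
    have hgm : Measurable fun p => ‖g p‖ₑ ^ 2 := hg.enorm.pow_const 2
    rw [lintegral_prod _ hgm.aemeasurable] at hg2
    filter_upwards [hD.lintegral_source_lt_top hS hS2,
      ae_lt_top hgm.lintegral_prod_right' hg2.ne] with t ht₁ ht₂
    exact hD.isTrace_raySolution (S := fun x => S (t, x)) (g := fun z => g (t, z))
      (hS.comp measurable_prodMk_left) (hg.comp measurable_prodMk_left) ht₁ ht₂
  refine ⟨fun p => S (p.1, p.2.1) - rteSolution Ω S g p, rteSolution Ω S g,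
    ⟨hI, hSL.sub hI, ?_, ?_, htrace⟩, ae_of_all _ fun p => by ring, ?_⟩
  · exact (memLp_two_iff_lintegral hIm.aestronglyMeasurable).2
      ((hD.lintegral_rteSolution_outflow_le hd hS hg hS2).trans_lt
        (ENNReal.mul_lt_top (by simp) hfin))
  · exact htrace.mono fun t ht => hD.isWeakTransportDeriv_of_isTrace ht
  · filter_upwards [hIb, Measure.quasiMeasurePreserving_snd.ae hD.ae_inflow_mem] with p hp hp2
    rw [← hp]
    exact hD.raySolution_inflow _ _ hp2

/-- Uniqueness. -/
theorem ae_eq_of_isRTESolution {Ib I J : ℝ × E3 × S2 → ℝ} (hI : IsRTESolution Ω τ S Ib I)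
    (hJ : IsRTESolution Ω τ S Ib J) :
    ∀ᵐ p ∂((timeMeasure τ).prod (phaseMeasure Ω)), J p = I p := by
  have := hD.isFiniteMeasure_phase
  have := hD.isFiniteMeasure_inflow
  obtain ⟨D₁, γ₁, h₁, e₁, b₁⟩ := hI
  obtain ⟨D₂, γ₂, h₂, e₂, b₂⟩ := hJ
  have slice {v : ℝ × E3 × S2 → ℝ} (hv : MemLp v 2 ((timeMeasure τ).prod (phaseMeasure Ω))) :
      ∀ᵐ t ∂(timeMeasure τ), Integrable (fun z => v (t, z)) (phaseMeasure Ω) :=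
    (hv.integrable (by norm_num)).prod_right_ae
  have main : ∀ᵐ t ∂(timeMeasure τ), ∀ᵐ z ∂(phaseMeasure Ω), J (t, z) = I (t, z) := by
    filter_upwards [slice h₁.memLp, slice h₂.memLp, slice h₁.memLp_deriv, slice h₂.memLp_deriv,
      h₁.trace, h₂.trace, Measure.ae_ae_of_ae_prod e₁, Measure.ae_ae_of_ae_prod e₂,
      Measure.ae_ae_of_ae_prod b₁, Measure.ae_ae_of_ae_prod b₂]
      with t a₁ a₂ c₁ c₂ t₁ t₂ s₁ s₂ r₁ r₂
    refine hD.ae_eq_of_isTrace a₂ a₁ c₂ c₁ t₂ t₁ ?_ ?_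
    · filter_upwards [s₁, s₂] with z hz₁ hz₂
      exact hz₂.trans hz₁.symm
    · filter_upwards [r₁, r₂] with z hz₁ hz₂
      exact hz₂.trans hz₁.symm
  -- Equality on almost every time slice implies equality almost everywhere in the product only for
  -- a measurable set, hence the passage to a measurable representative of the difference.
  set w : ℝ × E3 × S2 → ℝ := fun p => J p - I p with hw
  have hwm : AEStronglyMeasurable w ((timeMeasure τ).prod (phaseMeasure Ω)) :=
    h₂.memLp.1.sub h₁.memLp.1
  have hmk := hwm.ae_eq_mk
  have h0 : ∀ᵐ p ∂((timeMeasure τ).prod (phaseMeasure Ω)), hwm.mk w p = 0 := by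
    refine (Measure.ae_prod_iff_ae_ae
      (hwm.stronglyMeasurable_mk.measurable (measurableSet_singleton 0))).2 ?_
    filter_upwards [main, Measure.ae_ae_of_ae_prod hmk] with t ht₁ ht₂
    filter_upwards [ht₁, ht₂] with z hz₁ hz₂
    rw [← hz₂, hw]
    simp [hz₁]
  filter_upwards [hmk, h0] with p hp₁ hp₂
  rw [hp₂] at hp₁
  exact sub_eq_zero.1 hp₁

end IsC2ConvexDomain

/-! ### The angular integral and the source `T⁴` -/

open Filter Topology Module

/-- `∫ I(t, x, β) dβ`. -/
def angularIntegral (I : ℝ × E3 × S2 → ℝ) (q : ℝ × E3) : ℝ :=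
  ∫ β, I (q.1, q.2, β) ∂sphereMeasure

theorem measurable_angularIntegral {I : ℝ × E3 × S2 → ℝ} (hI : Measurable I) :
    Measurable (angularIntegral I) := by
  have h : Measurable fun p : (ℝ × E3) × S2 => I (p.1.1, p.1.2, p.2) := hI.comp (by fun_prop)
  exact (h.stronglyMeasurable.integral_prod_right' (ν := sphereMeasure)).measurable

namespace IsC2ConvexDomain

variable {Ω : Set E3} {τ : ℝ} (hD : IsC2ConvexDomain Ω)
include hD

theorem measurePreserving_assoc : MeasurePreserving
    (MeasurableEquiv.prodAssoc : (ℝ × E3) × S2 ≃ᵐ ℝ × E3 × S2)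
    ((cylinderMeasure Ω τ).prod sphereMeasure) ((timeMeasure τ).prod (phaseMeasure Ω)) := by
  have := hD.isFiniteMeasure_volume
  exact measurePreserving_prodAssoc _ _ _

theorem isFiniteMeasure_cylinder : IsFiniteMeasure (cylinderMeasure Ω τ) := by
  have := hD.isFiniteMeasure_volume
  unfold cylinderMeasure
  infer_instance

theorem ae_ae_sphere {p : ℝ × E3 × S2 → Prop}
    (h : ∀ᵐ z ∂((timeMeasure τ).prod (phaseMeasure Ω)), p z) :
    ∀ᵐ q ∂(cylinderMeasure Ω τ), ∀ᵐ β ∂sphereMeasure, p (q.1, q.2, β) :=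
  Measure.ae_ae_of_ae_prod (hD.measurePreserving_assoc.quasiMeasurePreserving.ae h)

theorem ae_integrable_sphere {I : ℝ × E3 × S2 → ℝ}
    (h : MemLp I 2 ((timeMeasure τ).prod (phaseMeasure Ω))) :
    ∀ᵐ q ∂(cylinderMeasure Ω τ), Integrable (fun β => I (q.1, q.2, β)) sphereMeasure := by
  have := hD.isFiniteMeasure_phase
  have := hD.isFiniteMeasure_cylinder (τ := τ)
  have h1 : Integrable I ((timeMeasure τ).prod (phaseMeasure Ω)) := h.integrable (by norm_num)
  exact ((hD.measurePreserving_assoc.integrable_comp_emb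
    MeasurableEquiv.prodAssoc.measurableEmbedding).2 h1).prod_right_ae

/-- Cauchy–Schwarz on the sphere, at the cost of its total mass. Square integrability of `I` and `J`
makes almost every directional slice integrable, so the difference of the integrals is the integral
of the difference. -/
theorem lintegral_angularIntegral_sub_le {I J : ℝ × E3 × S2 → ℝ} (hI : Measurable I)
    (hJ : Measurable J) (hI2 : MemLp I 2 ((timeMeasure τ).prod (phaseMeasure Ω)))
    (hJ2 : MemLp J 2 ((timeMeasure τ).prod (phaseMeasure Ω))) :
    ∫⁻ q, ‖angularIntegral I q - angularIntegral J q‖ₑ ^ 2 ∂(cylinderMeasure Ω τ) ≤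
      sphereMeasure univ *
        ∫⁻ p, ‖I p - J p‖ₑ ^ 2 ∂((timeMeasure τ).prod (phaseMeasure Ω)) := by
  have hm : Measurable fun p => ‖I p - J p‖ₑ ^ 2 := (hI.sub hJ).enorm.pow_const 2
  have hm' : Measurable fun p : (ℝ × E3) × S2 => ‖I (p.1.1, p.1.2, p.2) - J (p.1.1, p.1.2, p.2)‖ₑ ^ 2 :=
    hm.comp (by fun_prop)
  have e : ∫⁻ p, ‖I p - J p‖ₑ ^ 2 ∂((timeMeasure τ).prod (phaseMeasure Ω)) =
      ∫⁻ q, ∫⁻ β, ‖I (q.1, q.2, β) - J (q.1, q.2, β)‖ₑ ^ 2 ∂sphereMeasure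
        ∂(cylinderMeasure Ω τ) := by
    rw [← hD.measurePreserving_assoc.lintegral_comp hm]
    exact lintegral_prod _ hm'.aemeasurable
  rw [e, ← lintegral_const_mul' _ _ (measure_ne_top _ _)]
  refine lintegral_mono_ae ?_
  filter_upwards [hD.ae_integrable_sphere hI2, hD.ae_integrable_sphere hJ2] with q h1 h2
  rw [angularIntegral, angularIntegral, ← integral_sub h1 h2]
  have hmq : Measurable fun β : S2 => I (q.1, q.2, β) - J (q.1, q.2, β) :=
    (hI.comp (by fun_prop)).sub (hJ.comp (by fun_prop))
  refine le_trans ?_ (lintegral_sq_le _ hmq.enorm.aemeasurable)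
  gcongr
  exact enorm_integral_le_lintegral_enorm _

end IsC2ConvexDomain

/-- Hölder's inequality with exponents `4` and `4/3`, without roots. -/
theorem lintegral_mul_pow_four_le {α : Type*} [MeasurableSpace α] (μ : Measure α)
    {f g : α → ℝ≥0∞} (hf : AEMeasurable f μ) (hg : AEMeasurable g μ) :
    (∫⁻ x, f x ^ 2 * g x ^ 6 ∂μ) ^ 4 ≤ (∫⁻ x, f x ^ 8 ∂μ) * (∫⁻ x, g x ^ 8 ∂μ) ^ 3 := by
  have hpq : (4 : ℝ).HolderConjugate (4 / 3) := by
    rw [Real.holderConjugate_iff]; norm_num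
  have h := ENNReal.lintegral_mul_le_Lp_mul_Lq μ hpq (hf.pow_const 2) (hg.pow_const 6)
  have e1 (x : α) : ((f x ^ 2) ^ (4 : ℝ) : ℝ≥0∞) = f x ^ 8 := by
    rw [← ENNReal.rpow_natCast, ← ENNReal.rpow_natCast, ← ENNReal.rpow_mul]; norm_num
  have e2 (x : α) : ((g x ^ 6) ^ (4 / 3 : ℝ) : ℝ≥0∞) = g x ^ 8 := by
    rw [← ENNReal.rpow_natCast, ← ENNReal.rpow_natCast, ← ENNReal.rpow_mul]; norm_num
  simp only [e1, e2, Pi.mul_apply] at h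
  calc (∫⁻ x, f x ^ 2 * g x ^ 6 ∂μ) ^ 4 ≤ _ := pow_le_pow_left' h 4
    _ = _ := by
      rw [mul_pow, ← ENNReal.rpow_natCast, ← ENNReal.rpow_natCast, ← ENNReal.rpow_natCast,
        ← ENNReal.rpow_mul, ← ENNReal.rpow_mul]
      norm_num

/-- Factor `a ^ 4 - b ^ 4` as `a - b` times a cubic with four terms. Cauchy–Schwarz gives the factor
`4`, and the mixed terms of degree six are at most `a ^ 6 + b ^ 6`. -/
theorem enorm_pow_four_sub_sq_le (a b : ℝ) :
    ‖a ^ 4 - b ^ 4‖ₑ ^ 2 ≤ 16 * (‖a - b‖ₑ ^ 2 * ‖a‖ₑ ^ 6 + ‖a - b‖ₑ ^ 2 * ‖b‖ₑ ^ 6) := by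
  have h : ‖a ^ 4 - b ^ 4‖ ^ 2 ≤ 16 * (‖a - b‖ ^ 2 * ‖a‖ ^ 6 + ‖a - b‖ ^ 2 * ‖b‖ ^ 6) := by
    rw [← norm_pow, ← norm_pow, ← norm_pow, ← norm_pow]
    simp only [Real.norm_eq_abs]
    rw [abs_of_nonneg (sq_nonneg _), abs_of_nonneg (sq_nonneg _),
      abs_of_nonneg (by positivity : 0 ≤ a ^ 6), abs_of_nonneg (by positivity : 0 ≤ b ^ 6)]
    have e : (a ^ 4 - b ^ 4) ^ 2 = (a - b) ^ 2 * (a ^ 3 + a ^ 2 * b + a * b ^ 2 + b ^ 3) ^ 2 := by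
      ring
    rw [e, ← mul_add, mul_left_comm]
    refine mul_le_mul_of_nonneg_left ?_ (sq_nonneg _)
    have h1 : (a ^ 3 + a ^ 2 * b + a * b ^ 2 + b ^ 3) ^ 2 ≤
        4 * (a ^ 6 + a ^ 4 * b ^ 2 + a ^ 2 * b ^ 4 + b ^ 6) := by
      nlinarith [sq_nonneg (a ^ 3 - a ^ 2 * b), sq_nonneg (a ^ 3 - a * b ^ 2),
        sq_nonneg (a ^ 3 - b ^ 3), sq_nonneg (a ^ 2 * b - a * b ^ 2),
        sq_nonneg (a ^ 2 * b - b ^ 3), sq_nonneg (a * b ^ 2 - b ^ 3)]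
    have h2 : a ^ 4 * b ^ 2 + a ^ 2 * b ^ 4 ≤ a ^ 6 + b ^ 6 := by
      nlinarith [mul_nonneg (add_nonneg (sq_nonneg a) (sq_nonneg b)) (sq_nonneg (a ^ 2 - b ^ 2))]
    nlinarith [h1, h2, (by positivity : 0 ≤ a ^ 6), (by positivity : 0 ≤ b ^ 6)]
  have h3 := ENNReal.ofReal_le_ofReal h
  have e (x : ℝ) (n : ℕ) : ENNReal.ofReal (‖x‖ ^ n) = ‖x‖ₑ ^ n := by
    rw [ENNReal.ofReal_pow (norm_nonneg _), ofReal_norm]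
  rwa [ENNReal.ofReal_mul (by norm_num), ENNReal.ofReal_add (by positivity) (by positivity),
    ENNReal.ofReal_mul (by positivity), ENNReal.ofReal_mul (by positivity), e, e, e, e,
    ENNReal.ofReal_ofNat] at h3

section source
variable {Ω : Set E3} {τ : ℝ}

theorem measurable_fourthPower (T : W21 Ω τ) : Measurable (fourthPower T) :=
  (Lp.stronglyMeasurable _).measurable.pow_const 4

theorem lintegral_fourthPower_sq {K : ℝ} (hK : ∀ T : W21 Ω τ,
    ∫⁻ z, ‖((T : PiLp 2 fun _ : W21Index => L2Q Ω τ) .val) z‖ₑ ^ 8 ∂(cylinderMeasure Ω τ) ≤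
      ENNReal.ofReal (K * ‖T‖ ^ 8)) (T : W21 Ω τ) :
    ∫⁻ q, ‖fourthPower T q‖ₑ ^ 2 ∂(cylinderMeasure Ω τ) ≤ ENNReal.ofReal (K * ‖T‖ ^ 8) := by
  refine le_trans (le_of_eq ?_) (hK T)
  refine lintegral_congr fun q => ?_
  rw [fourthPower, enorm_pow, ← pow_mul]

/-- Hölder with exponents `4` and `4/3` puts `T - U` and the sixth powers all in `L⁸`, where the
embedding applies to `T - U` as well as to `T` and `U`. Writing the constant as `κ ^ 4` lets the
fourth powers be compared without extracting roots. -/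
theorem lintegral_fourthPower_sub_sq {κ : ℝ} (hK : ∀ T : W21 Ω τ,
    ∫⁻ z, ‖((T : PiLp 2 fun _ : W21Index => L2Q Ω τ) .val) z‖ₑ ^ 8 ∂(cylinderMeasure Ω τ) ≤
      ENNReal.ofReal (κ ^ 4 * ‖T‖ ^ 8)) (T U : W21 Ω τ) :
    ∫⁻ q, ‖fourthPower T q - fourthPower U q‖ₑ ^ 2 ∂(cylinderMeasure Ω τ) ≤
      ENNReal.ofReal (16 * (κ ^ 4 * ‖T - U‖ ^ 2 * (‖T‖ ^ 6 + ‖U‖ ^ 6))) := by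
  set f : W21 Ω τ → ℝ × E3 → ℝ := fun T =>
    ((T : PiLp 2 fun _ : W21Index => L2Q Ω τ) .val) with hf
  have hfm (T : W21 Ω τ) : Measurable (f T) := (Lp.stronglyMeasurable _).measurable
  have hsub : f (T - U) =ᵐ[cylinderMeasure Ω τ] fun q => f T q - f U q := Lp.coeFn_sub _ _
  have hX (V : W21 Ω τ) : ∫⁻ q, ‖f T q - f U q‖ₑ ^ 2 * ‖f V q‖ₑ ^ 6 ∂(cylinderMeasure Ω τ) ≤
      ENNReal.ofReal (κ ^ 4 * ‖T - U‖ ^ 2 * ‖V‖ ^ 6) := by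
    rw [← ENNReal.pow_le_pow_left_iff (n := 4) (by norm_num)]
    refine (lintegral_mul_pow_four_le _ (f := fun q => ‖f T q - f U q‖ₑ)
      (g := fun q => ‖f V q‖ₑ) ((hfm T).sub (hfm U)).enorm.aemeasurable
      (hfm V).enorm.aemeasurable).trans ?_
    have h1 : ∫⁻ q, ‖f T q - f U q‖ₑ ^ 8 ∂(cylinderMeasure Ω τ) ≤
        ENNReal.ofReal (κ ^ 4 * ‖T - U‖ ^ 8) := by
      refine le_trans (le_of_eq (lintegral_congr_ae ?_)) (hK (T - U))
      filter_upwards [hsub] with q hq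
      rw [← hq]
    calc _ ≤ ENNReal.ofReal (κ ^ 4 * ‖T - U‖ ^ 8) * ENNReal.ofReal (κ ^ 4 * ‖V‖ ^ 8) ^ 3 := by
          gcongr
          exact hK V
      _ = _ := by
          rw [← ENNReal.ofReal_pow (by positivity), ← ENNReal.ofReal_pow (by positivity),
            ← ENNReal.ofReal_mul (by positivity)]
          congr 1
          ring
  calc ∫⁻ q, ‖fourthPower T q - fourthPower U q‖ₑ ^ 2 ∂(cylinderMeasure Ω τ)
      ≤ ∫⁻ q, 16 * (‖f T q - f U q‖ₑ ^ 2 * ‖f T q‖ₑ ^ 6 + ‖f T q - f U q‖ₑ ^ 2 * ‖f U q‖ₑ ^ 6)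
          ∂(cylinderMeasure Ω τ) := lintegral_mono fun q => enorm_pow_four_sub_sq_le _ _
    _ = 16 * (∫⁻ q, ‖f T q - f U q‖ₑ ^ 2 * ‖f T q‖ₑ ^ 6 ∂(cylinderMeasure Ω τ) +
          ∫⁻ q, ‖f T q - f U q‖ₑ ^ 2 * ‖f U q‖ₑ ^ 6 ∂(cylinderMeasure Ω τ)) := by
        rw [lintegral_const_mul' _ _ (by simp), lintegral_add_left]
        exact (((hfm T).sub (hfm U)).enorm.pow_const 2).mul ((hfm T).enorm.pow_const 6)
    _ ≤ 16 * (ENNReal.ofReal (κ ^ 4 * ‖T - U‖ ^ 2 * ‖T‖ ^ 6) +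
          ENNReal.ofReal (κ ^ 4 * ‖T - U‖ ^ 2 * ‖U‖ ^ 6)) := by
        gcongr
        · exact hX T
        · exact hX U
    _ = _ := by
        rw [← ENNReal.ofReal_add (by positivity) (by positivity), ← mul_add,
          ENNReal.ofReal_mul (p := 16) (by norm_num), ENNReal.ofReal_ofNat]

end source

/-! ### The solution operator -/

open Filter Topology Module

theorem norm_le_of_lintegral {α : Type*} [MeasurableSpace α] {μ : Measure α} (F : Lp ℝ 2 μ)
    {c : ℝ} (h : ∫⁻ x, ‖F x‖ₑ ^ 2 ∂μ ≤ ENNReal.ofReal c) : ‖F‖ ≤ √c := by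
  rw [lintegral_enorm_sq_eq] at h
  by_cases hc : 0 ≤ c
  · rw [ENNReal.ofReal_le_ofReal_iff hc] at h
    exact Real.le_sqrt_of_sq_le h
  · rw [ENNReal.ofReal_of_nonpos (not_le.1 hc).le, nonpos_iff_eq_zero, ENNReal.ofReal_eq_zero] at h
    have : ‖F‖ = 0 := by nlinarith [norm_nonneg F]
    rw [this]
    positivity

namespace IsC2ConvexDomain

variable {Ω : Set E3} {τ : ℝ} (hD : IsC2ConvexDomain Ω)
include hD

theorem lintegral_angularIntegral_rteSolution_sub_le {S₁ S₂ : ℝ × E3 → ℝ}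
    {g₁ g₂ : ℝ × E3 × S2 → ℝ} {d a b : ℝ}
    (hd : ∀ z : E3 × S2, z.1 ∈ inflowPart Ω (z.2 : E3) → chordLength Ω z ≤ d)
    (hS₁ : Measurable S₁) (hS₂ : Measurable S₂) (hg₁ : Measurable g₁) (hg₂ : Measurable g₂)
    (h₁ : ∫⁻ q, ‖S₁ q‖ₑ ^ 2 ∂(cylinderMeasure Ω τ) < ⊤)
    (h₂ : ∫⁻ q, ‖S₂ q‖ₑ ^ 2 ∂(cylinderMeasure Ω τ) < ⊤)
    (hg₁' : ∫⁻ p, ‖g₁ p‖ₑ ^ 2 ∂((timeMeasure τ).prod (inflowMeasure Ω)) < ⊤)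
    (hg₂' : ∫⁻ p, ‖g₂ p‖ₑ ^ 2 ∂((timeMeasure τ).prod (inflowMeasure Ω)) < ⊤)
    (ha : 0 ≤ a) (hb : 0 ≤ b) (hd0 : 0 ≤ d)
    (hga : ∫⁻ p, ‖g₁ p - g₂ p‖ₑ ^ 2 ∂((timeMeasure τ).prod (inflowMeasure Ω)) ≤ ENNReal.ofReal a)
    (hSb : ∫⁻ q, ‖S₁ q - S₂ q‖ₑ ^ 2 ∂(cylinderMeasure Ω τ) ≤ ENNReal.ofReal b) :
    ∫⁻ q, ‖angularIntegral (rteSolution Ω S₁ g₁) q - angularIntegral (rteSolution Ω S₂ g₂) q‖ₑ ^ 2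
        ∂(cylinderMeasure Ω τ) ≤
      ENNReal.ofReal (sphereMeasure.real univ * (d * (2 * (a +
        d * (sphereMeasure.real univ * b))))) := by
  have m₁ := hD.measurable_rteSolution hS₁ hg₁
  have m₂ := hD.measurable_rteSolution hS₂ hg₂
  obtain ⟨D₁, γ₁, s₁, -⟩ := hD.isRTESolution_rteSolution hS₁ hg₁ h₁ hg₁' (ae_of_all _ fun _ => rfl)
  obtain ⟨D₂, γ₂, s₂, -⟩ := hD.isRTESolution_rteSolution hS₂ hg₂ h₂ hg₂' (ae_of_all _ fun _ => rfl)
  have hs : 0 ≤ sphereMeasure.real univ := measureReal_nonneg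
  have es : ENNReal.ofReal (sphereMeasure.real univ) = sphereMeasure univ :=
    ofReal_measureReal
  refine (hD.lintegral_angularIntegral_sub_le m₁ m₂ s₁.memLp s₂.memLp).trans ?_
  rw [ENNReal.ofReal_mul hs, ENNReal.ofReal_mul hd0, ENNReal.ofReal_mul (by norm_num),
    ENNReal.ofReal_add ha (by positivity), ENNReal.ofReal_mul hd0, ENNReal.ofReal_mul hs, es,
    ENNReal.ofReal_ofNat]
  gcongr
  refine (hD.lintegral_rteSolution_sub_le hd hS₁ hS₂ hg₁ hg₂ h₁ h₂).trans ?_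
  gcongr

theorem memLp_fourthPower (hne : Ω.Nonempty) (hτ : 0 < τ) (T : W21 Ω τ) :
    MemLp (fourthPower T) 2 (cylinderMeasure Ω τ) := by
  obtain ⟨K, -, hK⟩ := exists_eLpNorm_eight_le hD.isOpen hne hD.convex hD.bounded hτ
  exact (memLp_two_iff_lintegral (measurable_fourthPower T).aestronglyMeasurable).2
    ((lintegral_fourthPower_sq hK T).trans_lt ENNReal.ofReal_lt_top)

end IsC2ConvexDomain

/-- A nonnegative measurable representative of the inflow data. -/
theorem exists_measurable_inflow {Ω : Set E3} {τ : ℝ} {Ib : ℝ × E3 × S2 → ℝ}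
    (hIb : MemLp Ib 2 ((timeMeasure τ).prod (inflowMeasure Ω)))
    (h0 : ∀ᵐ p ∂((timeMeasure τ).prod (inflowMeasure Ω)), 0 ≤ Ib p) :
    ∃ g : ℝ × E3 × S2 → ℝ, Measurable g ∧ (∀ p, 0 ≤ g p) ∧
      (∀ᵐ p ∂((timeMeasure τ).prod (inflowMeasure Ω)), g p = Ib p) ∧
      ∫⁻ p, ‖g p‖ₑ ^ 2 ∂((timeMeasure τ).prod (inflowMeasure Ω)) =
        ENNReal.ofReal (inflowNorm Ω τ Ib ^ 2) := by
  have hae : ∀ᵐ p ∂((timeMeasure τ).prod (inflowMeasure Ω)), |hIb.1.mk Ib p| = Ib p := by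
    filter_upwards [hIb.1.ae_eq_mk, h0] with p hp hp0
    rw [← hp, abs_of_nonneg hp0]
  refine ⟨fun p => |hIb.1.mk Ib p|, hIb.1.stronglyMeasurable_mk.measurable.abs,
    fun p => abs_nonneg _, hae, ?_⟩
  rw [inflowNorm, ENNReal.ofReal_pow ENNReal.toReal_nonneg, ENNReal.ofReal_toReal hIb.2.ne,
    eLpNorm_two_sq]
  refine lintegral_congr_ae ?_
  filter_upwards [hae] with p hp
  rw [hp]

theorem angularIntegral_zero : angularIntegral (fun _ => 0) = fun _ => 0 := by
  funext q
  simp [angularIntegral]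

theorem rteSolution_zero (Ω : Set E3) :
    rteSolution Ω (fun _ => 0) (fun _ => 0) = fun _ => 0 := by
  funext p
  simp [rteSolution, raySolution_zero]

end RadTransfer

end

/-! ### Assembly of the theorem. -/

open RadTransfer in
theorem mainTheorem5
    (Ω : Set RadTransfer.E3) (hΩ_open : IsOpen Ω) (hΩ_nonempty : Ω.Nonempty)
    (hΩ_convex : Convex ℝ Ω) (hΩ_bounded : Bornology.IsBounded Ω)
    (hΩ_C2 : RadTransfer.HasC2Boundary Ω) (τ : ℝ) (hτ : 0 < τ) :
    ∃ C₂ : ℝ, 0 < C₂ ∧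
      ∀ Ib : ℝ × RadTransfer.E3 × RadTransfer.S2 → ℝ,
        MemLp Ib 2 ((RadTransfer.timeMeasure τ).prod (RadTransfer.inflowMeasure Ω)) →
        (∀ᵐ p ∂((RadTransfer.timeMeasure τ).prod (RadTransfer.inflowMeasure Ω)), 0 ≤ Ib p) →
        -- the source `T⁴` belongs to `L²(Q_τ)`
        (∀ T : RadTransfer.W21 Ω τ,
          MemLp (RadTransfer.fourthPower T) 2 (RadTransfer.cylinderMeasure Ω τ)) ∧
        -- the transfer equation with source `T⁴` has a unique solution, which is nonnegative
        (∀ T : RadTransfer.W21 Ω τ,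
          ∃ I : ℝ × RadTransfer.E3 × RadTransfer.S2 → ℝ,
            RadTransfer.IsRTESolution Ω τ (RadTransfer.fourthPower T) Ib I ∧
            (∀ᵐ p ∂((RadTransfer.timeMeasure τ).prod (RadTransfer.phaseMeasure Ω)), 0 ≤ I p) ∧
            ∀ J : ℝ × RadTransfer.E3 × RadTransfer.S2 → ℝ,
              RadTransfer.IsRTESolution Ω τ (RadTransfer.fourthPower T) Ib J →
              ∀ᵐ p ∂((RadTransfer.timeMeasure τ).prod (RadTransfer.phaseMeasure Ω)),
                J p = I p) ∧
        -- the map `T ↦ G = ∫ I dβ` is well defined, continuous, and satisfies the estimate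
        ∃ H : RadTransfer.W21 Ω τ → RadTransfer.L2Q Ω τ,
          (∀ (T : RadTransfer.W21 Ω τ) (I : ℝ × RadTransfer.E3 × RadTransfer.S2 → ℝ),
            RadTransfer.IsRTESolution Ω τ (RadTransfer.fourthPower T) Ib I →
            ∀ᵐ q ∂(RadTransfer.cylinderMeasure Ω τ),
              Integrable (fun β => I (q.1, q.2, β)) RadTransfer.sphereMeasure ∧
              H T q = ∫ β, I (q.1, q.2, β) ∂(RadTransfer.sphereMeasure)) ∧
          Continuous H ∧
          ∀ T : RadTransfer.W21 Ω τ,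
            ‖H T‖ ≤ C₂ * (‖T‖ ^ 4 + RadTransfer.inflowNorm Ω τ Ib) := by
  have hD : IsC2ConvexDomain Ω := ⟨hΩ_open, hΩ_convex, hΩ_C2, hΩ_bounded⟩
  obtain ⟨K, hK0, hK⟩ := exists_eLpNorm_eight_le hΩ_open hΩ_nonempty hΩ_convex hΩ_bounded hτ
  obtain ⟨κ, rfl⟩ : ∃ κ : ℝ, K = κ ^ 4 := by
    refine ⟨√(√K), ?_⟩
    rw [show (4 : ℕ) = 2 * 2 from rfl, pow_mul, Real.sq_sqrt (Real.sqrt_nonneg _),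
      Real.sq_sqrt hK0]
  obtain ⟨d, hd0, hd⟩ := hD.exists_chordLength_le
  set s : ℝ := sphereMeasure.real univ with hs
  have hs0 : 0 ≤ s := measureReal_nonneg
  -- `M` is the coefficient obtained when `N ^ 2` and `‖T‖ ^ 8` are both replaced by `(‖T‖ ^ 4 + N)
  -- ^ 2`. It does not involve the inflow data; adding `1` to its root keeps the constant positive
  -- without proving `M ≠ 0`.
  set M : ℝ := s * (d * (2 * (1 + d * (s * κ ^ 4)))) with hM
  have hM0 : 0 ≤ M := by positivity
  refine ⟨√M + 1, by positivity, fun Ib hIb hIb0 => ?_⟩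
  obtain ⟨g, hgm, hg0, hgIb, hg2⟩ := exists_measurable_inflow hIb hIb0
  set N : ℝ := inflowNorm Ω τ Ib with hN
  have hN0 : 0 ≤ N := ENNReal.toReal_nonneg
  have hgfin : ∫⁻ p, ‖g p‖ₑ ^ 2 ∂((timeMeasure τ).prod (inflowMeasure Ω)) < ⊤ := by
    rw [hg2]; exact ENNReal.ofReal_lt_top
  have hSm (T : W21 Ω τ) := measurable_fourthPower T
  have hSL (T : W21 Ω τ) := hD.memLp_fourthPower hΩ_nonempty hτ T
  have hSfin (T : W21 Ω τ) : ∫⁻ q, ‖fourthPower T q‖ₑ ^ 2 ∂(cylinderMeasure Ω τ) < ⊤ :=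
    (memLp_two_iff_lintegral (hSL T).1).1 (hSL T)
  have hsol (T : W21 Ω τ) : IsRTESolution Ω τ (fourthPower T) Ib
      (rteSolution Ω (fourthPower T) g) :=
    hD.isRTESolution_rteSolution (hSm T) hgm (hSfin T) hgfin hgIb
  -- The map is built from the explicit solution with a measurable nonnegative representative of the
  -- inflow data; uniqueness later identifies it with the angular integral of any other solution.
  set G : W21 Ω τ → ℝ × E3 → ℝ := fun T => angularIntegral (rteSolution Ω (fourthPower T) g) with hG
  have hGm (T : W21 Ω τ) : Measurable (G T) :=
    measurable_angularIntegral (hD.measurable_rteSolution (hSm T) hgm)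
  have hGle (T : W21 Ω τ) : ∫⁻ q, ‖G T q‖ₑ ^ 2 ∂(cylinderMeasure Ω τ) ≤
      ENNReal.ofReal (s * (d * (2 * (N ^ 2 + d * (s * (κ ^ 4 * ‖T‖ ^ 8)))))) := by
    have := hD.lintegral_angularIntegral_rteSolution_sub_le (τ := τ) (a := N ^ 2)
      (b := κ ^ 4 * ‖T‖ ^ 8) hd (hSm T)
      (measurable_const (a := (0 : ℝ))) hgm (measurable_const (a := (0 : ℝ))) (hSfin T) (by simp)
      hgfin (by simp) (by positivity) (by positivity) hd0.le
      (by simpa using hg2.le) (by simpa using lintegral_fourthPower_sq hK T)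
    simpa only [rteSolution_zero, angularIntegral_zero, sub_zero] using this
  have hGL (T : W21 Ω τ) : MemLp (G T) 2 (cylinderMeasure Ω τ) :=
    (memLp_two_iff_lintegral (hGm T).aestronglyMeasurable).2
      ((hGle T).trans_lt ENNReal.ofReal_lt_top)
  have hcoe (T : W21 Ω τ) := (hGL T).coeFn_toLp
  -- Both solutions share the same inflow data, so the boundary contribution is `0` and only the
  -- difference of the sources remains.
  have hdiff (T U : W21 Ω τ) : ‖(hGL T).toLp (G T) - (hGL U).toLp (G U)‖ ≤
      √(s * (d * (2 * (0 + d * (s *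
        (16 * (κ ^ 4 * ‖T - U‖ ^ 2 * (‖T‖ ^ 6 + ‖U‖ ^ 6)))))))) := by
    refine norm_le_of_lintegral _ ?_
    refine le_trans (le_of_eq (lintegral_congr_ae ?_))
      (hD.lintegral_angularIntegral_rteSolution_sub_le (τ := τ) hd (hSm T) (hSm U) hgm hgm
        (hSfin T) (hSfin U) hgfin hgfin le_rfl (by positivity) hd0.le (by simp)
        (lintegral_fourthPower_sub_sq hK T U))
    filter_upwards [Lp.coeFn_sub ((hGL T).toLp (G T)) ((hGL U).toLp (G U)), hcoe T, hcoe U]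
      with q h1 h2 h3
    rw [h1, Pi.sub_apply, h2, h3]
  refine ⟨hSL, fun T => ⟨_, hsol T, ae_of_all _ fun p => ?_, fun J hJ =>
    hD.ae_eq_of_isRTESolution (hsol T) hJ⟩, fun T => (hGL T).toLp (G T), fun T I hI => ?_, ?_,
    fun T => ?_⟩
  · exact raySolution_nonneg (fun x => (by decide : Even 4).pow_nonneg _) (fun z => hg0 _) _
  · obtain ⟨D, γ, hmem, -⟩ := id hI
    filter_upwards [hcoe T, hD.ae_integrable_sphere hmem.memLp,
      hD.ae_ae_sphere (hD.ae_eq_of_isRTESolution (hsol T) hI)] with q h1 h2 h3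
    refine ⟨h2, ?_⟩
    rw [h1]
    exact (integral_congr_ae h3).symm
  · rw [continuous_iff_continuousAt]
    intro U
    rw [ContinuousAt, tendsto_iff_norm_sub_tendsto_zero]
    refine squeeze_zero (fun _ => norm_nonneg _) (fun T => hdiff T U) ?_
    -- The bound is continuous in `T` and vanishes at `T = U` through the factor `‖T - U‖ ^ 2`.
    have hcont : Continuous fun T : W21 Ω τ => √(s * (d * (2 * (0 + d * (s *
        (16 * (κ ^ 4 * ‖T - U‖ ^ 2 * (‖T‖ ^ 6 + ‖U‖ ^ 6)))))))) := by fun_prop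
    simpa using hcont.tendsto U
  · have h1 : ‖(hGL T).toLp (G T)‖ ≤
        √(s * (d * (2 * (N ^ 2 + d * (s * (κ ^ 4 * ‖T‖ ^ 8)))))) := by
      refine norm_le_of_lintegral _ (le_trans (le_of_eq (lintegral_congr_ae ?_)) (hGle T))
      filter_upwards [hcoe T] with q hq
      rw [hq]
    have h2 : s * (d * (2 * (N ^ 2 + d * (s * (κ ^ 4 * ‖T‖ ^ 8))))) ≤
        M * (‖T‖ ^ 4 + N) ^ 2 := by
      have hT : 0 ≤ ‖T‖ ^ 4 := by positivity
      have e8 : ‖T‖ ^ 8 = (‖T‖ ^ 4) ^ 2 := by ring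
      have a1 : N ^ 2 ≤ (‖T‖ ^ 4 + N) ^ 2 := by gcongr; linarith
      have a2 : ‖T‖ ^ 8 ≤ (‖T‖ ^ 4 + N) ^ 2 := by rw [e8]; gcongr; linarith
      calc s * (d * (2 * (N ^ 2 + d * (s * (κ ^ 4 * ‖T‖ ^ 8)))))
          ≤ s * (d * (2 * ((‖T‖ ^ 4 + N) ^ 2 + d * (s * (κ ^ 4 * (‖T‖ ^ 4 + N) ^ 2))))) := by
            gcongr
        _ = _ := by rw [hM]; ring
    calc _ ≤ √(M * (‖T‖ ^ 4 + N) ^ 2) := h1.trans (Real.sqrt_le_sqrt h2)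
      _ = √M * (‖T‖ ^ 4 + N) := by
        rw [Real.sqrt_mul hM0, Real.sqrt_sq (by positivity)]
      _ ≤ (√M + 1) * (‖T‖ ^ 4 + N) := by gcongr; linarith
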